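/- Let $\Omega=[0,\ell_x]\times[0,\ell_y]\times[0,\ell_z]$ with $\ell_x,\ell_y,\ell_z>0$. **Equation.** Let $\varepsilon>0$, $\eta\in\mathbb R$, and let $u:\Omega\times[0,\infty)\to\mathbb R$ be a $C^6$ solution (jointly in space and time, up to the boundary) of the Swift–Hohenberg equation $$\partial_t u=-\bigl(u^3+(1-\eta)u+\varepsilon\Delta^2u+2\Delta u\bigr),\qquad \nabla u\cdot n=\nabla(\Delta u)\cdot n=0\ \text{on }\partial\Omega,$$ with $u_0=u(\cdot,0)$ and energy $\mathcal H(v)=\int_\Omega\bigl(\tfrac14v^4+\tfrac{1-\eta}2v^2+\tfrac\varepsilon2(\Delta v)^2-|\nabla v|^2\bigr)dx$. **Scheme.** For integers $N_x,N_y,N_z\ge1$ let $\Delta x=\ell_x/N_x$, $\Delta y=\ell_y/N_y$, $\Delta z=\ell_z/N_z$. Let $\nabla_d^{\pm}$ be the forward and backward difference gradients, $\Delta_d=\nabla_d^+\cdot\nabla_d^-$, let $\langle f\rangle_d$ be the trapezoidal sum of a grid function $f$ over the grid $0\le i\le N_x$, $0\le j\le N_y$, $0\le k\le N_z$ (weight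 $\tfrac12$ at the end points in each direction) times $\Delta x\Delta y\Delta z$, and $\|f\|_d=\langle f^2\rangle_d^{1/2}$. Write $|Df|^2=\tfrac12(|\nabla_d^+f|^2+|\nabla_d^-f|^2)$. The discrete boundary conditions for $f$ require that, at the grid points of each face, the central differences of $f$ and of $\Delta_df$ in the normal direction vanish (they fix the needed ghost values). The discrete energy is $$H_d(f)=\bigl\langle\tfrac14f^4+\tfrac{1-\eta}2f^2-|Df|^2+\tfrac\varepsilon2(\Delta_df)^2\bigr\rangle_d .$$ Let $\Delta t>0$. The grid functions $U^n$ satisfy the discrete boundary conditions and, on the grid, $$\frac{U^{n+1}-U^n}{\Delta t}=\begin{cases}-\bigl[(U^n)^3+(1-\eta)U^{n+1}+\varepsilon\Delta_d^2U^{n+1}+2\Delta_dU^n\bigr]&(\eta<1),\\-\bigl[(U^n)^3+\varepsilon\Delta_d^2U^{n+1}-\{(\eta-1)U^n-2\Delta_dU^n\}\bigr]&(\eta\ge1),\end{cases}$$ with consistent initial data $U^0_{i,j,k}=u_0(i\Delta x,j\Delta y,k\Delta z)$. **Constants.** There are constants $C$ and $C'$ such that $$\max_{\text{grid}}|f|\le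 C\bigl(\langle f^2\rangle_d+\langle|Df|^2\rangle_d+\langle(\Delta_df)^2\rangle_d\bigr)^{1/2}$$ for every mesh as above on $\Omega$ and every grid function $f$ satisfying the discrete boundary conditions, and $$\max_\Omega|v|\le C'\Bigl(\int_\Omega(v^2+|\nabla v|^2+(\Delta v)^2)\,dx\Bigr)^{1/2}$$ for every $v\in C^4(\Omega)$ with $\nabla v\cdot n=\nabla(\Delta v)\cdot n=0$ on $\partial\Omega$. Fix any such $C,C'$ and any $\zeta>\frac1\varepsilon+\eta-1$, and put $$C_{\varepsilon,\eta,\zeta}=\tfrac16\Bigl(\varepsilon+1-\eta+\zeta-\sqrt{(\varepsilon-1+\eta-\zeta)^2+4}\Bigr),$$ $$M=\max\Bigl\{\sqrt{\max\{0,\zeta\}},\ \sqrt{\tfrac{C^2}{C_{\varepsilon,\eta,\zeta}}\bigl(H_d(U^0)+\tfrac{\zeta^2}4|\Omega|\bigr)}\Bigr\},\qquad M'=\max\Bigl\{M,\ \sqrt{\tfrac{C'^2}{C_{\varepsilon,\eta,\zeta}}\bigl(\mathcal H(u_0)+\tfrac{\zeta^2}4|\Omega|\bigr)}\Bigr\},$$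 and $\hat L=3M'^2-|1-\eta|$. **Theorem.** Assume $\hat L\ne0$ and that $\Delta t$ satisfies the following restriction: 1. $3M^2\le|1-\eta|$, or $3M^2>|1-\eta|$ and $\Delta t\le\frac{2}{3M^2-|1-\eta|}$; 2. $\hat L<0$, or $\hat L>0$ and $\Delta t<\frac2{\hat L}$. Then the numerical solution converges to the exact solution in the discrete $L^2$ norm with rate $O(\Delta t+\Delta x^2+\Delta y^2+\Delta z^2)$: for every $T>0$ there is a constant $K$, independent of $N_x,N_y,N_z$ and of $\Delta t$, such that for all such meshes, time steps and numerical solutions, and all $n\ge0$ with $n\Delta t\le T$, $$\|U^n-u(\cdot,n\Delta t)\|_d\le K\bigl(\Delta t+\Delta x^2+\Delta y^2+\Delta z^2\bigr),$$ where $u(\cdot,n\Delta t)$ is evaluated at the grid points. Moreover, the restriction on $\Delta t$ is mesh-independent in the following sense: there is $\tau_0>0$, independent of the mesh, such that on every mesh with $\hat L\ne0$ each $\Delta t\in(0,\tau_0]$ satisfies 1 and 2. -/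

import Mathlib

namespace SwiftHohenberg

/-! ### The continuous problem on a box in three dimensions -/

/-- The closed box `[0, ℓ 0] × [0, ℓ 1] × [0, ℓ 2]`. -/
def box (ℓ : Fin 3 → ℝ) : Set (Fin 3 → ℝ) := Set.Icc 0 ℓ

/-- The volume of the box. -/
noncomputable def boxVolume (ℓ : Fin 3 → ℝ) : ℝ := ∏ i, ℓ i

/-- Partial derivative in the `i`-th coordinate on the closed box (one-sided on the two faces
orthogonal to the `i`-th axis). -/
noncomputable def partialDeriv (ℓ : Fin 3 → ℝ) (i : Fin 3) (v : (Fin 3 → ℝ) → ℝ) :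
    (Fin 3 → ℝ) → ℝ :=
  fun p => derivWithin (fun s => v (Function.update p i s)) (Set.Icc 0 (ℓ i)) (p i)

/-- The Laplacian on the closed box. -/
noncomputable def lap (ℓ : Fin 3 → ℝ) (v : (Fin 3 → ℝ) → ℝ) : (Fin 3 → ℝ) → ℝ :=
  fun p => ∑ i, partialDeriv ℓ i (partialDeriv ℓ i v) p

/-- The squared Euclidean length of the gradient on the closed box. -/
noncomputable def gradSq (ℓ : Fin 3 → ℝ) (v : (Fin 3 → ℝ) → ℝ) : (Fin 3 → ℝ) → ℝ :=
  fun p => ∑ i, partialDeriv ℓ i v p ^ 2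

/-- The boundary conditions `∇v · n = 0` and `∇(Δv) · n = 0`, on each of the six faces. -/
def NeumannBC (ℓ : Fin 3 → ℝ) (v : (Fin 3 → ℝ) → ℝ) : Prop :=
  ∀ i, ∀ p ∈ box ℓ, p i = 0 ∨ p i = ℓ i →
    partialDeriv ℓ i v p = 0 ∧ partialDeriv ℓ i (lap ℓ v) p = 0

/-- `u p t` solves the Swift--Hohenberg equation
`∂u/∂t = -(u³ + (1 - η) u + ε Δ²u + 2 Δu)` on the box, for all times `t ≥ 0`,
with the Neumann boundary conditions. -/
structure IsSolution (ℓ : Fin 3 → ℝ) (ε η : ℝ) (u : (Fin 3 → ℝ) → ℝ → ℝ) : Prop where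
  pde : ∀ p ∈ box ℓ, ∀ t, 0 ≤ t →
    derivWithin (fun s => u p s) (Set.Ici 0) t =
      -(u p t ^ 3 + (1 - η) * u p t + ε * lap ℓ (lap ℓ (fun q => u q t)) p
        + 2 * lap ℓ (fun q => u q t) p)
  bc : ∀ t, 0 ≤ t → NeumannBC ℓ (fun q => u q t)

/-- The continuous energy
`∫ (u⁴/4 + (1 - η) u²/2 + ε (Δu)²/2 - |∇u|²)` over the box. -/
noncomputable def energy (ℓ : Fin 3 → ℝ) (ε η : ℝ) (v : (Fin 3 → ℝ) → ℝ) : ℝ :=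
  ∫ p in box ℓ, (1 / 4 * v p ^ 4 + (1 - η) / 2 * v p ^ 2 + ε / 2 * lap ℓ v p ^ 2 - gradSq ℓ v p)

/-- `C'` is a constant in the Sobolev inequality
`max |v| ≤ C' (‖v‖² + ‖∇v‖² + ‖Δv‖²)^(1/2)` for functions on the box that satisfy the
boundary conditions. -/
def IsSobolevConst (ℓ : Fin 3 → ℝ) (C' : ℝ) : Prop :=
  ∀ v : (Fin 3 → ℝ) → ℝ, ContDiffOn ℝ 4 v (box ℓ) → NeumannBC ℓ v →
    ∀ p ∈ box ℓ, |v p| ≤ C' * √(∫ q in box ℓ, (v q ^ 2 + gradSq ℓ v q + lap ℓ v q ^ 2))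

/-! ### Grid functions

A grid function is indexed by all of `ℤ³`; the grid proper consists of the indices `k` with
`0 ≤ k i ≤ N i`, and the other values are ghost values, constrained only by the discrete
boundary conditions. -/

/-- The indices of the grid. -/
noncomputable def gridIdx (N : Fin 3 → ℕ) : Finset (Fin 3 → ℤ) :=
  Fintype.piFinset (fun i => Finset.Icc (0 : ℤ) (N i : ℤ))

/-- The mesh sizes `Δx, Δy, Δz`. -/
noncomputable def mesh (ℓ : Fin 3 → ℝ) (N : Fin 3 → ℕ) : Fin 3 → ℝ := fun i => ℓ i / N i

/-- The grid point with index `k`. -/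
noncomputable def gridPt (h : Fin 3 → ℝ) (k : Fin 3 → ℤ) : Fin 3 → ℝ := fun i => k i * h i

/-- Forward difference in direction `i`. -/
noncomputable def dPlus (h : Fin 3 → ℝ) (i : Fin 3) (f : (Fin 3 → ℤ) → ℝ) :
    (Fin 3 → ℤ) → ℝ :=
  fun k => (f (k + Pi.single i 1) - f k) / h i

/-- Backward difference in direction `i`. -/
noncomputable def dMinus (h : Fin 3 → ℝ) (i : Fin 3) (f : (Fin 3 → ℤ) → ℝ) :
    (Fin 3 → ℤ) → ℝ :=
  fun k => (f k - f (k - Pi.single i 1)) / h i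

/-- Central difference in direction `i`. -/
noncomputable def dCtr (h : Fin 3 → ℝ) (i : Fin 3) (f : (Fin 3 → ℤ) → ℝ) :
    (Fin 3 → ℤ) → ℝ :=
  fun k => (f (k + Pi.single i 1) - f (k - Pi.single i 1)) / (2 * h i)

/-- The discrete Laplacian. -/
noncomputable def dLap (h : Fin 3 → ℝ) (f : (Fin 3 → ℤ) → ℝ) : (Fin 3 → ℤ) → ℝ :=
  fun k => ∑ i, dPlus h i (dMinus h i f) k

/-- `(|∇⁺f|² + |∇⁻f|²) / 2`. -/
noncomputable def dGradSq (h : Fin 3 → ℝ) (f : (Fin 3 → ℤ) → ℝ) : (Fin 3 → ℤ) → ℝ :=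
  fun k => (∑ i, dPlus h i f k ^ 2 + ∑ i, dMinus h i f k ^ 2) / 2

/-- The weight of the trapezoidal rule: `1/2` at both ends, `1` in between. -/
noncomputable def trapWeight (N : ℕ) (m : ℤ) : ℝ := if m = 0 ∨ m = N then 1 / 2 else 1

/-- The trapezoidal sum of `f` over the grid in all three directions, times `Δx Δy Δz`. -/
noncomputable def gridSum (h : Fin 3 → ℝ) (N : Fin 3 → ℕ) (f : (Fin 3 → ℤ) → ℝ) : ℝ :=
  (∑ k ∈ gridIdx N, (∏ i, trapWeight (N i) (k i)) * f k) * ∏ i, h i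

/-- The discrete `L²` norm. -/
noncomputable def dNorm (h : Fin 3 → ℝ) (N : Fin 3 → ℕ) (f : (Fin 3 → ℤ) → ℝ) : ℝ :=
  √(gridSum h N (fun k => f k ^ 2))

/-- The discrete boundary conditions: the central differences of `f` and of its discrete Laplacian
in the normal direction vanish at all grid points of the faces. -/
def DiscreteBC (h : Fin 3 → ℝ) (N : Fin 3 → ℕ) (f : (Fin 3 → ℤ) → ℝ) : Prop :=
  ∀ i, ∀ k ∈ gridIdx N, k i = 0 ∨ k i = N i →
    dCtr h i f k = 0 ∧ dCtr h i (dLap h f) k = 0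

/-- `C` is a constant in the discrete Sobolev inequality, uniformly in the mesh. -/
def IsDiscreteSobolevConst (ℓ : Fin 3 → ℝ) (C : ℝ) : Prop :=
  ∀ N : Fin 3 → ℕ, (∀ i, 0 < N i) → ∀ f : (Fin 3 → ℤ) → ℝ, DiscreteBC (mesh ℓ N) N f →
    ∀ k ∈ gridIdx N, |f k| ≤
      C * √(gridSum (mesh ℓ N) N (fun m => f m ^ 2)
        + gridSum (mesh ℓ N) N (dGradSq (mesh ℓ N) f)
        + gridSum (mesh ℓ N) N (fun m => dLap (mesh ℓ N) f m ^ 2))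

/-- The discrete energy. -/
noncomputable def dEnergy (h : Fin 3 → ℝ) (N : Fin 3 → ℕ) (ε η : ℝ)
    (f : (Fin 3 → ℤ) → ℝ) : ℝ :=
  gridSum h N (fun k => 1 / 4 * f k ^ 4) + gridSum h N (fun k => (1 - η) / 2 * f k ^ 2)
    - gridSum h N (dGradSq h f) + gridSum h N (fun k => ε / 2 * dLap h f k ^ 2)

/-- The sequence of grid functions `U` satisfies the linearly implicit scheme with time step `τ`. -/
structure IsSchemeSolution (h : Fin 3 → ℝ) (N : Fin 3 → ℕ) (ε η τ : ℝ)
    (U : ℕ → (Fin 3 → ℤ) → ℝ) : Prop where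
  step : ∀ n, ∀ k ∈ gridIdx N,
    (U (n + 1) k - U n k) / τ =
      if η < 1 then
        -(U n k ^ 3 + ((1 - η) * U (n + 1) k + ε * dLap h (dLap h (U (n + 1))) k)
          + 2 * dLap h (U n) k)
      else
        -(U n k ^ 3 + ε * dLap h (dLap h (U (n + 1))) k
          - ((η - 1) * U n k - 2 * dLap h (U n) k))
  bc : ∀ n, DiscreteBC h N (U n)

/-- The grid function `f` has, on the grid, the values of `v`. -/
def Samples (h : Fin 3 → ℝ) (N : Fin 3 → ℕ) (f : (Fin 3 → ℤ) → ℝ) (v : (Fin 3 → ℝ) → ℝ) : Prop :=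
  ∀ k ∈ gridIdx N, f k = v (gridPt h k)

/-! ### The constants and the restriction on the time step -/

/-- The constant `C_{ε,η,ζ}`. -/
noncomputable def coercConst (ε η ζ : ℝ) : ℝ :=
  (ε + 1 - η + ζ - √((ε - 1 + η - ζ) ^ 2 + 4)) / 6

/-- The bound `√(C² / C_{ε,η,ζ} · (E + ζ²|Ω|/4))` attached to an energy value `E`. -/
noncomputable def energyBound (ℓ : Fin 3 → ℝ) (ε η ζ C E : ℝ) : ℝ :=
  √(C ^ 2 / coercConst ε η ζ * (E + ζ ^ 2 / 4 * boxVolume ℓ))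

/-- The constant `M`, for the discrete initial value `U₀`. -/
noncomputable def constM (ℓ : Fin 3 → ℝ) (N : Fin 3 → ℕ) (ε η ζ C : ℝ)
    (U₀ : (Fin 3 → ℤ) → ℝ) : ℝ :=
  max (√(max 0 ζ)) (energyBound ℓ ε η ζ C (dEnergy (mesh ℓ N) N ε η U₀))

/-- The constant `M'`, for the discrete initial value `U₀` and the exact one `u₀`. -/
noncomputable def constM' (ℓ : Fin 3 → ℝ) (N : Fin 3 → ℕ) (ε η ζ C C' : ℝ)
    (U₀ : (Fin 3 → ℤ) → ℝ) (u₀ : (Fin 3 → ℝ) → ℝ) : ℝ :=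
  max (constM ℓ N ε η ζ C U₀) (energyBound ℓ ε η ζ C' (energy ℓ ε η u₀))

/-- The constant `L̂ = 3 M'² - |1 - η|`. -/
noncomputable def constLhat (η M' : ℝ) : ℝ := 3 * M' ^ 2 - |1 - η|

/-- The two restrictions on the time step `τ`: the one for stability, in terms of `M`, and the
one for the error estimate, in terms of `L̂`. -/
def StepRestriction (η M Lhat τ : ℝ) : Prop :=
  (3 * M ^ 2 ≤ |1 - η| ∨ (|1 - η| < 3 * M ^ 2 ∧ τ ≤ 2 / (3 * M ^ 2 - |1 - η|))) ∧
    (Lhat < 0 ∨ (0 < Lhat ∧ τ < 2 / Lhat))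

end SwiftHohenberg

open SwiftHohenberg

namespace SwiftHohenberg

/-! ### Trapezoidal sums -/

/-! The rate rests on two facts: the numerical solution stays in a sup-norm ball whose radius is
bounded independently of the mesh, and the sampled exact solution satisfies the scheme up to `O(τ +
∑ h i ^ 2)`. On such a ball the cubic is Lipschitz, so testing the error equation with the new error
and applying a discrete Gronwall inequality finishes the argument (`error_step`,
`discrete_gronwall`, `exists_error_bound`).

Stability: summation by parts (`gridSum_mul_dLap`) lets one test the scheme with the increment. The
second-order Taylor bound for the quartic would need a bound on the new iterate, which is what is
being proved. The circle is broken by continuing `s ^ 4 / 4` quadratically outside `[-M, M]`: the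
new potential has second derivative at most `3 * M ^ 2` everywhere, so the modified energy decreases
with no assumption on the new iterate (`truncQuartic_le`, `energy_step`). The modified energy still
controls `f`, its gradient and its Laplacian (`le_truncQuartic`, `coercive`), so the Sobolev
inequality bounds the new iterate by `M`, and the truncation turns out to be inactive
(`scheme_le_constM`). A uniform bound on the initial discrete energy (`exists_dEnergy_le`) makes `M`
mesh-independent, which also gives the uniform time step threshold.

Consistency: the solution is extended evenly across the faces, so that centred differences at the
boundary are ordinary ones. Second-order accuracy of the discrete bilaplacian needs the normal
derivatives of orders 1, 3 and 5 to vanish on the faces. The first two come from the boundary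
conditions; the fifth comes from differentiating the equation in the normal direction
(`neumann_fourth_of_isSolution`).

Sobolev constants: the discrete inequality follows by writing `f` through the Green function of `1 -
dLap` in the cosine basis. Its `L²` norm is bounded uniformly in the mesh because `∑ (1 + |ξ|²)⁻²`
converges over a three-dimensional lattice (`exists_strong_discreteSobolev`). The continuous
inequality is its limit under mesh refinement (`exists_isSobolevConst`). -/

theorem mem_gridIdx {N : Fin 3 → ℕ} {k : Fin 3 → ℤ} :
    k ∈ gridIdx N ↔ ∀ i, 0 ≤ k i ∧ k i ≤ N i := by
  simp [gridIdx, Fintype.mem_piFinset]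

theorem trapWeight_nonneg (N : ℕ) (m : ℤ) : 0 ≤ trapWeight N m := by
  unfold trapWeight; split_ifs <;> norm_num

theorem trapWeight_le_one (N : ℕ) (m : ℤ) : trapWeight N m ≤ 1 := by
  unfold trapWeight; split_ifs <;> norm_num

theorem trapWeight_pos (N : ℕ) (m : ℤ) : 0 < trapWeight N m := by
  unfold trapWeight; split_ifs <;> norm_num

theorem sum_Icc_int_eq_sum_range (N : ℕ) (F : ℤ → ℝ) :
    ∑ m ∈ Finset.Icc (0 : ℤ) N, F m = ∑ j ∈ Finset.range (N + 1), F j := by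
  symm
  refine Finset.sum_bij (fun (j : ℕ) _ => (j : ℤ)) ?_ ?_ ?_ ?_
  · intro j hj
    have := Finset.mem_range.1 hj
    simp only [Finset.mem_Icc]; omega
  · intro a _ b _ hab
    exact_mod_cast hab
  · intro m hm
    obtain ⟨h0, h1⟩ := Finset.mem_Icc.1 hm
    exact ⟨m.toNat, by rw [Finset.mem_range]; omega, by omega⟩
  · intros; rfl

theorem sum_trapWeight_mul (M : ℕ) (F : ℤ → ℝ) :
    ∑ m ∈ Finset.Icc (0 : ℤ) (M + 1 : ℕ), trapWeight (M + 1) m * F m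
      = F 0 / 2 + ∑ j ∈ Finset.range M, F (j + 1) + F (M + 1) / 2 := by
  rw [sum_Icc_int_eq_sum_range, Finset.sum_range_succ, Finset.sum_range_succ']
  have h1 : ∀ j ∈ Finset.range M,
      trapWeight (M + 1) ((j + 1 : ℕ) : ℤ) * F ((j + 1 : ℕ) : ℤ) = F (j + 1) := by
    intro j hj
    have hj' := Finset.mem_range.1 hj
    have : ¬ (((j + 1 : ℕ) : ℤ) = 0 ∨ ((j + 1 : ℕ) : ℤ) = ((M + 1 : ℕ) : ℤ)) := by omega
    rw [trapWeight, if_neg this]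
    push_cast; ring
  rw [Finset.sum_congr rfl h1]
  simp only [trapWeight, Nat.cast_zero, true_or, or_true, if_true]
  push_cast; ring

theorem sum_trapWeight (N : ℕ) (hN : 0 < N) :
    ∑ m ∈ Finset.Icc (0 : ℤ) N, trapWeight N m = N := by
  obtain ⟨M, rfl⟩ : ∃ M, N = M + 1 := ⟨N - 1, by omega⟩
  have := sum_trapWeight_mul M (fun _ => 1)
  simp only [mul_one, Finset.sum_const, Finset.card_range, nsmul_eq_mul] at this
  rw [this]; push_cast; ring

/-- The interior terms telescope to `q (N - 1) - q 0`. At each end the flux is odd under reflection,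
so the end difference is twice one flux value, and the weight `1/2` makes it cancel exactly. -/
theorem sum_trapWeight_mul_sub (N : ℕ) (hN : 0 < N) (q : ℤ → ℝ) (h0 : q (-1) = -q 0)
    (h1 : q N = -q (N - 1)) :
    ∑ m ∈ Finset.Icc (0 : ℤ) N, trapWeight N m * (q m - q (m - 1)) = 0 := by
  obtain ⟨M, rfl⟩ : ∃ M, N = M + 1 := ⟨N - 1, by omega⟩
  rw [sum_trapWeight_mul M (fun m => q m - q (m - 1))]
  have h2 : ∑ j ∈ Finset.range M, (q ((j : ℤ) + 1) - q ((j : ℤ) + 1 - 1)) = q M - q 0 := by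
    have := Finset.sum_range_sub (fun j : ℕ => q (j : ℤ)) M
    simpa using this
  rw [h2]
  push_cast at h1
  simp only [zero_sub, add_sub_cancel_right] at h1 ⊢
  rw [h0, h1]; ring

/-- Fubini: the grid is fibred into lines parallel to the `i`-th axis, each represented by its point
with `i`-th coordinate `0`; the transverse weights are constant along a line and factor out. -/
theorem sum_gridIdx_eq_zero {N : Fin 3 → ℕ} (i : Fin 3) (Q : (Fin 3 → ℤ) → ℝ)
    (hQ : ∀ k ∈ gridIdx N,
      ∑ m ∈ Finset.Icc (0 : ℤ) (N i), trapWeight (N i) m * Q (Function.update k i m) = 0) :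
    ∑ k ∈ gridIdx N, (∏ j, trapWeight (N j) (k j)) * Q k = 0 := by
  classical
  have hmaps : ∀ k ∈ gridIdx N, Function.update k i 0 ∈ gridIdx N := by
    intro k hk
    rw [mem_gridIdx] at hk ⊢
    intro j
    by_cases hj : j = i
    · subst hj; simp
    · simpa [hj] using hk j
  rw [← Finset.sum_fiberwise_of_maps_to hmaps]
  refine Finset.sum_eq_zero fun k₀ hk₀ => ?_
  by_cases h0 : k₀ i = 0
  · have himg : (gridIdx N).filter (fun k => Function.update k i 0 = k₀)
        = (Finset.Icc (0 : ℤ) (N i)).image (fun m => Function.update k₀ i m) := by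
      ext k
      simp only [Finset.mem_filter, Finset.mem_image, Finset.mem_Icc]
      constructor
      · rintro ⟨hk, rfl⟩
        exact ⟨k i, mem_gridIdx.1 hk i, by simp⟩
      · rintro ⟨m, hm, rfl⟩
        refine ⟨?_, by rw [Function.update_idem, ← h0, Function.update_eq_self]⟩
        rw [mem_gridIdx] at hk₀ ⊢
        intro j
        by_cases hj : j = i
        · subst hj; simpa using hm
        · simpa [hj] using hk₀ j
    rw [himg, Finset.sum_image]
    · have : ∀ m ∈ Finset.Icc (0 : ℤ) (N i),
          (∏ j, trapWeight (N j) (Function.update k₀ i m j)) * Q (Function.update k₀ i m)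
          = (∏ j ∈ Finset.univ.erase i, trapWeight (N j) (k₀ j)) *
            (trapWeight (N i) m * Q (Function.update k₀ i m)) := by
        intro m _
        rw [← Finset.mul_prod_erase Finset.univ _ (Finset.mem_univ i)]
        rw [Finset.prod_congr rfl (fun j hj => by
          rw [Function.update_of_ne (Finset.ne_of_mem_erase hj)])]
        rw [Function.update_self]; ring
      rw [Finset.sum_congr rfl this, ← Finset.mul_sum, hQ k₀ hk₀, mul_zero]
    · intro a _ b _ hab
      simpa using congrFun hab i
  · refine Finset.sum_eq_zero fun k hk => ?_
    rw [Finset.mem_filter] at hk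
    exact absurd (by rw [← hk.2]; simp) h0

section Sums

variable (h : Fin 3 → ℝ) (N : Fin 3 → ℕ)

theorem gridSum_add (f g : (Fin 3 → ℤ) → ℝ) :
    gridSum h N (fun k => f k + g k) = gridSum h N f + gridSum h N g := by
  simp only [gridSum, mul_add, Finset.sum_add_distrib, add_mul]

theorem gridSum_const_mul (c : ℝ) (f : (Fin 3 → ℤ) → ℝ) :
    gridSum h N (fun k => c * f k) = c * gridSum h N f := by
  simp only [gridSum]
  rw [← mul_assoc, Finset.mul_sum]
  congr 1
  exact Finset.sum_congr rfl fun k _ => by ring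

theorem gridSum_neg (f : (Fin 3 → ℤ) → ℝ) :
    gridSum h N (fun k => - f k) = - gridSum h N f := by
  have := gridSum_const_mul h N (-1) f
  simpa using this

theorem gridSum_sub (f g : (Fin 3 → ℤ) → ℝ) :
    gridSum h N (fun k => f k - g k) = gridSum h N f - gridSum h N g := by
  simp only [gridSum, mul_sub, Finset.sum_sub_distrib, sub_mul]

variable {h N}

theorem gridSum_congr {f g : (Fin 3 → ℤ) → ℝ} (hfg : ∀ k ∈ gridIdx N, f k = g k) :
    gridSum h N f = gridSum h N g := by
  simp only [gridSum]
  congr 1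
  exact Finset.sum_congr rfl fun k hk => by rw [hfg k hk]

theorem gridSum_mono (hh : ∀ i, 0 < h i) {f g : (Fin 3 → ℤ) → ℝ}
    (hfg : ∀ k ∈ gridIdx N, f k ≤ g k) : gridSum h N f ≤ gridSum h N g := by
  simp only [gridSum]
  refine mul_le_mul_of_nonneg_right (Finset.sum_le_sum fun k hk => ?_)
    (Finset.prod_nonneg fun i _ => (hh i).le)
  exact mul_le_mul_of_nonneg_left (hfg k hk)
    (Finset.prod_nonneg fun i _ => trapWeight_nonneg _ _)

theorem gridSum_nonneg (hh : ∀ i, 0 < h i) {f : (Fin 3 → ℤ) → ℝ}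
    (hf : ∀ k ∈ gridIdx N, 0 ≤ f k) : 0 ≤ gridSum h N f := by
  have := gridSum_mono (f := fun _ => 0) hh hf
  simpa [gridSum] using this

end Sums

theorem sum_gridIdx_prod (N : Fin 3 → ℕ) (F : Fin 3 → ℤ → ℝ) :
    ∑ k ∈ gridIdx N, ∏ i, F i (k i) = ∏ i, ∑ m ∈ Finset.Icc (0 : ℤ) (N i), F i m := by
  rw [Finset.prod_univ_sum]; rfl

theorem mesh_pos {ℓ : Fin 3 → ℝ} (hℓ : ∀ i, 0 < ℓ i) {N : Fin 3 → ℕ} (hN : ∀ i, 0 < N i)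
    (i : Fin 3) : 0 < mesh ℓ N i :=
  div_pos (hℓ i) (Nat.cast_pos.2 (hN i))

theorem gridSum_const {ℓ : Fin 3 → ℝ} {N : Fin 3 → ℕ} (hN : ∀ i, 0 < N i)
    (c : ℝ) : gridSum (mesh ℓ N) N (fun _ => c) = c * boxVolume ℓ := by
  have h1 : ∑ k ∈ gridIdx N, ∏ i, trapWeight (N i) (k i) = ∏ i, (N i : ℝ) := by
    rw [sum_gridIdx_prod]
    exact Finset.prod_congr rfl fun i _ => sum_trapWeight _ (hN i)
  rw [gridSum, ← Finset.sum_mul, h1, boxVolume, mul_right_comm, ← Finset.prod_mul_distrib, mul_comm]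
  congr 1
  refine Finset.prod_congr rfl fun i _ => ?_
  have : (N i : ℝ) ≠ 0 := Nat.cast_ne_zero.2 (hN i).ne'
  rw [mesh]; field_simp

theorem boxVolume_pos {ℓ : Fin 3 → ℝ} (hℓ : ∀ i, 0 < ℓ i) : 0 < boxVolume ℓ :=
  Finset.prod_pos fun i _ => hℓ i

/-! ### Summation by parts -/

/-- Across each face of the grid, the values of `f` at the two neighbours agree. -/
def Reflects (N : Fin 3 → ℕ) (f : (Fin 3 → ℤ) → ℝ) : Prop :=
  ∀ i, ∀ k ∈ gridIdx N, k i = 0 ∨ k i = N i → f (k + Pi.single i 1) = f (k - Pi.single i 1)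

theorem dCtr_eq_zero_iff {h : Fin 3 → ℝ} (hh : ∀ i, 0 < h i) (i : Fin 3) (f : (Fin 3 → ℤ) → ℝ)
    (k : Fin 3 → ℤ) : dCtr h i f k = 0 ↔ f (k + Pi.single i 1) = f (k - Pi.single i 1) := by
  have := (hh i).ne'
  rw [dCtr, div_eq_zero_iff]
  simp [this, sub_eq_zero]

theorem discreteBC_iff {h : Fin 3 → ℝ} (hh : ∀ i, 0 < h i) {N : Fin 3 → ℕ}
    {f : (Fin 3 → ℤ) → ℝ} :
    DiscreteBC h N f ↔ Reflects N f ∧ Reflects N (dLap h f) := by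
  simp only [DiscreteBC, Reflects, dCtr_eq_zero_iff hh]
  exact ⟨fun H => ⟨fun i k hk hki => (H i k hk hki).1, fun i k hk hki => (H i k hk hki).2⟩,
    fun H i k hk hki => ⟨H.1 i k hk hki, H.2 i k hk hki⟩⟩

theorem Reflects.sub {N : Fin 3 → ℕ} {f g : (Fin 3 → ℤ) → ℝ} (hf : Reflects N f)
    (hg : Reflects N g) : Reflects N (fun k => f k - g k) := fun i k hk hki => by
  simp only [hf i k hk hki, hg i k hk hki]

/-- The polarization of `dGradSq`. -/
noncomputable def dGradInner (h : Fin 3 → ℝ) (f g : (Fin 3 → ℤ) → ℝ) (k : Fin 3 → ℤ) : ℝ :=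
  (∑ i, dPlus h i f k * dPlus h i g k + ∑ i, dMinus h i f k * dMinus h i g k) / 2

theorem dGradInner_self (h : Fin 3 → ℝ) (f : (Fin 3 → ℤ) → ℝ) : dGradInner h f f = dGradSq h f := by
  ext k; simp only [dGradInner, dGradSq, pow_two]

theorem dGradInner_comm (h : Fin 3 → ℝ) (f g : (Fin 3 → ℤ) → ℝ) :
    dGradInner h f g = dGradInner h g f := by
  ext k; simp only [dGradInner, mul_comm]

theorem dPlus_dMinus (h : Fin 3 → ℝ) (i : Fin 3) (f : (Fin 3 → ℤ) → ℝ) (k : Fin 3 → ℤ) :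
    dPlus h i (dMinus h i f) k
      = (f (k + Pi.single i 1) - 2 * f k + f (k - Pi.single i 1)) / h i ^ 2 := by
  simp only [dPlus, dMinus, add_sub_cancel_right]
  rw [← sub_div, div_div, pow_two]; ring

theorem dLap_sub (h : Fin 3 → ℝ) (f g : (Fin 3 → ℤ) → ℝ) :
    dLap h (fun k => f k - g k) = fun k => dLap h f k - dLap h g k := by
  ext k
  simp only [dLap, dPlus_dMinus, ← Finset.sum_sub_distrib]
  exact Finset.sum_congr rfl fun i _ => by ring

/-- Direction by direction, `f * dLap h g` plus the averaged gradient product is a difference of the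
flux `(f (k+1) + f k) * (g (k+1) - g k)` divided by `2 * h i ^ 2`. Since `f` and `g` are even across
the faces, this flux is odd there, so its trapezoidal sum vanishes. Averaging forward and backward
gradients is what makes the identity exact, without boundary terms. -/
theorem gridSum_mul_dLap {h : Fin 3 → ℝ} (hh : ∀ i, 0 < h i) {N : Fin 3 → ℕ} (hN : ∀ i, 0 < N i)
    {f g : (Fin 3 → ℤ) → ℝ} (hf : Reflects N f) (hg : Reflects N g) :
    gridSum h N (fun k => f k * dLap h g k) = - gridSum h N (dGradInner h f g) := by
  have key : ∀ i : Fin 3, ∑ k ∈ gridIdx N, (∏ j, trapWeight (N j) (k j)) *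
      ((f (k + Pi.single i 1) + f k) * (g (k + Pi.single i 1) - g k)
        - (f k + f (k - Pi.single i 1)) * (g k - g (k - Pi.single i 1))) = 0 := by
    intro i
    refine sum_gridIdx_eq_zero i _ fun k hk => ?_
    have e1 : ∀ m : ℤ, Function.update k i m + Pi.single i 1 = Function.update k i (m + 1) := by
      intro m; ext j; by_cases hj : j = i
      · subst hj; simp
      · simp [hj]
    have e2 : ∀ m : ℤ, Function.update k i m - Pi.single i 1 = Function.update k i (m - 1) := by
      intro m; ext j; by_cases hj : j = i
      · subst hj; simp
      · simp [hj]
    have hmem : ∀ m : ℤ, 0 ≤ m → m ≤ N i → Function.update k i m ∈ gridIdx N := by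
      intro m h0 h1
      rw [mem_gridIdx] at hk ⊢
      intro j; by_cases hj : j = i
      · subst hj; simp [h0, h1]
      · simpa [hj] using hk j
    have b0 : ∀ {F : (Fin 3 → ℤ) → ℝ}, Reflects N F →
        F (Function.update k i 1) = F (Function.update k i (-1)) := by
      intro F hF
      have := hF i _ (hmem 0 le_rfl (by positivity)) (by simp)
      simpa [e1, e2] using this
    have b1 : ∀ {F : (Fin 3 → ℤ) → ℝ}, Reflects N F →
        F (Function.update k i (N i + 1)) = F (Function.update k i (N i - 1)) := by
      intro F hF
      have := hF i _ (hmem (N i) (by positivity) le_rfl) (by simp)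
      simpa [e1, e2] using this
    have := sum_trapWeight_mul_sub (N i) (hN i) (fun m =>
      (f (Function.update k i (m + 1)) + f (Function.update k i m)) *
        (g (Function.update k i (m + 1)) - g (Function.update k i m)))
      (by simp only [neg_add_cancel, zero_add, b0 hf, b0 hg]; ring)
      (by simp only [sub_add_cancel, b1 hf, b1 hg]; ring)
    simp only [sub_add_cancel] at this
    simpa only [e1, e2] using this
  rw [eq_neg_iff_add_eq_zero, ← gridSum_add, gridSum]
  have : ∀ k, f k * dLap h g k + dGradInner h f g k = ∑ i, 1 / (2 * h i ^ 2) *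
      ((f (k + Pi.single i 1) + f k) * (g (k + Pi.single i 1) - g k)
        - (f k + f (k - Pi.single i 1)) * (g k - g (k - Pi.single i 1))) := by
    intro k
    rw [dLap, dGradInner, Finset.mul_sum, ← Finset.sum_add_distrib, Finset.sum_div,
      ← Finset.sum_add_distrib]
    refine Finset.sum_congr rfl fun i _ => ?_
    have := (hh i).ne'
    rw [dPlus_dMinus]
    simp only [dPlus, dMinus]
    field_simp; ring
  simp only [this, Finset.mul_sum]
  rw [Finset.sum_comm]
  have : ∀ i : Fin 3, ∑ k ∈ gridIdx N, (∏ j, trapWeight (N j) (k j)) * (1 / (2 * h i ^ 2) *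
      ((f (k + Pi.single i 1) + f k) * (g (k + Pi.single i 1) - g k)
        - (f k + f (k - Pi.single i 1)) * (g k - g (k - Pi.single i 1)))) = 0 := by
    intro i
    have := congrArg (fun x => 1 / (2 * h i ^ 2) * x) (key i)
    simp only [mul_zero, Finset.mul_sum] at this
    rw [← this]
    exact Finset.sum_congr rfl fun k _ => by ring
  rw [Finset.sum_eq_zero fun i _ => this i, zero_mul]

theorem gridSum_mul_dLap_comm {h : Fin 3 → ℝ} (hh : ∀ i, 0 < h i) {N : Fin 3 → ℕ}
    (hN : ∀ i, 0 < N i) {f g : (Fin 3 → ℤ) → ℝ} (hf : Reflects N f) (hg : Reflects N g) :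
    gridSum h N (fun k => f k * dLap h g k) = gridSum h N (fun k => dLap h f k * g k) := by
  rw [gridSum_mul_dLap hh hN hf hg, dGradInner_comm, ← gridSum_mul_dLap hh hN hg hf]
  simp only [mul_comm]

theorem gridSum_dGradSq {h : Fin 3 → ℝ} (hh : ∀ i, 0 < h i) {N : Fin 3 → ℕ}
    (hN : ∀ i, 0 < N i) {f : (Fin 3 → ℤ) → ℝ} (hf : Reflects N f) :
    gridSum h N (dGradSq h f) = - gridSum h N (fun k => f k * dLap h f k) := by
  rw [gridSum_mul_dLap hh hN hf hf, dGradInner_self, neg_neg]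

theorem dGradSq_nonneg (h : Fin 3 → ℝ) (f : (Fin 3 → ℤ) → ℝ) (k : Fin 3 → ℤ) :
    0 ≤ dGradSq h f k := by
  unfold dGradSq
  have := Finset.sum_nonneg (s := Finset.univ) fun i (_ : i ∈ _) => sq_nonneg (dPlus h i f k)
  have := Finset.sum_nonneg (s := Finset.univ) fun i (_ : i ∈ _) => sq_nonneg (dMinus h i f k)
  positivity

/-! ### Coercivity of the energy -/

theorem coercConst_pos {ε η ζ : ℝ} (hε : 0 < ε) (hζ : 1 / ε + η - 1 < ζ) :
    0 < coercConst ε η ζ := by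
  have h1 : 1 / ε < 1 - η + ζ := by linarith
  have ha : 0 < 1 - η + ζ := lt_trans (by positivity) h1
  rw [div_lt_iff₀ hε] at h1
  have : √((ε - 1 + η - ζ) ^ 2 + 4) < ε + 1 - η + ζ := by
    rw [Real.sqrt_lt' (by linarith)]; nlinarith
  unfold coercConst; linarith

/-- The factor `3 / 2 * coercConst ε η ζ` is the smaller eigenvalue of the symmetric matrix of the
quadratic form on the right. The difference of the two sides is therefore a perfect square up to a
positive factor. By `coercConst_pos` this eigenvalue is positive once `ζ` exceeds the threshold,
which says that the determinant is positive. -/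
theorem coercConst_quadratic {ε η ζ : ℝ} (x y : ℝ) :
    3 / 2 * coercConst ε η ζ * (x ^ 2 + y ^ 2)
      ≤ (1 - η + ζ) / 2 * x ^ 2 + x * y + ε / 2 * y ^ 2 := by
  set r := √((ε - 1 + η - ζ) ^ 2 + 4) with hr
  have hr2 : r ^ 2 = (ε - 1 + η - ζ) ^ 2 + 4 := Real.sq_sqrt (by positivity)
  have hlt : |ε - 1 + η - ζ| < r := by
    rw [hr]; exact Real.lt_sqrt_of_sq_lt (by rw [sq_abs]; linarith)
  have h1 := abs_lt.1 hlt
  have hc : coercConst ε η ζ = (ε + 1 - η + ζ - r) / 6 := rfl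
  rw [hc]
  have hp : 0 < (1 - η + ζ - ε + r) := by linarith
  have key : 0 ≤ ((1 - η + ζ - ε + r) * x + 2 * y) ^ 2 / (4 * (1 - η + ζ - ε + r)) := by positivity
  have : ((1 - η + ζ - ε + r) * x + 2 * y) ^ 2 / (4 * (1 - η + ζ - ε + r))
      = (1 - η + ζ - ε + r) / 4 * x ^ 2 + x * y + (ε - 1 + η - ζ + r) / 4 * y ^ 2 := by
    field_simp
    linear_combination (-y ^ 2) * hr2
  rw [this] at key
  linarith

/-- The gradient term is `-⟨f, dLap f⟩`, so on the right it supplies the cross term of the quadratic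
form. On the left it costs at most half of the other two sums, which turns the factor `1` into `3 /
2`. -/
theorem coercive {h : Fin 3 → ℝ} (hh : ∀ i, 0 < h i) {N : Fin 3 → ℕ} (hN : ∀ i, 0 < N i)
    {ε η ζ : ℝ} (hc : 0 < coercConst ε η ζ) {f : (Fin 3 → ℤ) → ℝ} (hf : Reflects N f) :
    coercConst ε η ζ * (gridSum h N (fun m => f m ^ 2) + gridSum h N (dGradSq h f)
        + gridSum h N (fun m => dLap h f m ^ 2))
      ≤ ζ / 2 * gridSum h N (fun m => f m ^ 2) + (1 - η) / 2 * gridSum h N (fun m => f m ^ 2)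
        - gridSum h N (dGradSq h f) + ε / 2 * gridSum h N (fun m => dLap h f m ^ 2) := by
  have h1 := gridSum_mono (N := N) hh fun k _ =>
    coercConst_quadratic (ε := ε) (η := η) (ζ := ζ) (f k) (dLap h f k)
  have h2 : gridSum h N (dGradSq h f) ≤ 1 / 2 * (gridSum h N (fun m => f m ^ 2)
      + gridSum h N (fun m => dLap h f m ^ 2)) := by
    rw [gridSum_dGradSq hh hN hf, ← gridSum_neg, ← gridSum_add, ← gridSum_const_mul]
    exact gridSum_mono hh fun k _ => by nlinarith [sq_nonneg (f k + dLap h f k)]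
  simp only [gridSum_const_mul, gridSum_add] at h1
  have h3 := gridSum_dGradSq hh hN hf
  nlinarith

/-! ### Energy stability of the scheme -/

/-- The quartic potential `s⁴ / 4`, continued quadratically outside `[-M, M]`. -/
noncomputable def truncQuartic (M s : ℝ) : ℝ :=
  if |s| ≤ M then s ^ 4 / 4 else M ^ 4 / 4 + M ^ 3 * (|s| - M) + 3 / 2 * M ^ 2 * (|s| - M) ^ 2

theorem truncQuartic_neg (M s : ℝ) : truncQuartic M (-s) = truncQuartic M s := by
  simp only [truncQuartic, abs_neg, Even.neg_pow (by decide : Even 4)]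

/-- This is the lower bound given by `(s ^ 2 - ζ) ^ 2 ≥ 0` for the true quartic; it survives the
truncation because `ζ ≤ M ^ 2`. That is the role of `√(max 0 ζ)` in the definition of `M`. -/
theorem le_truncQuartic {M ζ : ℝ} (hM : 0 ≤ M) (hζ : ζ ≤ M ^ 2) (s : ℝ) :
    ζ / 2 * s ^ 2 - ζ ^ 2 / 4 ≤ truncQuartic M s := by
  unfold truncQuartic
  split_ifs with hs
  · nlinarith [sq_nonneg (s ^ 2 - ζ)]
  · have hd : 0 ≤ |s| - M := by linarith
    rw [← sq_abs s]
    have h1 : 0 ≤ (|s| - M) * (M * (M ^ 2 - ζ)) :=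
      mul_nonneg hd (mul_nonneg hM (by linarith))
    have h2 : 0 ≤ (|s| - M) ^ 2 * (3 * M ^ 2 - ζ) :=
      mul_nonneg (sq_nonneg _) (by nlinarith [sq_nonneg M])
    nlinarith [sq_nonneg (M ^ 2 - ζ)]

theorem quartic_le {M a b : ℝ} (ha : |a| ≤ M) (hb : |b| ≤ M) :
    b ^ 4 / 4 ≤ a ^ 4 / 4 + a ^ 3 * (b - a) + 3 / 2 * M ^ 2 * (b - a) ^ 2 := by
  have ha2 : a ^ 2 ≤ M ^ 2 := sq_le_sq' (by linarith [abs_le.1 ha]) (abs_le.1 ha).2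
  have hb2 : b ^ 2 ≤ M ^ 2 := sq_le_sq' (by linarith [abs_le.1 hb]) (abs_le.1 hb).2
  have : 0 ≤ (b - a) ^ 2 * (6 * M ^ 2 - (b ^ 2 + 2 * a * b + 3 * a ^ 2)) :=
    mul_nonneg (sq_nonneg _) (by nlinarith [sq_nonneg (a - b)])
  nlinarith

/-- Taylor's formula with second derivative at most `3 * M ^ 2`. Only the expansion point `a` has to
lie in `[-M, M]`, so the estimate applies to a new iterate about which nothing is known yet. For `b
> M` one goes from `a` to `M` by `quartic_le` and from `M` to `b` along the quadratic branch. -/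
theorem truncQuartic_le {M a : ℝ} (ha : |a| ≤ M) (b : ℝ) :
    truncQuartic M b ≤ a ^ 4 / 4 + a ^ 3 * (b - a) + 3 / 2 * M ^ 2 * (b - a) ^ 2 := by
  have hM : 0 ≤ M := (abs_nonneg a).trans ha
  have key : ∀ a b : ℝ, |a| ≤ M → M < b →
      truncQuartic M b ≤ a ^ 4 / 4 + a ^ 3 * (b - a) + 3 / 2 * M ^ 2 * (b - a) ^ 2 := by
    intro a b ha hb
    have hab : |b| = b := abs_of_pos (by linarith)
    rw [truncQuartic, hab, if_neg (not_le.2 hb)]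
    have h1 := quartic_le ha (abs_of_nonneg hM).le
    have ha' := abs_le.1 ha
    have h2 : 0 ≤ (M - a) * ((b - M) * (3 * M ^ 2 - (M ^ 2 + M * a + a ^ 2))) := by
      refine mul_nonneg (by linarith) (mul_nonneg (by linarith) ?_)
      nlinarith
    nlinarith
  rcases le_or_gt |b| M with hb | hb
  · rw [truncQuartic, if_pos hb]; exact quartic_le ha hb
  · rcases lt_abs.1 hb with hb' | hb'
    · exact key a b ha hb'
    · have := key (-a) (-b) (by rwa [abs_neg]) hb'
      rw [truncQuartic_neg] at this
      linarith [this, show (-a) ^ 4 / 4 + (-a) ^ 3 * (-b - -a) + 3 / 2 * M ^ 2 * (-b - -a) ^ 2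
        = a ^ 4 / 4 + a ^ 3 * (b - a) + 3 / 2 * M ^ 2 * (b - a) ^ 2 by ring]

/-- The scheme is tested with `g - f`. Both treatments of the linear term (implicit when convex,
explicit when concave) gain `|1 - η| / 2 * (g - f) ^ 2`, the time difference gains `(g - f) ^ 2 /
τ`, and together they absorb the Taylor remainder `3 / 2 * M ^ 2 * (g - f) ^ 2`. The concave
gradient term is explicit and the bilaplacian implicit, so both contribute with the good sign. -/
theorem energy_step {h : Fin 3 → ℝ} (hh : ∀ i, 0 < h i) {N : Fin 3 → ℕ} (hN : ∀ i, 0 < N i)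
    {ε η τ M : ℝ} (hε : 0 < ε) (hτ : 3 * M ^ 2 - |1 - η| ≤ 2 / τ)
    {f g : (Fin 3 → ℤ) → ℝ} (hf : Reflects N f)
    (hg : Reflects N g) (hg' : Reflects N (dLap h g)) (hM : ∀ k ∈ gridIdx N, |f k| ≤ M)
    (hstep : ∀ k ∈ gridIdx N, (g k - f k) / τ =
      if η < 1 then
        -(f k ^ 3 + ((1 - η) * g k + ε * dLap h (dLap h g) k) + 2 * dLap h f k)
      else
        -(f k ^ 3 + ε * dLap h (dLap h g) k - ((η - 1) * f k - 2 * dLap h f k))) :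
    gridSum h N (fun k => truncQuartic M (g k)) + gridSum h N (fun k => (1 - η) / 2 * g k ^ 2)
      - gridSum h N (dGradSq h g) + gridSum h N (fun k => ε / 2 * dLap h g k ^ 2)
      ≤ dEnergy h N ε η f := by
  have hgf := hg.sub hf
  have e1 := gridSum_dGradSq hh hN hf
  have e2 := gridSum_dGradSq hh hN hg
  have e3 : gridSum h N (fun k => f k * dLap h g k - g k * dLap h f k) = 0 := by
    rw [gridSum_sub, gridSum_mul_dLap_comm hh hN hf hg]
    simp only [mul_comm, sub_self]
  have e4 : gridSum h N (fun k => (dLap h g k - dLap h f k) * dLap h g k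
      - (g k - f k) * dLap h (dLap h g) k) = 0 := by
    rw [gridSum_sub, gridSum_mul_dLap_comm hh hN hgf hg', dLap_sub, sub_self]
  have e5 : gridSum h N (fun k => (g k - f k) * (dLap h g k - dLap h f k)) ≤ 0 := by
    have := gridSum_dGradSq hh hN hgf
    have h0 := gridSum_nonneg hh fun k (_ : k ∈ gridIdx N) =>
      dGradSq_nonneg h (fun k => g k - f k) k
    rw [dLap_sub] at this
    linarith [show gridSum h N (fun k => dGradSq h (fun k => g k - f k) k)
      = gridSum h N (dGradSq h (fun k => g k - f k)) from rfl]
  -- The energy inequality holds at each grid point up to three expressions on the right; after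
  -- summation the first is nonpositive by `e5` and the other two vanish by `e3` and `e4`.
  have hpt : ∀ k ∈ gridIdx N,
      truncQuartic M (g k) + (1 - η) / 2 * g k ^ 2 + g k * dLap h g k + ε / 2 * dLap h g k ^ 2
      - (1 / 4 * f k ^ 4 + (1 - η) / 2 * f k ^ 2 + f k * dLap h f k + ε / 2 * dLap h f k ^ 2)
      ≤ (g k - f k) * (dLap h g k - dLap h f k) + (f k * dLap h g k - g k * dLap h f k)
        + ε * ((dLap h g k - dLap h f k) * dLap h g k - (g k - f k) * dLap h (dLap h g) k) := by
    intro k hk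
    have h1 := truncQuartic_le (hM k hk) (g k)
    have h2 := congrArg (fun x => x * (g k - f k)) (hstep k hk)
    have h3 : 0 ≤ (2 / τ - (3 * M ^ 2 - |1 - η|)) * (g k - f k) ^ 2 :=
      mul_nonneg (by linarith) (sq_nonneg _)
    have h4 : 0 ≤ ε * (dLap h g k - dLap h f k) ^ 2 := by positivity
    have h5 : (g k - f k) / τ * (g k - f k) = 1 / 2 * (2 / τ * (g k - f k) ^ 2) := by ring
    simp only [h5] at h2
    split_ifs at h2 with hη
    · rw [abs_of_pos (by linarith)] at h3
      nlinarith
    · rw [abs_of_nonpos (by linarith)] at h3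
      nlinarith
  have hs := gridSum_mono hh hpt
  simp only [gridSum_add, gridSum_sub, gridSum_const_mul] at hs e3 e4 e5 ⊢
  rw [dEnergy]
  simp only [gridSum_const_mul] at *
  nlinarith

/-- The potential `q` enters only through its quadratic lower bound, so the same statement serves
for the true quartic at the initial time and for the truncated one at later times. -/
theorem sup_le_energyBound {ℓ : Fin 3 → ℝ} (hℓ : ∀ i, 0 < ℓ i) {N : Fin 3 → ℕ}
    (hN : ∀ i, 0 < N i) {C ε η ζ E : ℝ} (hC : IsDiscreteSobolevConst ℓ C)
    (hc : 0 < coercConst ε η ζ) {f q : (Fin 3 → ℤ) → ℝ} (hf : DiscreteBC (mesh ℓ N) N f)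
    (hq : ∀ k ∈ gridIdx N, ζ / 2 * f k ^ 2 - ζ ^ 2 / 4 ≤ q k)
    (hE : gridSum (mesh ℓ N) N q + gridSum (mesh ℓ N) N (fun k => (1 - η) / 2 * f k ^ 2)
      - gridSum (mesh ℓ N) N (dGradSq (mesh ℓ N) f)
      + gridSum (mesh ℓ N) N (fun k => ε / 2 * dLap (mesh ℓ N) f k ^ 2) ≤ E) :
    ∀ k ∈ gridIdx N, |f k| ≤ energyBound ℓ ε η ζ C E := by
  have hh := fun i => mesh_pos hℓ hN i
  intro k hk
  have h1 := coercive hh hN hc ((discreteBC_iff hh).1 hf).1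
  have h2 := gridSum_mono hh hq
  rw [gridSum_sub, gridSum_const hN, gridSum_const_mul] at h2
  simp only [gridSum_const_mul] at hE
  set X := gridSum (mesh ℓ N) N (fun m => f m ^ 2)
        + gridSum (mesh ℓ N) N (dGradSq (mesh ℓ N) f)
        + gridSum (mesh ℓ N) N (fun m => dLap (mesh ℓ N) f m ^ 2) with hX
  have hXE : coercConst ε η ζ * X ≤ E + ζ ^ 2 / 4 * boxVolume ℓ := by linarith
  have hX0 : 0 ≤ X := by
    have a1 := gridSum_nonneg hh fun k (_ : k ∈ gridIdx N) => sq_nonneg (f k)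
    have a2 := gridSum_nonneg hh fun k (_ : k ∈ gridIdx N) => dGradSq_nonneg (mesh ℓ N) f k
    have a3 := gridSum_nonneg hh fun k (_ : k ∈ gridIdx N) => sq_nonneg (dLap (mesh ℓ N) f k)
    exact add_nonneg (add_nonneg a1 a2) a3
  refine (hC N hN f hf k hk).trans (Real.le_sqrt_of_sq_le ?_)
  rw [mul_pow, Real.sq_sqrt hX0, div_mul_eq_mul_div, le_div_iff₀ hc, mul_assoc]
  exact mul_le_mul_of_nonneg_left (by linarith) (sq_nonneg C)

theorem constM_nonneg (ℓ : Fin 3 → ℝ) (N : Fin 3 → ℕ) (ε η ζ C : ℝ) (U₀ : (Fin 3 → ℤ) → ℝ) :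
    0 ≤ constM ℓ N ε η ζ C U₀ :=
  le_max_of_le_left (Real.sqrt_nonneg _)

theorem le_constM_sq (ℓ : Fin 3 → ℝ) (N : Fin 3 → ℕ) (ε η ζ C : ℝ) (U₀ : (Fin 3 → ℤ) → ℝ) :
    ζ ≤ constM ℓ N ε η ζ C U₀ ^ 2 := by
  have h1 : √(max 0 ζ) ≤ constM ℓ N ε η ζ C U₀ := le_max_left _ _
  calc ζ ≤ max 0 ζ := le_max_right _ _
    _ = √(max 0 ζ) ^ 2 := (Real.sq_sqrt (le_max_left _ _)).symm
    _ ≤ _ := pow_le_pow_left₀ (Real.sqrt_nonneg _) h1 2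

/-- Under the first restriction on the time step, the energy does not exceed its initial value and
the numerical solution is bounded by `M`. -/
theorem scheme_le_constM {ℓ : Fin 3 → ℝ} (hℓ : ∀ i, 0 < ℓ i) {N : Fin 3 → ℕ}
    (hN : ∀ i, 0 < N i) {C ε η ζ τ : ℝ} (hC : IsDiscreteSobolevConst ℓ C) (hε : 0 < ε)
    (hζ : 1 / ε + η - 1 < ζ) (hτ : 0 < τ) {U : ℕ → (Fin 3 → ℤ) → ℝ}
    (hU : IsSchemeSolution (mesh ℓ N) N ε η τ U)
    (hr : 3 * constM ℓ N ε η ζ C (U 0) ^ 2 ≤ |1 - η| ∨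
      (|1 - η| < 3 * constM ℓ N ε η ζ C (U 0) ^ 2 ∧
      τ ≤ 2 / (3 * constM ℓ N ε η ζ C (U 0) ^ 2 - |1 - η|))) (n : ℕ) :
    (∀ k ∈ gridIdx N, |U n k| ≤ constM ℓ N ε η ζ C (U 0)) ∧
      dEnergy (mesh ℓ N) N ε η (U n) ≤ dEnergy (mesh ℓ N) N ε η (U 0) := by
  have hh := fun i => mesh_pos hℓ hN i
  have hc := coercConst_pos hε hζ
  have hbd : energyBound ℓ ε η ζ C (dEnergy (mesh ℓ N) N ε η (U 0)) ≤ constM ℓ N ε η ζ C (U 0) :=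
    le_max_right _ _
  have hM0 := constM_nonneg ℓ N ε η ζ C (U 0)
  have hMζ := le_constM_sq ℓ N ε η ζ C (U 0)
  induction n with
  | zero =>
    refine ⟨fun k hk => le_trans ?_ hbd, le_rfl⟩
    refine sup_le_energyBound hℓ hN hC hc (hU.bc 0) (q := fun k => 1 / 4 * U 0 k ^ 4) ?_ le_rfl k hk
    intro k _
    nlinarith [sq_nonneg (U 0 k ^ 2 - ζ)]
  | succ n ih =>
    set M := constM ℓ N ε η ζ C (U 0)
    have hτ' : 3 * M ^ 2 - |1 - η| ≤ 2 / τ := by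
      rcases hr with hr | ⟨h1, h2⟩
      · exact le_trans (by linarith) (by positivity : (0 : ℝ) ≤ 2 / τ)
      · rw [le_div_iff₀ (by linarith)] at h2
        rw [le_div_iff₀ hτ]; linarith
    have hs := energy_step hh hN hε hτ' ((discreteBC_iff hh).1 (hU.bc n)).1
      ((discreteBC_iff hh).1 (hU.bc (n + 1))).1 ((discreteBC_iff hh).1 (hU.bc (n + 1))).2
      ih.1 (hU.step n)
    have hs' := hs.trans ih.2
    -- The truncated energy is already at most the initial energy, hence the new iterate lies in
    -- `[-M, M]`. There the truncated and true potentials agree, so the true energy inherits the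
    -- bound.
    have hsup : ∀ k ∈ gridIdx N, |U (n + 1) k| ≤ M := fun k hk =>
      (sup_le_energyBound hℓ hN hC hc (hU.bc (n + 1)) (fun k _ => le_truncQuartic hM0 hMζ _)
        hs' k hk).trans hbd
    refine ⟨hsup, ?_⟩
    have : gridSum (mesh ℓ N) N (fun k => 1 / 4 * U (n + 1) k ^ 4)
        = gridSum (mesh ℓ N) N (fun k => truncQuartic M (U (n + 1) k)) :=
      gridSum_congr fun k hk => by rw [truncQuartic, if_pos (hsup k hk)]; ring
    rw [dEnergy, this]
    exact hs'

/-! ### The cosine basis -/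

/-- The second difference of `cos (θ * m)` is `2 * (cos θ - 1) * cos (θ * m)`. Its trapezoidal sum
vanishes because the first differences are odd about both ends (at `N` since `sin (θ * N) = 0`).
Hence the sum itself is zero unless `cos θ = 1`. -/
theorem sum_trapWeight_mul_cos (N : ℕ) (hN : 0 < N) (j : ℤ) :
    ∑ m ∈ Finset.Icc (0 : ℤ) N, trapWeight N m * Real.cos (Real.pi * j / N * m)
      = if (2 * N : ℤ) ∣ j then (N : ℝ) else 0 := by
  have hN' : (N : ℝ) ≠ 0 := Nat.cast_ne_zero.2 hN.ne'
  split_ifs with hj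
  · obtain ⟨c, rfl⟩ := hj
    refine (Finset.sum_congr rfl fun m _ => ?_).trans (sum_trapWeight N hN)
    have : Real.pi * ((2 * N * c : ℤ) : ℝ) / N * m = ((c * m : ℤ) : ℝ) * (2 * Real.pi) := by
      push_cast; field_simp
    rw [this, Real.cos_int_mul_two_pi, mul_one]
  · set θ := Real.pi * j / N with hθ
    have hsin : Real.sin (θ * N) = 0 := by
      rw [hθ, div_mul_cancel₀ _ hN', mul_comm]; exact Real.sin_int_mul_pi j
    have h1 := sum_trapWeight_mul_sub N hN
      (fun m => Real.cos (θ * (m + 1 : ℤ)) - Real.cos (θ * m))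
      (by
        simp only [Int.reduceNeg, neg_add_cancel, Int.cast_zero, mul_zero, Int.cast_neg,
          Int.cast_one, mul_neg, mul_one, Real.cos_neg, zero_add]
        ring)
      (by
        simp only [sub_add_cancel, Int.cast_natCast, Int.cast_add, Int.cast_one, mul_add, mul_one,
          Int.cast_sub, mul_sub, Real.cos_add, Real.cos_sub, hsin]
        ring)
    have h2 : ∀ m : ℤ, (Real.cos (θ * (m + 1 : ℤ)) - Real.cos (θ * m))
        - (Real.cos (θ * (m - 1 + 1 : ℤ)) - Real.cos (θ * (m - 1 : ℤ)))
        = 2 * (Real.cos θ - 1) * Real.cos (θ * m) := by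
      intro m
      simp only [sub_add_cancel, Int.cast_add, Int.cast_one, mul_add, mul_one, Int.cast_sub,
        mul_sub, Real.cos_add, Real.cos_sub]
      ring
    simp only [h2] at h1
    have h3 : ∑ m ∈ Finset.Icc (0 : ℤ) N, trapWeight N m * (2 * (Real.cos θ - 1) * Real.cos (θ * m))
        = 2 * (Real.cos θ - 1) *
          ∑ m ∈ Finset.Icc (0 : ℤ) N, trapWeight N m * Real.cos (θ * m) := by
      rw [Finset.mul_sum]
      exact Finset.sum_congr rfl fun m _ => by ring
    rw [h3] at h1
    rcases mul_eq_zero.1 h1 with h4 | h4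
    · exfalso
      have h5 : Real.cos θ = 1 := by linarith
      obtain ⟨n, hn⟩ := (Real.cos_eq_one_iff θ).1 h5
      apply hj
      refine ⟨n, ?_⟩
      have : (j : ℝ) = 2 * N * n := by
        rw [hθ, eq_div_iff hN'] at hn
        have := Real.pi_ne_zero
        apply mul_left_cancel₀ this
        linarith
      exact_mod_cast this
    · exact h4

/-- By the product formula only the frequencies `a - b` and `a + b` matter. In the given range `2 *
N` divides the first only for `a = b`, and the second only when `a = b` is an end point. The extra
contribution at the end points is recorded by `trapWeight N a`. -/
theorem sum_trapWeight_cos_mul_cos (N : ℕ) (hN : 0 < N) (a b : ℤ) (ha : 0 ≤ a ∧ a ≤ N)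
    (hb : 0 ≤ b ∧ b ≤ N) :
    ∑ m ∈ Finset.Icc (0 : ℤ) N, trapWeight N m *
        (Real.cos (Real.pi * a / N * m) * Real.cos (Real.pi * b / N * m))
      = if a = b then N / (2 * trapWeight N a) else 0 := by
  have h1 : ∀ m : ℤ, trapWeight N m *
        (Real.cos (Real.pi * a / N * m) * Real.cos (Real.pi * b / N * m))
      = (trapWeight N m * Real.cos (Real.pi * (a - b : ℤ) / N * m)
        + trapWeight N m * Real.cos (Real.pi * (a + b : ℤ) / N * m)) / 2 := by
    intro m
    have e1 : Real.pi * (a - b : ℤ) / N * m = Real.pi * a / N * m - Real.pi * b / N * m := by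
      push_cast; ring
    have e2 : Real.pi * (a + b : ℤ) / N * m = Real.pi * a / N * m + Real.pi * b / N * m := by
      push_cast; ring
    rw [e1, e2, Real.cos_sub, Real.cos_add]; ring
  simp only [h1]
  rw [← Finset.sum_div, Finset.sum_add_distrib, sum_trapWeight_mul_cos N hN,
    sum_trapWeight_mul_cos N hN]
  by_cases hab : a = b
  · subst hab
    rw [if_pos (by simp), if_pos rfl, trapWeight]
    by_cases h0 : a = 0 ∨ a = N
    · rw [if_pos h0, if_pos]
      · ring
      · rcases h0 with rfl | rfl
        · simp
        · exact ⟨1, by ring⟩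
    · rw [if_neg h0, if_neg]
      · ring
      · rintro ⟨c, hc⟩
        push Not at h0
        have : 0 < c := by
          by_contra hc'
          have : (2 * N : ℤ) * c ≤ 0 := mul_nonpos_of_nonneg_of_nonpos (by positivity) (by omega)
          omega
        have : (2 * N : ℤ) * 1 ≤ 2 * N * c := by gcongr; omega
        omega
  · rw [if_neg hab, if_neg, if_neg]
    · ring
    · rintro ⟨c, hc⟩
      have : 0 < c := by
        by_contra hc'
        have : (2 * N : ℤ) * c ≤ 0 := mul_nonpos_of_nonneg_of_nonpos (by positivity) (by omega)
        omega
      have : (2 * N : ℤ) * 1 ≤ 2 * N * c := by gcongr; omega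
      omega
    · rintro ⟨c, hc⟩
      rcases lt_trichotomy c 0 with h | h | h
      · have : (2 * N : ℤ) * c ≤ 2 * N * (-1) := by gcongr; omega
        omega
      · subst h; omega
      · have : (2 * N : ℤ) * 1 ≤ 2 * N * c := by gcongr; omega
        omega

/-- The products of cosines, eigenfunctions of the discrete Laplacian. -/
noncomputable def cosFun (N : Fin 3 → ℕ) (ξ k : Fin 3 → ℤ) : ℝ :=
  ∏ i, Real.cos (Real.pi * ξ i / N i * k i)

/-- The eigenvalue (with opposite sign) of the discrete Laplacian belonging to `cosFun N ξ`. -/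
noncomputable def cosEigenvalue (h : Fin 3 → ℝ) (N : Fin 3 → ℕ) (ξ : Fin 3 → ℤ) : ℝ :=
  ∑ i, 2 / h i ^ 2 * (1 - Real.cos (Real.pi * ξ i / N i))

theorem cosFun_add_single (N : Fin 3 → ℕ) (ξ k : Fin 3 → ℤ) (i : Fin 3) (a : ℤ) :
    cosFun N ξ (k + Pi.single i a) = Real.cos (Real.pi * ξ i / N i * (k i + a)) *
      ∏ j ∈ Finset.univ.erase i, Real.cos (Real.pi * ξ j / N j * k j) := by
  rw [cosFun, ← Finset.mul_prod_erase Finset.univ _ (Finset.mem_univ i)]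
  congr 1
  · simp
  · refine Finset.prod_congr rfl fun j hj => ?_
    simp [Pi.single_eq_of_ne (Finset.ne_of_mem_erase hj)]

/-- The symmetry between frequency and position turns orthogonality into completeness, so no
separate inversion formula is needed. -/
theorem cosFun_comm (N : Fin 3 → ℕ) (ξ k : Fin 3 → ℤ) : cosFun N ξ k = cosFun N k ξ := by
  unfold cosFun
  refine Finset.prod_congr rfl fun i _ => ?_
  congr 1; ring

theorem abs_cosFun_le_one (N : Fin 3 → ℕ) (ξ k : Fin 3 → ℤ) : |cosFun N ξ k| ≤ 1 := by
  rw [cosFun, Finset.abs_prod]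
  exact Finset.prod_le_one (fun i _ => abs_nonneg _) fun i _ => Real.abs_cos_le_one _

theorem cosFun_reflects {N : Fin 3 → ℕ} (hN : ∀ i, 0 < N i) (ξ : Fin 3 → ℤ) :
    Reflects N (cosFun N ξ) := by
  intro i k _ hki
  rw [sub_eq_add_neg, ← Pi.single_neg, cosFun_add_single, cosFun_add_single]
  congr 1
  have hN' : (N i : ℝ) ≠ 0 := Nat.cast_ne_zero.2 (hN i).ne'
  rcases hki with h | h
  · rw [h]; push_cast
    rw [← Real.cos_neg]; congr 1; ring
  · rw [h]; push_cast
    have hs : Real.sin (Real.pi * ξ i / N i * N i) = 0 := by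
      rw [div_mul_cancel₀ _ hN', mul_comm]; exact Real.sin_int_mul_pi _
    simp only [mul_add, mul_neg, Real.cos_add, hs]
    simp

theorem dLap_cosFun (h : Fin 3 → ℝ) (N : Fin 3 → ℕ) (ξ k : Fin 3 → ℤ) :
    dLap h (cosFun N ξ) k = - cosEigenvalue h N ξ * cosFun N ξ k := by
  rw [dLap, cosEigenvalue, ← Finset.sum_neg_distrib, Finset.sum_mul]
  refine Finset.sum_congr rfl fun i _ => ?_
  rw [dPlus_dMinus, sub_eq_add_neg k, ← Pi.single_neg, cosFun_add_single, cosFun_add_single]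
  have := cosFun_add_single N ξ k i 0
  rw [Pi.single_zero, add_zero] at this
  rw [this]
  push_cast
  simp only [mul_add, add_zero, mul_neg, mul_one, Real.cos_add, Real.cos_neg, Real.sin_neg]
  ring

/-- Half-angle formula and Jordan's inequality `sin x ≥ 2 * x / π` on `[0, π / 2]`. The lower bound
does not involve the mesh, which is the source of uniformity in the Sobolev inequality. -/
theorem cosEigenvalue_ge {ℓ : Fin 3 → ℝ} (hℓ : ∀ i, 0 < ℓ i) {N : Fin 3 → ℕ} (hN : ∀ i, 0 < N i)
    {ξ : Fin 3 → ℤ} (hξ : ξ ∈ gridIdx N) :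
    ∑ i, 4 / ℓ i ^ 2 * (ξ i : ℝ) ^ 2 ≤ cosEigenvalue (mesh ℓ N) N ξ := by
  refine Finset.sum_le_sum fun i _ => ?_
  obtain ⟨h0, h1⟩ := mem_gridIdx.1 hξ i
  have h0' : (0 : ℝ) ≤ ξ i := by exact_mod_cast h0
  have h1' : (ξ i : ℝ) ≤ N i := by exact_mod_cast h1
  have hN' : (0 : ℝ) < N i := Nat.cast_pos.2 (hN i)
  have hx0 : 0 ≤ Real.pi * ξ i / N i / 2 := by positivity
  have hx1 : Real.pi * ξ i / N i / 2 ≤ Real.pi / 2 := by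
    have : Real.pi * ξ i / N i ≤ Real.pi := by
      rw [div_le_iff₀ hN']; gcongr
    linarith
  have hs := Real.mul_le_sin hx0 hx1
  have e1 : 2 / Real.pi * (Real.pi * ξ i / N i / 2) = ξ i / N i := by
    have := Real.pi_ne_zero
    field_simp
  rw [e1] at hs
  have hs2 : ((ξ i : ℝ) / N i) ^ 2 ≤ Real.sin (Real.pi * ξ i / N i / 2) ^ 2 :=
    pow_le_pow_left₀ (by positivity) hs 2
  have hc : 1 - Real.cos (Real.pi * ξ i / N i) = 2 * Real.sin (Real.pi * ξ i / N i / 2) ^ 2 := by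
    have := Real.cos_sq' (Real.pi * ξ i / N i / 2)
    have h2 := Real.cos_two_mul (Real.pi * ξ i / N i / 2)
    rw [mul_div_cancel₀ _ (two_ne_zero)] at h2
    linarith
  rw [hc, mesh]
  have := hℓ i
  calc 4 / ℓ i ^ 2 * (ξ i : ℝ) ^ 2 = 2 / (ℓ i / N i) ^ 2 * (2 * ((ξ i : ℝ) / N i) ^ 2) := by
        field_simp; ring
    _ ≤ _ := by gcongr

theorem sum_cosFun_mul_cosFun {N : Fin 3 → ℕ} (hN : ∀ i, 0 < N i) {ξ ξ' : Fin 3 → ℤ}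
    (hξ : ξ ∈ gridIdx N) (hξ' : ξ' ∈ gridIdx N) :
    ∑ k ∈ gridIdx N, (∏ i, trapWeight (N i) (k i)) * (cosFun N ξ k * cosFun N ξ' k)
      = if ξ = ξ' then ∏ i, (N i / (2 * trapWeight (N i) (ξ i))) else 0 := by
  simp only [cosFun, ← Finset.prod_mul_distrib]
  rw [sum_gridIdx_prod N (fun i m => trapWeight (N i) m *
    (Real.cos (Real.pi * ξ i / N i * m) * Real.cos (Real.pi * ξ' i / N i * m)))]
  rw [Finset.prod_congr rfl fun i _ => sum_trapWeight_cos_mul_cos (N i) (hN i) (ξ i) (ξ' i)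
    (mem_gridIdx.1 hξ i) (mem_gridIdx.1 hξ' i)]
  split_ifs with h
  · subst h; simp
  · obtain ⟨i, hi⟩ := Function.ne_iff.1 h
    exact Finset.prod_eq_zero (Finset.mem_univ i) (if_neg hi)

/-! ### The discrete Sobolev inequality -/

theorem gridSum_sum (h : Fin 3 → ℝ) (N : Fin 3 → ℕ) {ι : Type*} (s : Finset ι)
    (F : ι → (Fin 3 → ℤ) → ℝ) :
    gridSum h N (fun k => ∑ a ∈ s, F a k) = ∑ a ∈ s, gridSum h N (F a) := by
  simp only [gridSum, Finset.mul_sum, ← Finset.sum_mul]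
  rw [Finset.sum_comm]

theorem gridSum_mul_le_sqrt {h : Fin 3 → ℝ} (hh : ∀ i, 0 < h i) {N : Fin 3 → ℕ}
    (f g : (Fin 3 → ℤ) → ℝ) :
    gridSum h N (fun k => f k * g k)
      ≤ √(gridSum h N (fun k => f k ^ 2)) * √(gridSum h N (fun k => g k ^ 2)) := by
  have hw : ∀ k : Fin 3 → ℤ, 0 ≤ (∏ i, trapWeight (N i) (k i)) * ∏ i, h i := fun k =>
    mul_nonneg (Finset.prod_nonneg fun i _ => trapWeight_nonneg _ _)
      (Finset.prod_nonneg fun i _ => (hh i).le)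
  have e : ∀ F : (Fin 3 → ℤ) → ℝ, gridSum h N F
      = ∑ k ∈ gridIdx N, (∏ i, trapWeight (N i) (k i)) * (∏ i, h i) * F k := by
    intro F
    rw [gridSum, Finset.sum_mul]
    exact Finset.sum_congr rfl fun k _ => by ring
  have := Real.sum_mul_le_sqrt_mul_sqrt (gridIdx N)
    (fun k => √((∏ i, trapWeight (N i) (k i)) * ∏ i, h i) * f k)
    (fun k => √((∏ i, trapWeight (N i) (k i)) * ∏ i, h i) * g k)
  simp only [mul_pow, Real.sq_sqrt (hw _)] at this
  rw [e, e, e]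
  refine le_trans (le_of_eq ?_) this
  refine Finset.sum_congr rfl fun k _ => ?_
  linear_combination (- f k * g k) * Real.mul_self_sqrt (hw k)

/-- Below, `G` is the Green function of `1 - dLap` with pole `k₀`, expanded in cosines. Then `f k₀ =
⟨f - dLap f, G⟩` by summation by parts, and Cauchy–Schwarz leaves the norm of `G`, which
orthogonality bounds by the sum over frequencies. -/
theorem abs_le_dNorm_mul_green {h : Fin 3 → ℝ} (hh : ∀ i, 0 < h i) {N : Fin 3 → ℕ}
    (hN : ∀ i, 0 < N i) {f : (Fin 3 → ℤ) → ℝ} (hf : Reflects N f) (k₀ : Fin 3 → ℤ)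
    (hk₀ : k₀ ∈ gridIdx N) (hpos : ∀ ξ ∈ gridIdx N, 0 ≤ cosEigenvalue h N ξ) :
    |f k₀| ≤ √(gridSum h N (fun k => (f k - dLap h f k) ^ 2)) *
      √(∑ ξ ∈ gridIdx N, (∏ i, 2 * trapWeight (N i) (ξ i) / (N i * h i)) /
        (1 + cosEigenvalue h N ξ) ^ 2) := by
  classical
  set H := ∏ i, h i with hH
  have hH0 : H ≠ 0 := Finset.prod_ne_zero_iff.2 fun i _ => (hh i).ne'
  set c : (Fin 3 → ℤ) → ℝ := fun ξ => ∏ i, 2 * trapWeight (N i) (ξ i) / N i with hc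
  have hcinv : ∀ ξ, ∏ i, ((N i : ℝ) / (2 * trapWeight (N i) (ξ i))) = (c ξ)⁻¹ := by
    intro ξ
    rw [hc, ← Finset.prod_inv_distrib]
    exact Finset.prod_congr rfl fun i _ => by rw [inv_div]
  have hc0 : ∀ ξ, 0 < c ξ := fun ξ => Finset.prod_pos fun i _ => by
    have := trapWeight_pos (N i) (ξ i)
    have : (0 : ℝ) < N i := Nat.cast_pos.2 (hN i)
    positivity
  set a : (Fin 3 → ℤ) → ℝ := fun ξ => c ξ * cosFun N ξ k₀ / ((1 + cosEigenvalue h N ξ) * H) with ha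
  set G : (Fin 3 → ℤ) → ℝ := fun k => ∑ ξ ∈ gridIdx N, a ξ * cosFun N ξ k with hG
  have hrep : gridSum h N (fun k => (f k - dLap h f k) * G k) = f k₀ := by
    have h1 : ∀ ξ ∈ gridIdx N, gridSum h N (fun k => a ξ * ((f k - dLap h f k) * cosFun N ξ k))
        = gridSum h N (fun k => c ξ * cosFun N ξ k₀ / H * (f k * cosFun N ξ k)) := by
      intro ξ hξ
      have hl := hpos ξ hξ
      have e1 := gridSum_mul_dLap_comm hh hN hf (cosFun_reflects hN ξ)
      have e2 : gridSum h N (fun k => (f k - dLap h f k) * cosFun N ξ k)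
          = (1 + cosEigenvalue h N ξ) * gridSum h N (fun k => f k * cosFun N ξ k) := by
        simp only [sub_mul]
        rw [gridSum_sub, ← e1, ← gridSum_const_mul, ← gridSum_sub]
        refine gridSum_congr fun k _ => ?_
        rw [dLap_cosFun]; ring
      rw [gridSum_const_mul, gridSum_const_mul, e2, ha]
      have : 1 + cosEigenvalue h N ξ ≠ 0 := by positivity
      field_simp
    -- Completeness: after exchanging positions and frequencies this is the orthogonality relation
    -- `sum_cosFun_mul_cosFun`, whose weights in `ξ` are exactly those contained in `c ξ`.
    have h2 : ∀ k ∈ gridIdx N, ∑ ξ ∈ gridIdx N, c ξ * cosFun N ξ k₀ / H * (f k * cosFun N ξ k)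
        = if k = k₀ then (∏ i, trapWeight (N i) (k i))⁻¹ / H * f k else 0 := by
      intro k hk
      have h3 := sum_cosFun_mul_cosFun hN hk hk₀
      have h4 : ∀ ξ, c ξ = (∏ i, 2 / (N i : ℝ)) * ∏ i, trapWeight (N i) (ξ i) := by
        intro ξ
        rw [hc, ← Finset.prod_mul_distrib]
        exact Finset.prod_congr rfl fun i _ => by ring
      calc _ = f k / H * (∏ i, 2 / (N i : ℝ)) * ∑ ξ ∈ gridIdx N,
              (∏ i, trapWeight (N i) (ξ i)) * (cosFun N k ξ * cosFun N k₀ ξ) := by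
            rw [Finset.mul_sum]
            refine Finset.sum_congr rfl fun ξ _ => ?_
            rw [h4, cosFun_comm N k ξ, cosFun_comm N k₀ ξ]; ring
        _ = _ := by
            rw [h3, mul_ite, mul_zero]
            refine if_congr Iff.rfl ?_ rfl
            have : ∏ i, ((N i : ℝ) / (2 * trapWeight (N i) (k i)))
                = (∏ i, 2 / (N i : ℝ))⁻¹ * (∏ i, trapWeight (N i) (k i))⁻¹ := by
              rw [← Finset.prod_inv_distrib, ← Finset.prod_inv_distrib, ← Finset.prod_mul_distrib]
              exact Finset.prod_congr rfl fun i _ => by rw [inv_div, ← div_div]; ring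
            rw [this]
            have : (∏ i, 2 / (N i : ℝ)) ≠ 0 := Finset.prod_ne_zero_iff.2 fun i _ =>
              div_ne_zero two_ne_zero (Nat.cast_ne_zero.2 (hN i).ne')
            field_simp
    have h5 : ∀ k, (f k - dLap h f k) * G k
        = ∑ ξ ∈ gridIdx N, a ξ * ((f k - dLap h f k) * cosFun N ξ k) := by
      intro k
      rw [hG, Finset.mul_sum]
      exact Finset.sum_congr rfl fun ξ _ => by ring
    simp only [h5]
    rw [gridSum_sum, Finset.sum_congr rfl h1, ← gridSum_sum, gridSum_congr h2, gridSum]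
    have hw : ∏ i, trapWeight (N i) (k₀ i) ≠ 0 :=
      (Finset.prod_pos fun i _ => trapWeight_pos _ _).ne'
    simp only [mul_ite, mul_zero]
    rw [Finset.sum_ite_eq' , if_pos hk₀, ← hH]
    field_simp
  have hnorm : gridSum h N (fun k => G k ^ 2)
      ≤ ∑ ξ ∈ gridIdx N, (∏ i, 2 * trapWeight (N i) (ξ i) / (N i * h i)) /
        (1 + cosEigenvalue h N ξ) ^ 2 := by
    have h1 : ∀ k, G k ^ 2 = ∑ ξ ∈ gridIdx N, ∑ ξ' ∈ gridIdx N,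
        a ξ * a ξ' * (cosFun N ξ k * cosFun N ξ' k) := by
      intro k
      rw [pow_two, hG, Finset.sum_mul_sum]
      exact Finset.sum_congr rfl fun _ _ => Finset.sum_congr rfl fun _ _ => by ring
    simp only [h1]
    rw [gridSum_sum]
    refine Finset.sum_le_sum fun ξ hξ => ?_
    rw [gridSum_sum]
    have h2 : ∀ ξ' ∈ gridIdx N, gridSum h N (fun k => a ξ * a ξ' * (cosFun N ξ k * cosFun N ξ' k))
        = if ξ = ξ' then a ξ * a ξ' * ((c ξ)⁻¹ * H) else 0 := by
      intro ξ' hξ'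
      rw [gridSum_const_mul, gridSum, sum_cosFun_mul_cosFun hN hξ hξ', hcinv, ite_mul, mul_ite, ← hH]
      simp
    rw [Finset.sum_congr rfl h2, Finset.sum_ite_eq, if_pos hξ]
    have hl := hpos ξ hξ
    have h3 : ∏ i, 2 * trapWeight (N i) (ξ i) / (N i * h i) = c ξ / H := by
      rw [hc, hH, ← Finset.prod_div_distrib]
      exact Finset.prod_congr rfl fun i _ => by rw [div_div]
    have hHpos : 0 < H := Finset.prod_pos fun i _ => hh i
    have h4 : cosFun N ξ k₀ ^ 2 ≤ 1 := by
      rw [← sq_abs]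
      exact pow_le_one₀ (abs_nonneg _) (abs_cosFun_le_one _ _ _)
    have hcξ := hc0 ξ
    calc a ξ * a ξ * ((c ξ)⁻¹ * H)
        = c ξ / H / (1 + cosEigenvalue h N ξ) ^ 2 * cosFun N ξ k₀ ^ 2 := by
          rw [ha]; field_simp
      _ ≤ c ξ / H / (1 + cosEigenvalue h N ξ) ^ 2 * 1 := by gcongr
      _ = _ := by rw [h3, mul_one]
  have h6 := gridSum_mul_le_sqrt hh (N := N) (fun k => f k - dLap h f k) G
  have h7 := gridSum_mul_le_sqrt hh (N := N) (fun k => -(f k - dLap h f k)) G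
  simp only [neg_mul, neg_sq] at h7
  rw [gridSum_neg] at h7
  rw [hrep] at h6 h7
  have h8 := mul_le_mul_of_nonneg_left (Real.sqrt_le_sqrt hnorm)
    (Real.sqrt_nonneg (gridSum h N (fun k => (f k - dLap h f k) ^ 2)))
  exact abs_le.2 ⟨by linarith, by linarith⟩

theorem summable_rpow_one_add_mul_sq {c : ℝ} (hc : 0 < c) :
    Summable fun n : ℕ => (1 + c * (n : ℝ) ^ 2) ^ (-(2 / 3) : ℝ) := by
  rw [← summable_nat_add_iff 1]
  have hs : Summable fun n : ℕ => c ^ (-(2 / 3) : ℝ) * ((n + 1 : ℕ) : ℝ) ^ (-(4 / 3) : ℝ) := by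
    refine Summable.mul_left _ ?_
    rw [summable_nat_add_iff 1 (f := fun n : ℕ => (n : ℝ) ^ (-(4 / 3) : ℝ))]
    exact Real.summable_nat_rpow.2 (by norm_num)
  refine Summable.of_nonneg_of_le (fun n => by positivity) (fun n => ?_) hs
  have hn : (0 : ℝ) < ((n + 1 : ℕ) : ℝ) := by positivity
  calc (1 + c * ((n + 1 : ℕ) : ℝ) ^ 2) ^ (-(2 / 3) : ℝ)
      ≤ (c * ((n + 1 : ℕ) : ℝ) ^ 2) ^ (-(2 / 3) : ℝ) :=
        Real.rpow_le_rpow_of_nonpos (by positivity) (by linarith) (by norm_num)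
    _ = _ := by
        rw [Real.mul_rpow hc.le (by positivity), ← Real.rpow_natCast, ← Real.rpow_mul hn.le]
        norm_num

/-- The power `-2` is split evenly among the three factors. Each one-dimensional series then has
terms of order `n ^ (-4 / 3)` and converges; this is where dimension three enters. -/
theorem inv_sq_one_add_sum_le {x : Fin 3 → ℝ} (hx : ∀ i, 0 ≤ x i) :
    1 / (1 + ∑ i, x i) ^ 2 ≤ ∏ i, (1 + x i) ^ (-(2 / 3) : ℝ) := by
  have h0 : 0 ≤ ∑ i, x i := Finset.sum_nonneg fun i _ => hx i
  have h1 : ∀ i, 1 + x i ≤ 1 + ∑ j, x j := fun i => by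
    have := Finset.single_le_sum (fun j _ => hx j) (Finset.mem_univ i)
    linarith
  have h2 : ∏ _i : Fin 3, (1 + ∑ j, x j) ^ (-(2 / 3) : ℝ) ≤ ∏ i, (1 + x i) ^ (-(2 / 3) : ℝ) :=
    Finset.prod_le_prod (fun i _ => by positivity) fun i _ =>
      Real.rpow_le_rpow_of_nonpos (by linarith [hx i]) (h1 i) (by norm_num)
  refine le_trans (le_of_eq ?_) h2
  have h3 : 0 ≤ 1 + ∑ i, x i := by positivity
  rw [Finset.prod_const, Finset.card_univ, Fintype.card_fin]
  generalize 1 + ∑ i, x i = b at h3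
  rw [← Real.rpow_natCast (b ^ _), ← Real.rpow_mul h3,
    show (-(2 / 3) : ℝ) * (3 : ℕ) = -2 by norm_num, Real.rpow_neg h3, one_div, Real.rpow_two]

/-- The Green function sum is dominated by a product of three convergent series that depend only on
the box. No gradient term and no condition on `dLap f` at the faces is needed, which also makes the
passage to the continuous inequality simple. -/
theorem exists_strong_discreteSobolev {ℓ : Fin 3 → ℝ} (hℓ : ∀ i, 0 < ℓ i) :
    ∃ C : ℝ, 0 ≤ C ∧ ∀ N : Fin 3 → ℕ, (∀ i, 0 < N i) → ∀ f : (Fin 3 → ℤ) → ℝ, Reflects N f →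
      ∀ k ∈ gridIdx N, |f k| ≤ C * √(gridSum (mesh ℓ N) N (fun m => f m ^ 2)
        + gridSum (mesh ℓ N) N (fun m => dLap (mesh ℓ N) f m ^ 2)) := by
  set S : ℝ := ∏ i, (2 / ℓ i * ∑' n : ℕ, (1 + 4 / ℓ i ^ 2 * (n : ℝ) ^ 2) ^ (-(2 / 3) : ℝ)) with hS
  refine ⟨√2 * √S, by positivity, fun N hN f hf k hk => ?_⟩
  have hh := fun i => mesh_pos hℓ hN i
  have hx : ∀ (ξ : Fin 3 → ℤ) i, 0 ≤ 4 / ℓ i ^ 2 * (ξ i : ℝ) ^ 2 := fun ξ i => by positivity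
  have hlam : ∀ ξ ∈ gridIdx N, 0 ≤ cosEigenvalue (mesh ℓ N) N ξ := fun ξ hξ =>
    (Finset.sum_nonneg fun i _ => hx ξ i).trans (cosEigenvalue_ge hℓ hN hξ)
  have h1 := abs_le_dNorm_mul_green hh hN hf k hk hlam
  have h2 : ∑ ξ ∈ gridIdx N, (∏ i, 2 * trapWeight (N i) (ξ i) / (N i * mesh ℓ N i)) /
        (1 + cosEigenvalue (mesh ℓ N) N ξ) ^ 2 ≤ S := by
    calc _ ≤ ∑ ξ ∈ gridIdx N, ∏ i,
            (2 / ℓ i * (1 + 4 / ℓ i ^ 2 * (ξ i : ℝ) ^ 2) ^ (-(2 / 3) : ℝ)) := by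
          refine Finset.sum_le_sum fun ξ hξ => ?_
          rw [Finset.prod_mul_distrib, div_eq_mul_one_div]
          refine mul_le_mul ?_ ?_ (by positivity)
            (Finset.prod_nonneg fun i _ => (by have := hℓ i; positivity))
          · refine Finset.prod_le_prod (fun i _ => ?_) fun i _ => ?_
            · have := hh i
              have := trapWeight_nonneg (N i) (ξ i)
              positivity
            · have hN' : (N i : ℝ) ≠ 0 := Nat.cast_ne_zero.2 (hN i).ne'
              rw [mesh, mul_div_cancel₀ _ hN']
              have := hℓ i
              have := trapWeight_le_one (N i) (ξ i)
              gcongr; linarith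
          · refine le_trans ?_ (inv_sq_one_add_sum_le (hx ξ))
            have := Finset.sum_nonneg fun i (_ : i ∈ Finset.univ) => hx ξ i
            have := cosEigenvalue_ge hℓ hN hξ
            gcongr
      _ = ∏ i, ∑ m ∈ Finset.Icc (0 : ℤ) (N i),
            (2 / ℓ i * (1 + 4 / ℓ i ^ 2 * (m : ℝ) ^ 2) ^ (-(2 / 3) : ℝ)) :=
          sum_gridIdx_prod N (fun i m => 2 / ℓ i * (1 + 4 / ℓ i ^ 2 * (m : ℝ) ^ 2) ^ (-(2 / 3) : ℝ))
      _ ≤ S := by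
          refine Finset.prod_le_prod (fun i _ => Finset.sum_nonneg fun m _ => ?_) fun i _ => ?_
          · have := hℓ i; positivity
          · have := hℓ i
            rw [← Finset.mul_sum, sum_Icc_int_eq_sum_range]
            refine mul_le_mul_of_nonneg_left ?_ (by positivity)
            simp only [Int.cast_natCast]
            exact (summable_rpow_one_add_mul_sq (by positivity)).sum_le_tsum _
              fun n _ => by positivity
  have h3 : gridSum (mesh ℓ N) N (fun k => (f k - dLap (mesh ℓ N) f k) ^ 2)
      ≤ 2 * (gridSum (mesh ℓ N) N (fun m => f m ^ 2)
        + gridSum (mesh ℓ N) N (fun m => dLap (mesh ℓ N) f m ^ 2)) := by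
    rw [← gridSum_add, ← gridSum_const_mul]
    exact gridSum_mono hh fun k _ => by nlinarith [sq_nonneg (f k + dLap (mesh ℓ N) f k)]
  calc |f k| ≤ _ := h1
    _ ≤ √(2 * (gridSum (mesh ℓ N) N (fun m => f m ^ 2)
        + gridSum (mesh ℓ N) N (fun m => dLap (mesh ℓ N) f m ^ 2))) * √S :=
      mul_le_mul (Real.sqrt_le_sqrt h3) (Real.sqrt_le_sqrt h2) (Real.sqrt_nonneg _)
        (Real.sqrt_nonneg _)
    _ = _ := by rw [Real.sqrt_mul zero_le_two]; ring

theorem exists_isDiscreteSobolevConst {ℓ : Fin 3 → ℝ} (hℓ : ∀ i, 0 < ℓ i) :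
    ∃ C : ℝ, IsDiscreteSobolevConst ℓ C := by
  obtain ⟨C, hC0, hC⟩ := exists_strong_discreteSobolev hℓ
  refine ⟨C, fun N hN f hf k hk => ?_⟩
  have hh := fun i => mesh_pos hℓ hN i
  refine (hC N hN f ((discreteBC_iff hh).1 hf).1 k hk).trans ?_
  refine mul_le_mul_of_nonneg_left (Real.sqrt_le_sqrt ?_) hC0
  have := gridSum_nonneg hh fun k (_ : k ∈ gridIdx N) => dGradSq_nonneg (mesh ℓ N) f k
  linarith [show gridSum (mesh ℓ N) N (fun k => dGradSq (mesh ℓ N) f k)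
      = gridSum (mesh ℓ N) N (dGradSq (mesh ℓ N) f) from rfl]

/-! ### Even extension -/

/-- The triangle wave of period `2ℓ`: the distance to `2ℓℤ`. -/
noncomputable def tri (ℓ x : ℝ) : ℝ := ‖(x : AddCircle (2 * ℓ))‖

theorem continuous_tri (ℓ : ℝ) : Continuous (tri ℓ) :=
  continuous_norm.comp (AddCircle.continuous_mk' _)

theorem tri_mem {ℓ : ℝ} (hℓ : 0 < ℓ) (x : ℝ) : tri ℓ x ∈ Set.Icc 0 ℓ := by
  refine ⟨norm_nonneg _, ?_⟩
  have := AddCircle.norm_le_half_period (2 * ℓ) (x := (x : AddCircle (2 * ℓ))) (by positivity)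
  rw [abs_of_pos (by positivity)] at this
  unfold tri; linarith

theorem tri_of_mem {ℓ x : ℝ} (hℓ : 0 < ℓ) (hx : x ∈ Set.Icc 0 ℓ) : tri ℓ x = x := by
  have := (AddCircle.norm_coe_eq_abs_iff (2 * ℓ) (x := x) (by positivity)).2
    (by rw [abs_of_nonneg hx.1, abs_of_pos (by positivity)]; linarith [hx.2])
  rw [tri, this, abs_of_nonneg hx.1]

theorem tri_neg (ℓ x : ℝ) : tri ℓ (-x) = tri ℓ x := by
  rw [tri, AddCircle.coe_neg, norm_neg]; rfl

theorem tri_add_period (ℓ x : ℝ) : tri ℓ (x + 2 * ℓ) = tri ℓ x := by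
  rw [tri, AddCircle.coe_add_period]; rfl

theorem apply_tri {F : ℝ → ℝ} {ℓ : ℝ} (heven : ∀ x, F (-x) = F x)
    (hper : Function.Periodic F (2 * ℓ)) (x : ℝ) : F (tri ℓ x) = F x := by
  rw [tri, AddCircle.norm_eq]
  rcases abs_choice (x - round ((2 * ℓ)⁻¹ * x) * (2 * ℓ)) with h | h
  · rw [h, hper.sub_int_mul_eq]
  · rw [h, heven, hper.sub_int_mul_eq]

theorem eq_of_hasDerivAt_zero {f : ℝ → ℝ} (hf : ∀ x, HasDerivAt f 0 x) (x y : ℝ) : f x = f y :=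
  is_const_of_deriv_eq_zero (fun x => (hf x).differentiableAt) (fun x => (hf x).deriv) x y

theorem hasDerivAt_comp_neg' {F : ℝ → ℝ} {c s : ℝ} (hF : HasDerivAt F c (-s)) :
    HasDerivAt (fun s => F (-s)) (-c) s :=
  (hF.comp s (hasDerivAt_neg s)).congr_deriv (by ring)

theorem eqOn_Icc_of_hasDerivWithinAt {ℓ : ℝ} {f g f' : ℝ → ℝ}
    (hf : ∀ s ∈ Set.Icc 0 ℓ, HasDerivWithinAt f (f' s) (Set.Icc 0 ℓ) s)
    (hg : ∀ s ∈ Set.Icc 0 ℓ, HasDerivWithinAt g (f' s) (Set.Icc 0 ℓ) s) (h0 : f 0 = g 0) :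
    ∀ s ∈ Set.Icc 0 ℓ, f s = g s := by
  intro s hs
  have h := (convex_Icc 0 ℓ).norm_image_sub_le_of_norm_hasDerivWithin_le (C := 0)
    (fun s hs => (hf s hs).sub (hg s hs)) (fun s _ => by simp)
    (Set.left_mem_Icc.2 (hs.1.trans hs.2)) hs
  rw [zero_mul, norm_le_zero_iff] at h
  simp only [Pi.sub_apply, h0, sub_self, sub_zero] at h
  exact sub_eq_zero.1 h

/-- The even `2ℓ`-periodic extension of a `C²` function whose derivative vanishes at both ends is
`C²`. -/
theorem hasDerivAt_comp_tri {ℓ : ℝ} (hℓ : 0 < ℓ) {g g₁ g₂ : ℝ → ℝ}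
    (h1 : ∀ s ∈ Set.Icc 0 ℓ, HasDerivWithinAt g (g₁ s) (Set.Icc 0 ℓ) s)
    (h2 : ∀ s ∈ Set.Icc 0 ℓ, HasDerivWithinAt g₁ (g₂ s) (Set.Icc 0 ℓ) s)
    (hc : ContinuousOn g₂ (Set.Icc 0 ℓ)) (b0 : g₁ 0 = 0) (b1 : g₁ ℓ = 0) :
    ∃ G₁ : ℝ → ℝ, ∀ s, HasDerivAt (fun s => g (tri ℓ s)) (G₁ s) s ∧
      HasDerivAt G₁ (g₂ (tri ℓ s)) s := by
  have hφ : Continuous fun s => g₂ (tri ℓ s) :=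
    hc.comp_continuous (continuous_tri ℓ) (tri_mem hℓ)
  -- The extension is built from the top derivative downwards: the continuous function `g₂ ∘ tri` is
  -- integrated twice, which gives a `C²` function at once. It remains to identify the result with
  -- `g ∘ tri`, by uniqueness on `[0, ℓ]` and by parity and periodicity elsewhere.
  set G₁ : ℝ → ℝ := fun x => ∫ s in (0 : ℝ)..x, g₂ (tri ℓ s) with hG₁
  have d1 : ∀ s, HasDerivAt G₁ (g₂ (tri ℓ s)) s := fun s =>
    (hφ.integral_hasStrictDerivAt 0 s).hasDerivAt
  have hG₁c : Continuous G₁ := continuous_iff_continuousAt.2 fun s => (d1 s).continuousAt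
  set G₀ : ℝ → ℝ := fun x => g 0 + ∫ s in (0 : ℝ)..x, G₁ s with hG₀
  have d0 : ∀ s, HasDerivAt G₀ (G₁ s) s := fun s =>
    ((hG₁c.integral_hasStrictDerivAt 0 s).hasDerivAt).const_add _
  have e1 : ∀ s ∈ Set.Icc 0 ℓ, G₁ s = g₁ s := by
    refine eqOn_Icc_of_hasDerivWithinAt (f' := g₂) (fun s hs => ?_) h2 ?_
    · have := (d1 s).hasDerivWithinAt (s := Set.Icc 0 ℓ)
      rwa [tri_of_mem hℓ hs] at this
    · simp [hG₁, b0]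
  have e0 : ∀ s ∈ Set.Icc 0 ℓ, G₀ s = g s := by
    refine eqOn_Icc_of_hasDerivWithinAt (f' := g₁) (fun s hs => ?_) h1 ?_
    · have := (d0 s).hasDerivWithinAt (s := Set.Icc 0 ℓ)
      rwa [e1 s hs] at this
    · simp [hG₀]
  have odd1 : ∀ s, G₁ (-s) = - G₁ s := by
    intro s
    have := eq_of_hasDerivAt_zero (f := fun s => G₁ (-s) + G₁ s) (fun s => by
      have := (hasDerivAt_comp_neg' (d1 (-s))).add (d1 s)
      rwa [tri_neg, neg_add_cancel] at this) s 0
    have h0 : G₁ 0 = 0 := by simp [hG₁]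
    simp only [neg_zero, h0, add_zero] at this
    linarith
  have even0 : ∀ s, G₀ (-s) = G₀ s := by
    intro s
    have := eq_of_hasDerivAt_zero (f := fun s => G₀ (-s) - G₀ s) (fun s => by
      have := (hasDerivAt_comp_neg' (d0 (-s))).sub (d0 s)
      rwa [odd1, neg_neg, sub_self] at this) s 0
    simp only [neg_zero, sub_self] at this
    linarith
  have hℓ' : G₁ ℓ = 0 := by rw [e1 ℓ (Set.right_mem_Icc.2 hℓ.le), b1]
  -- The difference `G₁ (s + 2 * ℓ) - G₁ s` is constant; at `s = -ℓ` oddness makes it `2 * G₁ ℓ`,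
  -- which vanishes by the Neumann condition at `ℓ`.
  have per1 : ∀ s, G₁ (s + 2 * ℓ) = G₁ s := by
    intro s
    have := eq_of_hasDerivAt_zero (f := fun s => G₁ (s + 2 * ℓ) - G₁ s) (fun s => by
      have := ((d1 (s + 2 * ℓ)).comp_add_const s (2 * ℓ)).sub (d1 s)
      rwa [tri_add_period, sub_self] at this) s (-ℓ)
    simp only [show -ℓ + 2 * ℓ = ℓ by ring, odd1 ℓ, hℓ'] at this
    linarith
  have per0 : ∀ s, G₀ (s + 2 * ℓ) = G₀ s := by
    intro s
    have := eq_of_hasDerivAt_zero (f := fun s => G₀ (s + 2 * ℓ) - G₀ s) (fun s => by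
      have := ((d0 (s + 2 * ℓ)).comp_add_const s (2 * ℓ)).sub (d0 s)
      rwa [per1, sub_self] at this) s (-ℓ)
    simp only [show -ℓ + 2 * ℓ = ℓ by ring, even0 ℓ, sub_self] at this
    linarith
  have hg : (fun s => g (tri ℓ s)) = G₀ := by
    ext s
    rw [← e0 _ (tri_mem hℓ s), apply_tri even0 per0]
  exact ⟨G₁, fun s => ⟨by rw [hg]; exact d0 s, d1 s⟩⟩

/-- The point of the box obtained from `x` by reflecting across the faces. -/
noncomputable def refl (ℓ x : Fin 3 → ℝ) : Fin 3 → ℝ := fun i => tri (ℓ i) (x i)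

theorem mem_box {ℓ p : Fin 3 → ℝ} : p ∈ box ℓ ↔ ∀ i, p i ∈ Set.Icc 0 (ℓ i) := by
  simp only [box, Set.mem_Icc, Pi.le_def, Pi.zero_apply]
  exact ⟨fun h i => ⟨h.1 i, h.2 i⟩, fun h => ⟨fun i => (h i).1, fun i => (h i).2⟩⟩

theorem refl_mem {ℓ : Fin 3 → ℝ} (hℓ : ∀ i, 0 < ℓ i) (x : Fin 3 → ℝ) : refl ℓ x ∈ box ℓ :=
  mem_box.2 fun i => tri_mem (hℓ i) (x i)

theorem refl_of_mem {ℓ : Fin 3 → ℝ} (hℓ : ∀ i, 0 < ℓ i) {x : Fin 3 → ℝ} (hx : x ∈ box ℓ) :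
    refl ℓ x = x := by
  ext i; exact tri_of_mem (hℓ i) (mem_box.1 hx i)

theorem continuous_refl (ℓ : Fin 3 → ℝ) : Continuous (refl ℓ) :=
  continuous_pi fun i => (continuous_tri (ℓ i)).comp (continuous_apply i)

theorem update_mem_box {ℓ p : Fin 3 → ℝ} (hp : p ∈ box ℓ) {i : Fin 3} {s : ℝ}
    (hs : s ∈ Set.Icc 0 (ℓ i)) : Function.update p i s ∈ box ℓ := by
  rw [mem_box] at hp ⊢
  intro j
  by_cases hj : j = i
  · subst hj; simpa using hs
  · simpa [hj] using hp j

theorem gridPt_mem_box {ℓ : Fin 3 → ℝ} (hℓ : ∀ i, 0 < ℓ i) {N : Fin 3 → ℕ} (hN : ∀ i, 0 < N i)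
    {k : Fin 3 → ℤ} (hk : k ∈ gridIdx N) : gridPt (mesh ℓ N) k ∈ box ℓ := by
  refine mem_box.2 fun i => ?_
  obtain ⟨h0, h1⟩ := mem_gridIdx.1 hk i
  have h0' : (0 : ℝ) ≤ k i := by exact_mod_cast h0
  have h1' : (k i : ℝ) ≤ N i := by exact_mod_cast h1
  have hN' : (0 : ℝ) < N i := Nat.cast_pos.2 (hN i)
  have := hℓ i
  refine ⟨by simp only [gridPt, mesh]; positivity, ?_⟩
  rw [gridPt, mesh, ← mul_div_assoc, div_le_iff₀ hN', mul_comm]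
  gcongr

/-! ### Second derivatives along the coordinates and difference quotients -/

/-- `F₂` is the second derivative of `F` in the `i`-th coordinate. -/
def SecDeriv (i : Fin 3) (F F₂ : (Fin 3 → ℝ) → ℝ) : Prop :=
  ∀ x : Fin 3 → ℝ, ∃ G₁ : ℝ → ℝ, ∀ s, HasDerivAt (fun s => F (x + Pi.single i s)) (G₁ s) s ∧
    HasDerivAt G₁ (F₂ (x + Pi.single i s)) s

/-- The second difference quotient in the `i`-th coordinate. -/
noncomputable def secDiff (h : ℝ) (i : Fin 3) (F : (Fin 3 → ℝ) → ℝ) (x : Fin 3 → ℝ) : ℝ :=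
  (F (x + Pi.single i h) - 2 * F x + F (x - Pi.single i h)) / h ^ 2

theorem SecDeriv.sub {i : Fin 3} {F F₂ G G₂ : (Fin 3 → ℝ) → ℝ} (hF : SecDeriv i F F₂)
    (hG : SecDeriv i G G₂) : SecDeriv i (fun x => F x - G x) (fun x => F₂ x - G₂ x) := by
  intro x
  obtain ⟨f, hf⟩ := hF x
  obtain ⟨g, hg⟩ := hG x
  exact ⟨fun s => f s - g s, fun s => ⟨(hf s).1.sub (hg s).1, (hf s).2.sub (hg s).2⟩⟩

theorem SecDeriv.secDiff {i : Fin 3} {F F₂ : (Fin 3 → ℝ) → ℝ} (hF : SecDeriv i F F₂) (h : ℝ)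
    (j : Fin 3) : SecDeriv i (secDiff h j F) (secDiff h j F₂) := by
  intro x
  obtain ⟨f, hf⟩ := hF x
  obtain ⟨fp, hp⟩ := hF (x + Pi.single j h)
  obtain ⟨fm, hm⟩ := hF (x - Pi.single j h)
  have e1 : ∀ s : ℝ, x + Pi.single i s + Pi.single j h = x + Pi.single j h + Pi.single i s :=
    fun s => add_right_comm _ _ _
  have e2 : ∀ s : ℝ, x + Pi.single i s - Pi.single j h = x - Pi.single j h + Pi.single i s :=
    fun s => add_sub_right_comm _ _ _
  refine ⟨fun s => (fp s - 2 * f s + fm s) / h ^ 2, fun s => ⟨?_, ?_⟩⟩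
  · simp only [SwiftHohenberg.secDiff, e1, e2]
    exact (((hp s).1.sub ((hf s).1.const_mul 2)).add (hm s).1).div_const _
  · simp only [SwiftHohenberg.secDiff, e1, e2]
    exact (((hp s).2.sub ((hf s).2.const_mul 2)).add (hm s).2).div_const _

theorem abs_le_of_second_deriv_le {ψ ψ₁ ψ₂ : ℝ → ℝ} {h M : ℝ} (hh : 0 ≤ h) (hM : 0 ≤ M)
    (d0 : ∀ s, HasDerivAt ψ (ψ₁ s) s) (d1 : ∀ s, HasDerivAt ψ₁ (ψ₂ s) s) (h0 : ψ 0 = 0)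
    (h1 : ψ₁ 0 = 0) (hb : ∀ s ∈ Set.Icc 0 h, |ψ₂ s| ≤ M) : |ψ h| ≤ M * h ^ 2 := by
  have hz : (0 : ℝ) ∈ Set.Icc 0 h := Set.left_mem_Icc.2 hh
  have a1 : ∀ s ∈ Set.Icc 0 h, |ψ₁ s| ≤ M * h := by
    intro s hs
    have := (convex_Icc 0 h).norm_image_sub_le_of_norm_hasDerivWithin_le
      (fun s _ => (d1 s).hasDerivWithinAt) hb hz hs
    rw [h1, sub_zero, sub_zero, Real.norm_eq_abs, Real.norm_eq_abs, abs_of_nonneg hs.1] at this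
    exact this.trans (mul_le_mul_of_nonneg_left hs.2 hM)
  have := (convex_Icc 0 h).norm_image_sub_le_of_norm_hasDerivWithin_le
      (fun s _ => (d0 s).hasDerivWithinAt) a1 hz (Set.right_mem_Icc.2 hh)
  rw [h0, sub_zero, sub_zero, Real.norm_eq_abs, Real.norm_eq_abs, abs_of_nonneg hh] at this
  linarith

/-- The symmetric second difference, as a function of the step `s`, vanishes to first order at `0`.
The free constant `c` is `0` when bounding difference quotients, and `F₂ x` when comparing them with
the derivative. -/
theorem SecDeriv.hasDerivAt_symm {i : Fin 3} {F F₂ : (Fin 3 → ℝ) → ℝ} (hF : SecDeriv i F F₂)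
    (x : Fin 3 → ℝ) (c : ℝ) : ∃ ψ₁ : ℝ → ℝ, ψ₁ 0 = 0 ∧
      (∀ s, HasDerivAt (fun s => F (x + Pi.single i s) - 2 * F x + F (x - Pi.single i s)
        - c * s ^ 2) (ψ₁ s) s) ∧
      ∀ s, HasDerivAt ψ₁ (F₂ (x + Pi.single i s) + F₂ (x - Pi.single i s) - 2 * c) s := by
  obtain ⟨f, hf⟩ := hF x
  refine ⟨fun s => f s - f (-s) - 2 * c * s, by simp, fun s => ?_, fun s => ?_⟩
  · have a := hasDerivAt_comp_neg' (hf (-s)).1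
    simp only [Pi.single_neg, ← sub_eq_add_neg] at a
    refine ((((hf s).1.sub_const (2 * F x)).add a).sub
      ((hasDerivAt_pow 2 s).const_mul c)).congr_deriv ?_
    push_cast; ring
  · have a := hasDerivAt_comp_neg' (hf (-s)).2
    simp only [Pi.single_neg, ← sub_eq_add_neg] at a
    refine (((hf s).2.sub a).sub ((hasDerivAt_id s).const_mul (2 * c))).congr_deriv ?_
    ring

theorem SecDeriv.abs_second_diff_le {i : Fin 3} {F F₂ : (Fin 3 → ℝ) → ℝ} (hF : SecDeriv i F F₂)
    {B : ℝ} (hB : ∀ x, |F₂ x| ≤ B) (x : Fin 3 → ℝ) {h : ℝ} (hh : 0 ≤ h) :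
    |F (x + Pi.single i h) - 2 * F x + F (x - Pi.single i h)| ≤ 2 * B * h ^ 2 := by
  obtain ⟨ψ₁, h1, d0, d1⟩ := hF.hasDerivAt_symm x 0
  have hB0 : 0 ≤ B := (abs_nonneg _).trans (hB x)
  have := abs_le_of_second_deriv_le hh (by positivity : 0 ≤ 2 * B) d0 d1
    (by simp; ring) h1 (fun s _ => by
      have a := abs_le.1 (hB (x + Pi.single i s))
      have b := abs_le.1 (hB (x - Pi.single i s))
      exact abs_le.2 ⟨by linarith, by linarith⟩)
  simpa using this

theorem SecDeriv.abs_secDiff_le {i : Fin 3} {F F₂ : (Fin 3 → ℝ) → ℝ} (hF : SecDeriv i F F₂)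
    {B : ℝ} (hB : ∀ x, |F₂ x| ≤ B) (x : Fin 3 → ℝ) {h : ℝ} (hh : 0 < h) :
    |SwiftHohenberg.secDiff h i F x| ≤ 2 * B := by
  rw [SwiftHohenberg.secDiff, abs_div, abs_of_pos (by positivity : 0 < h ^ 2),
    div_le_iff₀ (by positivity)]
  exact hF.abs_second_diff_le hB x hh.le

/-- With `c = F₂ x`, the second derivative in `s` of the remainder is itself a symmetric second
difference of `F₂`, hence `O(s ^ 2)`; integrating twice gives `O(h ^ 4)` before division by `h ^ 2`.
-/
theorem SecDeriv.abs_secDiff_sub_le {i : Fin 3} {F F₂ F₄ : (Fin 3 → ℝ) → ℝ}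
    (hF : SecDeriv i F F₂) (hF₂ : SecDeriv i F₂ F₄)
    {B : ℝ} (hB : ∀ x, |F₄ x| ≤ B) (x : Fin 3 → ℝ) {h : ℝ} (hh : 0 < h) :
    |SwiftHohenberg.secDiff h i F x - F₂ x| ≤ 2 * B * h ^ 2 := by
  obtain ⟨ψ₁, h1, d0, d1⟩ := hF.hasDerivAt_symm x (F₂ x)
  have hB0 : 0 ≤ B := (abs_nonneg _).trans (hB x)
  have := abs_le_of_second_deriv_le hh.le (by positivity : 0 ≤ 2 * B * h ^ 2) d0 d1
    (by simp; ring) h1 (fun s hs => by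
      have a := hF₂.abs_second_diff_le hB x hs.1
      have b : 2 * B * s ^ 2 ≤ 2 * B * h ^ 2 := by
        have := pow_le_pow_left₀ hs.1 hs.2 2
        gcongr
      refine le_trans (le_of_eq ?_) (a.trans b)
      congr 1; ring)
  have e : SwiftHohenberg.secDiff h i F x - F₂ x
      = (F (x + Pi.single i h) - 2 * F x + F (x - Pi.single i h) - F₂ x * h ^ 2) / h ^ 2 := by
    rw [SwiftHohenberg.secDiff]; field_simp
  rw [e, abs_div, abs_of_pos (by positivity : 0 < h ^ 2), div_le_iff₀ (by positivity)]
  exact this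

theorem gridPt_add_single (h : Fin 3 → ℝ) (k : Fin 3 → ℤ) (i : Fin 3) :
    gridPt h (k + Pi.single i 1) = gridPt h k + Pi.single i (h i) := by
  ext j; by_cases hj : j = i
  · subst hj; simp [gridPt, add_mul]
  · simp [gridPt, hj]

theorem gridPt_sub_single (h : Fin 3 → ℝ) (k : Fin 3 → ℤ) (i : Fin 3) :
    gridPt h (k - Pi.single i 1) = gridPt h k - Pi.single i (h i) := by
  ext j; by_cases hj : j = i
  · subst hj; simp [gridPt, sub_mul]
  · simp [gridPt, hj]

theorem dLap_comp_gridPt (h : Fin 3 → ℝ) (F : (Fin 3 → ℝ) → ℝ) :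
    dLap h (fun k => F (gridPt h k)) = fun k => ∑ i, secDiff (h i) i F (gridPt h k) := by
  ext k
  refine Finset.sum_congr rfl fun i _ => ?_
  rw [dPlus_dMinus, secDiff, gridPt_add_single, gridPt_sub_single]

theorem abs_dLap_sub_le {h : Fin 3 → ℝ} (hh : ∀ i, 0 < h i) {F : (Fin 3 → ℝ) → ℝ}
    {F₂ F₄ : Fin 3 → (Fin 3 → ℝ) → ℝ} (h2 : ∀ i, SecDeriv i F (F₂ i))
    (h4 : ∀ i, SecDeriv i (F₂ i) (F₄ i)) {B : ℝ} (hB : ∀ i x, |F₄ i x| ≤ B) (k : Fin 3 → ℤ) :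
    |dLap h (fun k => F (gridPt h k)) k - ∑ i, F₂ i (gridPt h k)| ≤ 2 * B * ∑ i, h i ^ 2 := by
  rw [dLap_comp_gridPt, ← Finset.sum_sub_distrib, Finset.mul_sum]
  refine (Finset.abs_sum_le_sum_abs _ _).trans (Finset.sum_le_sum fun i _ => ?_)
  exact (h2 i).abs_secDiff_sub_le (h4 i) (hB i) _ (hh i)

/-- A naive estimate of a difference quotient of a truncation error would lose `h⁻²`. Instead, the
`j`-th truncation error `secDiff (h j) j F - F₂ j` has as its second `i`-derivative the truncation
error of `F₂ i`, which is `O(h j ^ 2)` by six derivatives and `hcomm`. Its second difference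
quotient is then of the same size. -/
theorem abs_dLap_dLap_sub_le {h : Fin 3 → ℝ} (hh : ∀ i, 0 < h i) {F : (Fin 3 → ℝ) → ℝ}
    {F₂ : Fin 3 → (Fin 3 → ℝ) → ℝ} {F₄ : Fin 3 → Fin 3 → (Fin 3 → ℝ) → ℝ}
    {F₆ : Fin 3 → Fin 3 → Fin 3 → (Fin 3 → ℝ) → ℝ} (h2 : ∀ i, SecDeriv i F (F₂ i))
    (h4 : ∀ i j, SecDeriv i (F₂ j) (F₄ i j)) (h6 : ∀ i j l, SecDeriv i (F₄ j l) (F₆ i j l))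
    (hcomm : ∀ i j, F₄ i j = F₄ j i) {B : ℝ} (hB : ∀ i j l x, |F₆ i j l x| ≤ B)
    (k : Fin 3 → ℤ) :
    |dLap h (dLap h (fun k => F (gridPt h k))) k - ∑ i, ∑ j, F₄ i j (gridPt h k)|
      ≤ 18 * B * ∑ i, h i ^ 2 := by
  have e : dLap h (dLap h (fun k => F (gridPt h k))) k
      = ∑ i, ∑ j, secDiff (h i) i (secDiff (h j) j F) (gridPt h k) := by
    rw [dLap_comp_gridPt, dLap_comp_gridPt h (fun x => ∑ i, secDiff (h i) i F x)]
    refine Finset.sum_congr rfl fun i _ => ?_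
    simp only [secDiff]
    rw [Finset.mul_sum, ← Finset.sum_sub_distrib, ← Finset.sum_add_distrib, Finset.sum_div]
  have key : ∀ i j x, |secDiff (h i) i (secDiff (h j) j F) x - F₄ i j x|
      ≤ 4 * B * h j ^ 2 + 2 * B * h i ^ 2 := by
    intro i j x
    have a1 : ∀ y, |secDiff (h j) j (F₂ i) y - F₄ i j y| ≤ 2 * B * h j ^ 2 := by
      intro y
      rw [hcomm i j]
      exact (h4 j i).abs_secDiff_sub_le (h6 j j i) (hB j j i) y (hh j)
    have a2 := (((h2 i).secDiff (h j) j).sub (h4 i j)).abs_secDiff_le a1 x (hh i)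
    have a3 := (h4 i j).abs_secDiff_sub_le (h6 i i j) (hB i i j) x (hh i)
    have a4 : secDiff (h i) i (secDiff (h j) j F) x - F₄ i j x
        = secDiff (h i) i (fun x => secDiff (h j) j F x - F₂ j x) x
          + (secDiff (h i) i (F₂ j) x - F₄ i j x) := by
      simp only [secDiff]; ring
    rw [a4]
    refine (abs_add_le _ _).trans ?_
    linarith
  rw [e, ← Finset.sum_sub_distrib]
  calc _ ≤ ∑ i, ∑ j, (4 * B * h j ^ 2 + 2 * B * h i ^ 2) := by
        refine (Finset.abs_sum_le_sum_abs _ _).trans (Finset.sum_le_sum fun i _ => ?_)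
        rw [← Finset.sum_sub_distrib]
        exact (Finset.abs_sum_le_sum_abs _ _).trans (Finset.sum_le_sum fun j _ => key i j _)
    _ = _ := by
        simp only [Fin.sum_univ_three]; ring

/-! ### Grid functions sampled from even extensions -/

/-- The grid function with the values of the even extension of `v`. -/
noncomputable def sample (ℓ h : Fin 3 → ℝ) (v : (Fin 3 → ℝ) → ℝ) (k : Fin 3 → ℤ) : ℝ :=
  v (refl ℓ (gridPt h k))

theorem sample_of_mem {ℓ : Fin 3 → ℝ} (hℓ : ∀ i, 0 < ℓ i) {N : Fin 3 → ℕ} (hN : ∀ i, 0 < N i)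
    (v : (Fin 3 → ℝ) → ℝ) {k : Fin 3 → ℤ} (hk : k ∈ gridIdx N) :
    sample ℓ (mesh ℓ N) v k = v (gridPt (mesh ℓ N) k) := by
  rw [sample, refl_of_mem hℓ (gridPt_mem_box hℓ hN hk)]

theorem dLap_apply_reflect (h : Fin 3 → ℝ) {i : Fin 3} {c : ℤ} {f : (Fin 3 → ℤ) → ℝ}
    (hf : ∀ k, f (Function.update k i (c - k i)) = f k) (k : Fin 3 → ℤ) :
    dLap h f (Function.update k i (c - k i)) = dLap h f k := by
  refine Finset.sum_congr rfl fun j _ => ?_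
  rw [dPlus_dMinus, dPlus_dMinus, hf]
  by_cases hj : j = i
  · subst hj
    have e1 : Function.update k j (c - k j) + Pi.single j 1
        = Function.update (k - Pi.single j 1) j (c - (k - Pi.single j 1 : Fin 3 → ℤ) j) := by
      ext m; by_cases hm : m = j
      · subst hm; simp; ring
      · simp [hm]
    have e2 : Function.update k j (c - k j) - Pi.single j 1
        = Function.update (k + Pi.single j 1) j (c - (k + Pi.single j 1 : Fin 3 → ℤ) j) := by
      ext m; by_cases hm : m = j
      · subst hm; simp; ring
      · simp [hm]
    rw [e1, e2, hf, hf]; ring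
  · have e1 : Function.update k i (c - k i) + Pi.single j 1
        = Function.update (k + Pi.single j 1) i (c - (k + Pi.single j 1 : Fin 3 → ℤ) i) := by
      ext m; by_cases hm : m = i
      · subst hm; simp [Pi.single_eq_of_ne (Ne.symm hj)]
      · simp [hm]
    have e2 : Function.update k i (c - k i) - Pi.single j 1
        = Function.update (k - Pi.single j 1) i (c - (k - Pi.single j 1 : Fin 3 → ℤ) i) := by
      ext m; by_cases hm : m = i
      · subst hm; simp [Pi.single_eq_of_ne (Ne.symm hj)]
      · simp [hm]
    rw [e1, e2, hf, hf]

theorem reflects_of_apply_reflect {N : Fin 3 → ℕ} {f : (Fin 3 → ℤ) → ℝ}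
    (h0 : ∀ i k, f (Function.update k i (0 - k i)) = f k)
    (h1 : ∀ i k, f (Function.update k i (2 * N i - k i)) = f k) : Reflects N f := by
  intro i k _ hki
  rcases hki with h | h
  · rw [← h0 i (k - Pi.single i 1)]
    congr 1
    ext m; by_cases hm : m = i
    · subst hm; simp [h]
    · simp [hm]
  · rw [← h1 i (k - Pi.single i 1)]
    congr 1
    ext m; by_cases hm : m = i
    · subst hm; simp [h]; ring
    · simp [hm]

/-- The extension is invariant under reflection in every face, hence so is its discrete Laplacian.
This is pure symmetry; the smoothness of `v` plays no part. -/
theorem sample_discreteBC {ℓ : Fin 3 → ℝ} (hℓ : ∀ i, 0 < ℓ i) {N : Fin 3 → ℕ} (hN : ∀ i, 0 < N i)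
    (v : (Fin 3 → ℝ) → ℝ) : DiscreteBC (mesh ℓ N) N (sample ℓ (mesh ℓ N) v) := by
  have h0 : ∀ i k, sample ℓ (mesh ℓ N) v (Function.update k i (0 - k i))
      = sample ℓ (mesh ℓ N) v k := by
    intro i k
    rw [sample, sample]
    congr 1
    ext m; by_cases hm : m = i
    · subst hm
      simp only [refl, gridPt, Function.update_self, zero_sub, Int.cast_neg, neg_mul, tri_neg]
    · simp [refl, gridPt, hm]
  have h1 : ∀ i k, sample ℓ (mesh ℓ N) v (Function.update k i (2 * N i - k i))
      = sample ℓ (mesh ℓ N) v k := by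
    intro i k
    rw [sample, sample]
    congr 1
    ext m; by_cases hm : m = i
    · subst hm
      have hN' : (N m : ℝ) ≠ 0 := Nat.cast_ne_zero.2 (hN m).ne'
      have : ((2 * N m - k m : ℤ) : ℝ) * mesh ℓ N m = -(k m * mesh ℓ N m) + 2 * ℓ m := by
        rw [mesh]; push_cast; field_simp; ring
      simp only [refl, gridPt, Function.update_self]
      rw [this, tri_add_period, tri_neg]
    · simp [refl, gridPt, hm]
  refine (discreteBC_iff fun i => mesh_pos hℓ hN i).2 ⟨reflects_of_apply_reflect h0 h1, ?_⟩
  exact reflects_of_apply_reflect (fun i => dLap_apply_reflect _ (h0 i))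
    fun i => dLap_apply_reflect _ (h1 i)

/-! ### Calculus on the space-time slab -/

/-- The box times the half line of nonnegative times. -/
def slab (ℓ : Fin 3 → ℝ) : Set ((Fin 3 → ℝ) × ℝ) := box ℓ ×ˢ Set.Ici 0

theorem convex_slab (ℓ : Fin 3 → ℝ) : Convex ℝ (slab ℓ) :=
  (convex_Icc 0 ℓ).prod (convex_Ici 0)

theorem interior_slab_nonempty {ℓ : Fin 3 → ℝ} (hℓ : ∀ i, 0 < ℓ i) :
    (interior (slab ℓ)).Nonempty := by
  rw [slab, interior_prod_eq, interior_Ici, box, ← Set.pi_univ_Icc, interior_pi_set Set.finite_univ]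
  refine Set.Nonempty.prod ?_ ⟨1, by simp⟩
  refine ⟨fun i => ℓ i / 2, fun i _ => ?_⟩
  have := hℓ i
  change ℓ i / 2 ∈ interior (Set.Icc (0 : ℝ) (ℓ i))
  rw [interior_Icc]
  exact ⟨by simpa using this, by linarith⟩

theorem uniqueDiffOn_slab {ℓ : Fin 3 → ℝ} (hℓ : ∀ i, 0 < ℓ i) : UniqueDiffOn ℝ (slab ℓ) :=
  uniqueDiffOn_convex (convex_slab ℓ) (interior_slab_nonempty hℓ)

theorem slab_subset_closure {ℓ : Fin 3 → ℝ} (hℓ : ∀ i, 0 < ℓ i) :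
    slab ℓ ⊆ closure (interior (slab ℓ)) := by
  rw [(convex_slab ℓ).closure_interior_eq_closure_of_nonempty_interior (interior_slab_nonempty hℓ)]
  exact subset_closure

theorem mk_mem_slab {ℓ p : Fin 3 → ℝ} (hp : p ∈ box ℓ) {t : ℝ} (ht : 0 ≤ t) : (p, t) ∈ slab ℓ :=
  ⟨hp, ht⟩

/-- Derivative in the direction `e` within the slab. -/
noncomputable def dirD (ℓ : Fin 3 → ℝ) (e : (Fin 3 → ℝ) × ℝ) (f : (Fin 3 → ℝ) × ℝ → ℝ) :
    (Fin 3 → ℝ) × ℝ → ℝ :=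
  fun z => fderivWithin ℝ f (slab ℓ) z e

/-- The `i`-th space derivative. -/
noncomputable abbrev dX (ℓ : Fin 3 → ℝ) (i : Fin 3) := dirD ℓ (Pi.single i 1, 0)

/-- The time derivative. -/
noncomputable abbrev dT (ℓ : Fin 3 → ℝ) := dirD ℓ (0, 1)

/-- The second derivative in the `i`-th coordinate. -/
noncomputable abbrev dXX (ℓ : Fin 3 → ℝ) (i : Fin 3) (f : (Fin 3 → ℝ) × ℝ → ℝ) :=
  dX ℓ i (dX ℓ i f)

section Slab

variable {ℓ : Fin 3 → ℝ} {f g : (Fin 3 → ℝ) × ℝ → ℝ}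

theorem dirD_congr (e : (Fin 3 → ℝ) × ℝ) (h : Set.EqOn f g (slab ℓ)) :
    Set.EqOn (dirD ℓ e f) (dirD ℓ e g) (slab ℓ) := fun z hz => by
  rw [dirD, dirD, fderivWithin_congr h (h hz)]

theorem ContDiffOn.dirD (hℓ : ∀ i, 0 < ℓ i) {n m : WithTop ℕ∞} (hf : ContDiffOn ℝ n f (slab ℓ))
    (hmn : m + 1 ≤ n) (e : (Fin 3 → ℝ) × ℝ) : ContDiffOn ℝ m (dirD ℓ e f) (slab ℓ) :=
  (hf.fderivWithin (uniqueDiffOn_slab hℓ) hmn).clm_apply contDiffOn_const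

theorem ContDiffOn.dXX (hℓ : ∀ i, 0 < ℓ i) {n m : WithTop ℕ∞} (hf : ContDiffOn ℝ n f (slab ℓ))
    (hmn : m + 2 ≤ n) (i : Fin 3) : ContDiffOn ℝ m (dXX ℓ i f) (slab ℓ) := by
  have : m + 1 + 1 ≤ n := by rwa [add_assoc, one_add_one_eq_two]
  exact (hf.dirD hℓ this _).dirD hℓ le_rfl _

theorem dirD_comm (hℓ : ∀ i, 0 < ℓ i) (hf : ContDiffOn ℝ 2 f (slab ℓ))
    (e e' : (Fin 3 → ℝ) × ℝ) :
    Set.EqOn (dirD ℓ e (dirD ℓ e' f)) (dirD ℓ e' (dirD ℓ e f)) (slab ℓ) := by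
  intro z hz
  have hu := uniqueDiffOn_slab hℓ
  have hd : DifferentiableWithinAt ℝ (fderivWithin ℝ f (slab ℓ)) (slab ℓ) z :=
    (hf.fderivWithin hu (m := 1) (by norm_num)).differentiableOn (by norm_num) z hz
  have key : ∀ a b : (Fin 3 → ℝ) × ℝ, dirD ℓ a (dirD ℓ b f) z
      = fderivWithin ℝ (fderivWithin ℝ f (slab ℓ)) (slab ℓ) z a b := by
    intro a b
    have := (hd.hasFDerivWithinAt.clm_apply (hasFDerivWithinAt_const b z _)).fderivWithin (hu z hz)
    change fderivWithin ℝ (fun y => fderivWithin ℝ f (slab ℓ) y b) (slab ℓ) z a = _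
    rw [this]; simp
  rw [key, key]
  exact (hf z hz).isSymmSndFDerivWithinAt (by simp) hu (slab_subset_closure hℓ hz) hz e e'

theorem dirD_dXX (hℓ : ∀ i, 0 < ℓ i) (hf : ContDiffOn ℝ 3 f (slab ℓ)) (e : (Fin 3 → ℝ) × ℝ)
    (i : Fin 3) : Set.EqOn (dirD ℓ e (dXX ℓ i f)) (dXX ℓ i (dirD ℓ e f)) (slab ℓ) :=
  (dirD_comm hℓ (hf.dirD hℓ (by norm_num) _) _ _).trans
    (dirD_congr _ (dirD_comm hℓ (hf.of_le (by norm_num)) _ _))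

theorem dXX_comm (hℓ : ∀ i, 0 < ℓ i) (hf : ContDiffOn ℝ 4 f (slab ℓ)) (i j : Fin 3) :
    Set.EqOn (dXX ℓ i (dXX ℓ j f)) (dXX ℓ j (dXX ℓ i f)) (slab ℓ) :=
  (dirD_congr _ (dirD_dXX hℓ (hf.of_le (by norm_num)) _ _)).trans
    (dirD_dXX hℓ (hf.dirD hℓ (by norm_num) _) _ _)

theorem dirD_add (hℓ : ∀ i, 0 < ℓ i) (hf : ContDiffOn ℝ 1 f (slab ℓ))
    (hg : ContDiffOn ℝ 1 g (slab ℓ)) (e : (Fin 3 → ℝ) × ℝ) {z} (hz : z ∈ slab ℓ) :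
    dirD ℓ e (fun z => f z + g z) z = dirD ℓ e f z + dirD ℓ e g z := by
  have := fderivWithin_fun_add (uniqueDiffOn_slab hℓ z hz)
    (hf.differentiableOn (by norm_num) z hz) (hg.differentiableOn (by norm_num) z hz)
  rw [dirD, this]; rfl

theorem dirD_sum (hℓ : ∀ i, 0 < ℓ i) {ι : Type*} (s : Finset ι)
    {F : ι → (Fin 3 → ℝ) × ℝ → ℝ} (hF : ∀ i, ContDiffOn ℝ 1 (F i) (slab ℓ))
    (e : (Fin 3 → ℝ) × ℝ) {z} (hz : z ∈ slab ℓ) :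
    dirD ℓ e (fun z => ∑ i ∈ s, F i z) z = ∑ i ∈ s, dirD ℓ e (F i) z := by
  have := fderivWithin_fun_sum (u := s) (uniqueDiffOn_slab hℓ z hz)
    fun i _ => (hF i).differentiableOn (by norm_num) z hz
  rw [dirD, this]; simp [dirD]

theorem dirD_const_mul (hℓ : ∀ i, 0 < ℓ i) (hf : ContDiffOn ℝ 1 f (slab ℓ)) (c : ℝ)
    (e : (Fin 3 → ℝ) × ℝ) {z} (hz : z ∈ slab ℓ) :
    dirD ℓ e (fun z => c * f z) z = c * dirD ℓ e f z := by
  have := ((hf.differentiableOn (by norm_num) z hz).hasFDerivWithinAt.const_mul c).fderivWithin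
    (uniqueDiffOn_slab hℓ z hz)
  rw [dirD, this]; simp [dirD]

theorem dirD_pow (hℓ : ∀ i, 0 < ℓ i) (hf : ContDiffOn ℝ 1 f (slab ℓ)) (n : ℕ)
    (e : (Fin 3 → ℝ) × ℝ) {z} (hz : z ∈ slab ℓ) :
    dirD ℓ e (fun z => f z ^ n) z = n * f z ^ (n - 1) * dirD ℓ e f z := by
  have := (HasFDerivWithinAt.pow (hf.differentiableOn (by norm_num) z hz).hasFDerivWithinAt n).fderivWithin
    (uniqueDiffOn_slab hℓ z hz)
  rw [dirD, this]; simp [dirD]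

theorem hasDerivWithinAt_dX (hf : ContDiffOn ℝ 1 f (slab ℓ)) (i : Fin 3)
    {p : Fin 3 → ℝ} (hp : p ∈ box ℓ) {t : ℝ} (ht : 0 ≤ t) :
    HasDerivWithinAt (fun s => f (Function.update p i s, t)) (dX ℓ i f (p, t))
      (Set.Icc 0 (ℓ i)) (p i) := by
  have h1 : HasDerivWithinAt (fun s => (Function.update p i s, t)) (Pi.single i (1 : ℝ), (0 : ℝ))
      (Set.Icc 0 (ℓ i)) (p i) :=
    ((hasDerivAt_update p i (p i)).prodMk (hasDerivAt_const _ _)).hasDerivWithinAt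
  have h2 : HasFDerivWithinAt f (fderivWithin ℝ f (slab ℓ) (p, t)) (slab ℓ)
      (Function.update p i (p i), t) := by
    rw [Function.update_eq_self]
    exact (hf.differentiableOn (by norm_num) _ (mk_mem_slab hp ht)).hasFDerivWithinAt
  exact h2.comp_hasDerivWithinAt (p i) h1 fun s hs => mk_mem_slab (update_mem_box hp hs) ht

theorem hasDerivWithinAt_dT (hf : ContDiffOn ℝ 1 f (slab ℓ))
    {p : Fin 3 → ℝ} (hp : p ∈ box ℓ) {t : ℝ} (ht : 0 ≤ t) :
    HasDerivWithinAt (fun s => f (p, s)) (dT ℓ f (p, t)) (Set.Ici 0) t := by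
  have h1 : HasDerivWithinAt (fun s : ℝ => (p, s)) ((0 : Fin 3 → ℝ), (1 : ℝ)) (Set.Ici 0) t :=
    ((hasDerivAt_const _ _).prodMk (hasDerivAt_id t)).hasDerivWithinAt
  have h2 : HasFDerivWithinAt f (fderivWithin ℝ f (slab ℓ) (p, t)) (slab ℓ) (p, t) :=
    (hf.differentiableOn (by norm_num) _ (mk_mem_slab hp ht)).hasFDerivWithinAt
  exact h2.comp_hasDerivWithinAt t h1 fun s hs => ⟨hp, hs⟩

theorem partialDeriv_congr {v w : (Fin 3 → ℝ) → ℝ} (i : Fin 3)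
    (h : ∀ p ∈ box ℓ, v p = w p) {p : Fin 3 → ℝ} (hp : p ∈ box ℓ) :
    partialDeriv ℓ i v p = partialDeriv ℓ i w p :=
  derivWithin_congr (fun _ hs => h _ (update_mem_box hp hs))
    (h _ (update_mem_box hp (mem_box.1 hp i)))

theorem partialDeriv_eq (hℓ : ∀ i, 0 < ℓ i) (hf : ContDiffOn ℝ 1 f (slab ℓ)) (i : Fin 3)
    {p : Fin 3 → ℝ} (hp : p ∈ box ℓ) {t : ℝ} (ht : 0 ≤ t) :
    partialDeriv ℓ i (fun q => f (q, t)) p = dX ℓ i f (p, t) :=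
  (hasDerivWithinAt_dX hf i hp ht).derivWithin
    (uniqueDiffOn_Icc (hℓ i) _ (mem_box.1 hp i))

theorem partialDeriv_partialDeriv_eq (hℓ : ∀ i, 0 < ℓ i) (hf : ContDiffOn ℝ 2 f (slab ℓ))
    (i : Fin 3) {p : Fin 3 → ℝ} (hp : p ∈ box ℓ) {t : ℝ} (ht : 0 ≤ t) :
    partialDeriv ℓ i (partialDeriv ℓ i (fun q => f (q, t))) p = dXX ℓ i f (p, t) := by
  rw [partialDeriv_congr i (fun q hq => partialDeriv_eq hℓ (hf.of_le (by norm_num)) i hq ht) hp]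
  exact partialDeriv_eq hℓ (hf.dirD hℓ (by norm_num) _) i hp ht

theorem lap_eq (hℓ : ∀ i, 0 < ℓ i) (hf : ContDiffOn ℝ 2 f (slab ℓ))
    {p : Fin 3 → ℝ} (hp : p ∈ box ℓ) {t : ℝ} (ht : 0 ≤ t) :
    lap ℓ (fun q => f (q, t)) p = ∑ i, dXX ℓ i f (p, t) :=
  Finset.sum_congr rfl fun i _ => partialDeriv_partialDeriv_eq hℓ hf i hp ht

theorem lap_congr {v w : (Fin 3 → ℝ) → ℝ} (h : ∀ p ∈ box ℓ, v p = w p) {p : Fin 3 → ℝ}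
    (hp : p ∈ box ℓ) : lap ℓ v p = lap ℓ w p :=
  Finset.sum_congr rfl fun i _ =>
    partialDeriv_congr i (fun _ hq => partialDeriv_congr i h hq) hp

theorem contDiffOn_sum_dXX (hℓ : ∀ i, 0 < ℓ i) {n m : WithTop ℕ∞}
    (hf : ContDiffOn ℝ n f (slab ℓ)) (hmn : m + 2 ≤ n) :
    ContDiffOn ℝ m (fun z => ∑ i, dXX ℓ i f z) (slab ℓ) :=
  ContDiffOn.sum fun i _ => hf.dXX hℓ hmn i

theorem lap_lap_eq (hℓ : ∀ i, 0 < ℓ i) (hf : ContDiffOn ℝ 4 f (slab ℓ))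
    {p : Fin 3 → ℝ} (hp : p ∈ box ℓ) {t : ℝ} (ht : 0 ≤ t) :
    lap ℓ (lap ℓ (fun q => f (q, t))) p = ∑ i, ∑ j, dXX ℓ i (dXX ℓ j f) (p, t) := by
  rw [lap_congr (fun q hq => lap_eq hℓ (hf.of_le (by norm_num)) hq ht) hp]
  rw [lap_eq hℓ (f := fun z => ∑ i, dXX ℓ i f z) (contDiffOn_sum_dXX hℓ hf (by norm_num)) hp ht]
  refine Finset.sum_congr rfl fun i _ => ?_
  have h1 : Set.EqOn (dX ℓ i (fun z => ∑ i, dXX ℓ i f z)) (fun z => ∑ j, dX ℓ i (dXX ℓ j f) z)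
      (slab ℓ) := fun z hz => dirD_sum hℓ _ (fun j => hf.dXX hℓ (by norm_num) j) _ hz
  rw [dXX, dX, dirD_congr _ h1 (mk_mem_slab hp ht)]
  exact dirD_sum hℓ _ (fun j => ((hf.dXX (m := 2) hℓ (by norm_num) j).dirD hℓ (by norm_num) _)) _
    (mk_mem_slab hp ht)

/-- `f` vanishes on the two faces orthogonal to the `i`-th axis. -/
def VanishOnFace (ℓ : Fin 3 → ℝ) (i : Fin 3) (f : (Fin 3 → ℝ) × ℝ → ℝ) : Prop :=
  ∀ z ∈ slab ℓ, z.1 i = 0 ∨ z.1 i = ℓ i → f z = 0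

theorem VanishOnFace.congr {i : Fin 3} (hg : VanishOnFace ℓ i g) (h : Set.EqOn f g (slab ℓ)) :
    VanishOnFace ℓ i f := fun z hz hzi => (h hz).trans (hg z hz hzi)

theorem VanishOnFace.dX (hℓ : ∀ i, 0 < ℓ i) {i j : Fin 3} (hij : i ≠ j)
    (hf : ContDiffOn ℝ 1 f (slab ℓ)) (h : VanishOnFace ℓ i f) :
    VanishOnFace ℓ i (dX ℓ j f) := by
  rintro ⟨p, t⟩ ⟨hp, ht⟩ hpi
  have h1 := hasDerivWithinAt_dX hf j hp ht
  have h2 : HasDerivWithinAt (fun s => f (Function.update p j s, t)) 0 (Set.Icc 0 (ℓ j)) (p j) := by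
    refine (hasDerivWithinAt_const _ _ (0 : ℝ)).congr (fun s hs => ?_) ?_
    · exact h _ ⟨update_mem_box hp hs, ht⟩ (by simpa [hij] using hpi)
    · rw [Function.update_eq_self]; exact h _ ⟨hp, ht⟩ hpi
  exact (uniqueDiffOn_Icc (hℓ j) _ (mem_box.1 hp j)).eq_deriv _ h1 h2

theorem VanishOnFace.dT {i : Fin 3} (hf : ContDiffOn ℝ 1 f (slab ℓ)) (h : VanishOnFace ℓ i f) :
    VanishOnFace ℓ i (dT ℓ f) := by
  rintro ⟨p, t⟩ ⟨hp, ht⟩ hpi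
  have h1 := hasDerivWithinAt_dT hf hp ht
  have h2 : HasDerivWithinAt (fun s => f (p, s)) 0 (Set.Ici 0) t :=
    (hasDerivWithinAt_const _ _ (0 : ℝ)).congr (fun s hs => h _ ⟨hp, hs⟩ hpi) (h _ ⟨hp, ht⟩ hpi)
  exact (uniqueDiffOn_Ici 0 _ ht).eq_deriv _ h1 h2

theorem VanishOnFace.dXX (hℓ : ∀ i, 0 < ℓ i) {i j : Fin 3} (hij : i ≠ j)
    (hf : ContDiffOn ℝ 2 f (slab ℓ)) (h : VanishOnFace ℓ i f) :
    VanishOnFace ℓ i (dXX ℓ j f) :=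
  (h.dX hℓ hij (hf.of_le (by norm_num))).dX hℓ hij (hf.dirD hℓ (by norm_num) _)

/-- Neumann conditions for `f`: the normal derivatives of `f` vanish on all faces. -/
def Neumann (ℓ : Fin 3 → ℝ) (f : (Fin 3 → ℝ) × ℝ → ℝ) : Prop :=
  ∀ i, VanishOnFace ℓ i (dX ℓ i f)

/-- For `j ≠ i`, the derivative `∂ᵢ∂ⱼ²f = ∂ⱼ²∂ᵢf` is a tangential derivative of a function that
vanishes on the face. Removing these terms from `∂ᵢΔf = 0` leaves the pure third normal derivative.
-/
theorem neumann_of_neumannBC (hℓ : ∀ i, 0 < ℓ i) (hf : ContDiffOn ℝ 4 f (slab ℓ))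
    (h : ∀ t, 0 ≤ t → NeumannBC ℓ (fun q => f (q, t))) :
    Neumann ℓ f ∧ ∀ j, Neumann ℓ (dXX ℓ j f) := by
  have h1 : Neumann ℓ f := by
    rintro i ⟨p, t⟩ ⟨hp, ht⟩ hpi
    rw [← partialDeriv_eq hℓ (hf.of_le (by norm_num)) i hp ht]
    exact (h t ht i p hp hpi).1
  refine ⟨h1, fun j i => ?_⟩
  have hoff : ∀ j, i ≠ j → VanishOnFace ℓ i (dX ℓ i (dXX ℓ j f)) := fun j hij =>
    ((h1 i).dXX hℓ hij (hf.dirD hℓ (by norm_num) _)).congr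
      (dirD_dXX hℓ (hf.of_le (by norm_num)) _ _)
  rcases eq_or_ne i j with rfl | hij
  · rintro ⟨p, t⟩ ⟨hp, ht⟩ hpi
    change p ∈ box ℓ at hp
    change 0 ≤ t at ht
    have h2 := (h t ht i p hp hpi).2
    rw [partialDeriv_congr i (fun q hq => lap_eq hℓ (hf.of_le (by norm_num)) hq ht) hp,
      partialDeriv_eq (f := fun z => ∑ i, dXX ℓ i f z) hℓ
        (contDiffOn_sum_dXX hℓ hf (by norm_num)) i hp ht,
      dX, dirD_sum hℓ _ (fun j => hf.dXX hℓ (by norm_num) j) _ (mk_mem_slab hp ht),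
      Finset.sum_eq_single i (fun j _ hj => hoff j (Ne.symm hj) _ (mk_mem_slab hp ht) hpi)
        (by simp)] at h2
    exact h2
  · exact hoff j hij

/-- The boundary conditions do not mention the fifth normal derivative. Differentiating the equation
in the normal direction kills the time derivative, the cubic, the linear term and the Laplacian on
the face, and all mixed fourth-order terms vanish by tangential differentiation. What is left is `ε
∂ᵢ⁵u = 0`. -/
theorem neumann_fourth_of_isSolution (hℓ : ∀ i, 0 < ℓ i) {ε η : ℝ} (hε : 0 < ε)
    {u : (Fin 3 → ℝ) → ℝ → ℝ}
    (hu : ContDiffOn ℝ 6 (fun q : (Fin 3 → ℝ) × ℝ => u q.1 q.2) (slab ℓ))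
    (hsol : IsSolution ℓ ε η u) (j l : Fin 3) :
    Neumann ℓ (dXX ℓ j (dXX ℓ l (fun q : (Fin 3 → ℝ) × ℝ => u q.1 q.2))) := by
  set f : (Fin 3 → ℝ) × ℝ → ℝ := fun q => u q.1 q.2 with hf
  obtain ⟨n1, n3⟩ := neumann_of_neumannBC hℓ (hu.of_le (by norm_num)) hsol.bc
  have hoff2 : ∀ i j l, i ≠ j → VanishOnFace ℓ i (dX ℓ i (dXX ℓ j (dXX ℓ l f))) :=
    fun i j l hij =>
    ((n3 l i).dXX hℓ hij ((hu.dXX (m := 4) hℓ (by norm_num) l).dirD hℓ (by norm_num) _)).congr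
      (dirD_dXX hℓ (hu.dXX hℓ (by norm_num) l) _ _)
  have hoff : ∀ i j l, ¬ (j = i ∧ l = i) → VanishOnFace ℓ i (dX ℓ i (dXX ℓ j (dXX ℓ l f))) := by
    intro i j l hjl
    by_cases hj : i = j
    · have hl : i ≠ l := fun h => hjl ⟨hj.symm, h.symm⟩
      exact (hoff2 i l j hl).congr (dirD_congr _ (dXX_comm hℓ (hu.of_le (by norm_num)) j l))
    · exact hoff2 i j l hj
  intro i
  by_cases hjl : j = i ∧ l = i
  · rw [hjl.1, hjl.2]
    have hpde : Set.EqOn (dT ℓ f) (fun z => -1 * (f z ^ 3 + ((1 - η) * f z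
        + (ε * (∑ i, ∑ j, dXX ℓ i (dXX ℓ j f) z) + 2 * ∑ i, dXX ℓ i f z)))) (slab ℓ) := by
      rintro ⟨p, t⟩ ⟨hp, ht⟩
      have h1 := hsol.pde p hp t ht
      have h2 := (hasDerivWithinAt_dT (f := f) (hu.of_le (by norm_num)) hp ht).derivWithin
        (uniqueDiffOn_Ici 0 _ ht)
      have h3 := lap_lap_eq hℓ (f := f) (hu.of_le (by norm_num)) hp ht
      have h4 := lap_eq hℓ (f := f) (hu.of_le (by norm_num)) hp ht
      simp only [hf] at h2 h3 h4 ⊢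
      rw [← h2, h1, h3, h4]; ring
    have hT : VanishOnFace ℓ i (dX ℓ i (dT ℓ f)) :=
      ((n1 i).dT (hu.dirD hℓ (by norm_num) _)).congr (dirD_comm hℓ (hu.of_le (by norm_num)) _ _)
    intro z hz hzi
    have c0 : ContDiffOn ℝ 1 f (slab ℓ) := hu.of_le (by norm_num)
    have c2 : ∀ i, ContDiffOn ℝ 1 (dXX ℓ i f) (slab ℓ) := fun i => hu.dXX hℓ (by norm_num) i
    have c4 : ∀ i j, ContDiffOn ℝ 1 (dXX ℓ i (dXX ℓ j f)) (slab ℓ) := fun i j =>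
      (hu.dXX (m := 3) hℓ (by norm_num) j).dXX hℓ (by norm_num) i
    have c4' : ∀ i, ContDiffOn ℝ 1 (fun z => ∑ j, dXX ℓ i (dXX ℓ j f) z) (slab ℓ) := fun i =>
      ContDiffOn.sum fun j _ => c4 i j
    have c4'' : ContDiffOn ℝ 1 (fun z => ∑ i, ∑ j, dXX ℓ i (dXX ℓ j f) z) (slab ℓ) :=
      ContDiffOn.sum fun i _ => c4' i
    have c2' : ContDiffOn ℝ 1 (fun z => ∑ i, dXX ℓ i f z) (slab ℓ) :=
      ContDiffOn.sum fun i _ => c2 i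
    have h1 := hT z hz hzi
    have k0 : dirD ℓ (Pi.single i 1, 0) f z = 0 := n1 i z hz hzi
    have k2 : ∑ j, dirD ℓ (Pi.single i 1, 0) (dXX ℓ j f) z = 0 := Finset.sum_eq_zero fun j _ => n3 j i z hz hzi
    have k4 : ∑ a, ∑ b, dirD ℓ (Pi.single i 1, 0) (dXX ℓ a (dXX ℓ b f)) z
        = dX ℓ i (dXX ℓ i (dXX ℓ i f)) z := by
      rw [Finset.sum_eq_single i, Finset.sum_eq_single i]
      · intro b _ hb; exact hoff i i b (fun h => hb h.2) z hz hzi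
      · simp
      · intro a _ ha
        exact Finset.sum_eq_zero fun b _ => hoff i a b (fun h => ha h.1) z hz hzi
      · simp
    rw [dX, dirD_congr _ hpde hz,
      dirD_const_mul hℓ ((c0.pow 3).add ((contDiffOn_const.mul c0).add
        ((contDiffOn_const.mul c4'').add (contDiffOn_const.mul c2')))) _ _ hz,
      dirD_add hℓ (c0.pow 3) ((contDiffOn_const.mul c0).add
        ((contDiffOn_const.mul c4'').add (contDiffOn_const.mul c2'))) _ hz,
      dirD_add hℓ (contDiffOn_const.mul c0)
        ((contDiffOn_const.mul c4'').add (contDiffOn_const.mul c2')) _ hz,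
      dirD_add hℓ (contDiffOn_const.mul c4'') (contDiffOn_const.mul c2') _ hz,
      dirD_pow hℓ c0 3 _ hz, dirD_const_mul hℓ c0 _ _ hz, dirD_const_mul hℓ c4'' _ _ hz,
      dirD_const_mul hℓ c2' _ _ hz, dirD_sum hℓ _ c2 _ hz, dirD_sum hℓ _ c4' _ hz,
      Finset.sum_congr rfl (fun a _ => dirD_sum hℓ _ (c4 a) _ hz), k0, k2, k4] at h1
    have h5 : ε * dX ℓ i (dXX ℓ i (dXX ℓ i f)) z = 0 := by linarith
    exact (mul_eq_zero.1 h5).resolve_left hε.ne'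
  · exact hoff i j l hjl

/-- Along a line parallel to the `i`-th axis the other coordinates are merely folded into the box,
so the one-dimensional statement `hasDerivAt_comp_tri` applies line by line. -/
theorem secDeriv_extension (hℓ : ∀ i, 0 < ℓ i) (hf : ContDiffOn ℝ 2 f (slab ℓ)) {i : Fin 3}
    (hn : VanishOnFace ℓ i (dX ℓ i f)) {t : ℝ} (ht : 0 ≤ t) :
    SecDeriv i (fun x => f (refl ℓ x, t)) (fun x => dXX ℓ i f (refl ℓ x, t)) := by
  intro x
  have hp := refl_mem hℓ x
  have hder : ∀ {g : (Fin 3 → ℝ) × ℝ → ℝ}, ContDiffOn ℝ 1 g (slab ℓ) → ∀ s ∈ Set.Icc 0 (ℓ i),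
      HasDerivWithinAt (fun s => g (Function.update (refl ℓ x) i s, t))
        (dX ℓ i g (Function.update (refl ℓ x) i s, t)) (Set.Icc 0 (ℓ i)) s := by
    intro g hg s hs
    have := hasDerivWithinAt_dX hg i (update_mem_box hp hs) ht
    simpa using this
  have hcont : ContinuousOn (fun s => dXX ℓ i f (Function.update (refl ℓ x) i s, t))
      (Set.Icc 0 (ℓ i)) := by
    refine (hf.dXX (m := 0) hℓ (by norm_num) i).continuousOn.comp (t := slab ℓ) ?_ ?_
    · fun_prop
    · exact fun s hs => ⟨update_mem_box hp hs, ht⟩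
  obtain ⟨G₁, hG⟩ := hasDerivAt_comp_tri (hℓ i) (hder (hf.of_le (by norm_num)))
    (hder (hf.dirD hℓ (by norm_num) _)) hcont
    (hn _ ⟨update_mem_box hp (Set.left_mem_Icc.2 (hℓ i).le), ht⟩ (by simp))
    (hn _ ⟨update_mem_box hp (Set.right_mem_Icc.2 (hℓ i).le), ht⟩ (by simp))
  have e : ∀ s : ℝ, refl ℓ (x + Pi.single i s)
      = Function.update (refl ℓ x) i (tri (ℓ i) (x i + s)) := by
    intro s; ext m; by_cases hm : m = i
    · subst hm; simp [refl]
    · simp [refl, hm]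
  refine ⟨fun s => G₁ (x i + s), fun s => ⟨?_, ?_⟩⟩
  · simp only [e]
    exact (hG (x i + s)).1.comp_const_add (x i) s
  · simp only [e]
    exact (hG (x i + s)).2.comp_const_add (x i) s

theorem exists_bound_slab {F : (Fin 3 → ℝ) × ℝ → ℝ} (hF : ContinuousOn F (slab ℓ)) (T : ℝ) :
    ∃ B : ℝ, ∀ p ∈ box ℓ, ∀ t ∈ Set.Icc 0 T, |F (p, t)| ≤ B := by
  have hc : IsCompact (box ℓ ×ˢ Set.Icc (0 : ℝ) T) := isCompact_Icc.prod isCompact_Icc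
  obtain ⟨B, hB⟩ := hc.exists_bound_of_continuousOn
    (hF.mono (Set.prod_mono_right Set.Icc_subset_Ici_self))
  exact ⟨B, fun p hp t ht => hB (p, t) ⟨hp, ht⟩⟩

theorem exists_bound_slab_fintype {ι : Type*} [Fintype ι] {F : ι → (Fin 3 → ℝ) × ℝ → ℝ}
    (hF : ∀ i, ContinuousOn (F i) (slab ℓ)) (T : ℝ) :
    ∃ B : ℝ, ∀ i, ∀ p ∈ box ℓ, ∀ t ∈ Set.Icc 0 T, |F i (p, t)| ≤ B := by
  obtain ⟨B, hB⟩ := exists_bound_slab (F := fun z => ∑ i, |F i z|)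
    (continuousOn_finsetSum _ fun i _ => (hF i).abs) T
  refine ⟨B, fun i p hp t ht => le_trans ?_ ((le_abs_self _).trans (hB p hp t ht))⟩
  exact Finset.single_le_sum (f := fun i => |F i (p, t)|) (fun _ _ => abs_nonneg _)
    (Finset.mem_univ i)

theorem exists_dLap_sample_consistent (hℓ : ∀ i, 0 < ℓ i) (hf : ContDiffOn ℝ 4 f (slab ℓ))
    (h1 : Neumann ℓ f) (h2 : ∀ j, Neumann ℓ (dXX ℓ j f)) (T : ℝ) :
    ∃ B : ℝ, ∀ h : Fin 3 → ℝ, (∀ i, 0 < h i) → ∀ t ∈ Set.Icc 0 T, ∀ k,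
      |dLap h (sample ℓ h (fun p => f (p, t))) k - ∑ i, dXX ℓ i f (refl ℓ (gridPt h k), t)|
        ≤ B * ∑ i, h i ^ 2 := by
  obtain ⟨B, hB⟩ := exists_bound_slab_fintype (F := fun i => dXX ℓ i (dXX ℓ i f))
    (fun i => ((hf.dXX (m := 2) hℓ (by norm_num) i).dXX (m := 0) hℓ (by norm_num) i).continuousOn) T
  refine ⟨2 * B, fun h hh t ht k => ?_⟩
  exact abs_dLap_sub_le hh (F := fun x => f (refl ℓ x, t))
    (F₂ := fun i x => dXX ℓ i f (refl ℓ x, t))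
    (F₄ := fun i x => dXX ℓ i (dXX ℓ i f) (refl ℓ x, t))
    (fun i => secDeriv_extension hℓ (hf.of_le (by norm_num)) (h1 i) ht.1)
    (fun i => secDeriv_extension hℓ (hf.dXX hℓ (by norm_num) i) (h2 i i) ht.1)
    (fun i x => hB i _ (refl_mem hℓ x) t ht) k

theorem exists_dLap_dLap_sample_consistent (hℓ : ∀ i, 0 < ℓ i) (hf : ContDiffOn ℝ 6 f (slab ℓ))
    (h1 : Neumann ℓ f) (h2 : ∀ j, Neumann ℓ (dXX ℓ j f))
    (h3 : ∀ j l, Neumann ℓ (dXX ℓ j (dXX ℓ l f))) (T : ℝ) :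
    ∃ B : ℝ, ∀ h : Fin 3 → ℝ, (∀ i, 0 < h i) → ∀ t ∈ Set.Icc 0 T, ∀ k,
      |dLap h (dLap h (sample ℓ h (fun p => f (p, t)))) k
        - ∑ i, ∑ j, dXX ℓ i (dXX ℓ j f) (refl ℓ (gridPt h k), t)| ≤ B * ∑ i, h i ^ 2 := by
  obtain ⟨B, hB⟩ := exists_bound_slab_fintype
    (F := fun i : Fin 3 × Fin 3 × Fin 3 => dXX ℓ i.1 (dXX ℓ i.2.1 (dXX ℓ i.2.2 f)))
    (fun i => (((hf.dXX (m := 4) hℓ (by norm_num) _).dXX (m := 2) hℓ (by norm_num) _).dXX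
      (m := 0) hℓ (by norm_num) _).continuousOn) T
  refine ⟨18 * B, fun h hh t ht k => ?_⟩
  exact abs_dLap_dLap_sub_le hh (F := fun x => f (refl ℓ x, t))
    (F₂ := fun i x => dXX ℓ i f (refl ℓ x, t))
    (F₄ := fun i j x => dXX ℓ i (dXX ℓ j f) (refl ℓ x, t))
    (F₆ := fun i j l x => dXX ℓ i (dXX ℓ j (dXX ℓ l f)) (refl ℓ x, t))
    (fun i => secDeriv_extension hℓ (hf.of_le (by norm_num)) (h1 i) ht.1)
    (fun i j => secDeriv_extension hℓ (hf.dXX hℓ (by norm_num) j) (h2 j i) ht.1)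
    (fun i j l => secDeriv_extension hℓ
      ((hf.dXX (m := 4) hℓ (by norm_num) l).dXX hℓ (by norm_num) j) (h3 j l i) ht.1)
    (fun i j => funext fun x => dXX_comm hℓ (hf.of_le (by norm_num)) i j ⟨refl_mem hℓ x, ht.1⟩)
    (fun i j l x => hB (i, j, l) _ (refl_mem hℓ x) t ht) k

end Slab

/-! ### Riemann sums over the grids -/

theorem setIntegral_box_eq {ℓ : Fin 3 → ℝ} (hℓ : ∀ i, 0 < ℓ i) {Φ : (Fin 3 → ℝ) → ℝ}
    (hΦ : Continuous Φ) :
    ∫ p in box ℓ, Φ p = boxVolume ℓ * ∫ x in Set.Icc (0 : Fin 3 → ℝ) 1, Φ (fun i => ℓ i * x i) := by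
  have hdet : (Matrix.diagonal ℓ).det = boxVolume ℓ := Matrix.det_diagonal
  have hvol := boxVolume_pos hℓ
  have hlin : ∀ x, Matrix.toLin' (Matrix.diagonal ℓ) x = fun i => ℓ i * x i := fun x => by
    ext i; simp [Matrix.toLin'_apply, Matrix.mulVec_diagonal]
  have hcont : Continuous (Matrix.toLin' (Matrix.diagonal ℓ)) :=
    LinearMap.continuous_on_pi _
  have hpre : (Matrix.toLin' (Matrix.diagonal ℓ)) ⁻¹' box ℓ = Set.Icc (0 : Fin 3 → ℝ) 1 := by
    ext x
    simp only [Set.mem_preimage, hlin, mem_box, Set.mem_Icc, Pi.le_def, Pi.zero_apply,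
      Pi.one_apply]
    constructor
    · intro h
      exact ⟨fun i => nonneg_of_mul_nonneg_right (h i).1 (hℓ i),
        fun i => by nlinarith [(h i).2, hℓ i]⟩
    · intro h i
      exact ⟨mul_nonneg (hℓ i).le (h.1 i), by nlinarith [h.2 i, hℓ i]⟩
  have h1 := Real.smul_map_diagonal_volume_pi (D := ℓ) (by rw [hdet]; exact hvol.ne')
  rw [hdet, abs_of_pos hvol] at h1
  conv_lhs => rw [← h1]
  rw [MeasureTheory.Measure.restrict_smul, MeasureTheory.integral_smul_measure,
    MeasureTheory.setIntegral_map (s := box ℓ) measurableSet_Icc hΦ.aestronglyMeasurable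
      hcont.measurable.aemeasurable, hpre, ENNReal.toReal_ofReal hvol.le, smul_eq_mul]
  simp only [hlin]

-- After rescaling to the unit cube, the grid points are the points of the lattice `n⁻¹ ℤ³` in the
-- closed cube. Boundary points have full weight here, which suffices because only an upper bound
-- for the trapezoidal sum is needed.
open scoped Pointwise in
theorem tendsto_riemannSum {ℓ : Fin 3 → ℝ} (hℓ : ∀ i, 0 < ℓ i) {Φ : (Fin 3 → ℝ) → ℝ}
    (hΦ : Continuous Φ) :
    Filter.Tendsto (fun n : ℕ => (∑ k ∈ gridIdx (fun _ => n), Φ (gridPt (mesh ℓ fun _ => n) k)) *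
      ∏ i, mesh ℓ (fun _ => n) i) Filter.atTop (nhds (∫ p in box ℓ, Φ p)) := by
  have h1 := tendsto_tsum_div_pow_atTop_integral (Set.Icc (0 : Fin 3 → ℝ) 1)
    (fun x => Φ (fun i => ℓ i * x i)) (hΦ.comp (by fun_prop)) (Metric.isBounded_Icc _ _)
    measurableSet_Icc ((convex_Icc _ _).addHaar_frontier _)
  rw [setIntegral_box_eq hℓ hΦ]
  refine (h1.const_mul (boxVolume ℓ)).congr' ?_
  filter_upwards [Filter.eventually_gt_atTop 0] with n hn
  have : NeZero n := ⟨hn.ne'⟩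
  have hn' : (0 : ℝ) < n := Nat.cast_pos.2 hn
  have himg : Set.Icc (0 : Fin 3 → ℝ) 1 ∩
      (n : ℝ)⁻¹ • (Submodule.span ℤ (Set.range (Pi.basisFun ℝ (Fin 3))) : Set (Fin 3 → ℝ))
      = (fun (k : Fin 3 → ℤ) i => (k i : ℝ) / n) '' (gridIdx (fun _ => n) : Set (Fin 3 → ℤ)) := by
    ext x
    have hm : x ∈ (n : ℝ)⁻¹ • (Submodule.span ℤ (Set.range (Pi.basisFun ℝ (Fin 3))) :
        Set (Fin 3 → ℝ)) ↔ ∀ i, n * x i ∈ Set.range (algebraMap ℤ ℝ) :=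
      BoxIntegral.unitPartition.mem_smul_span_iff
    rw [Set.mem_inter_iff, hm]
    constructor
    · rintro ⟨hx, hz⟩
      choose k hk using hz
      simp only [algebraMap_int_eq, eq_intCast] at hk
      refine ⟨k, ?_, ?_⟩
      · rw [Finset.mem_coe, mem_gridIdx]
        intro i
        have a := hx.1 i
        have b := hx.2 i
        simp only [Pi.zero_apply, Pi.one_apply] at a b
        have c : (0 : ℝ) ≤ k i := by rw [hk]; positivity
        have d : (k i : ℝ) ≤ n := by rw [hk]; nlinarith
        exact ⟨by exact_mod_cast c, by exact_mod_cast d⟩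
      · ext i
        simp only [hk]; field_simp
    · rintro ⟨k, hk, rfl⟩
      rw [Finset.mem_coe, mem_gridIdx] at hk
      refine ⟨⟨fun i => ?_, fun i => ?_⟩, fun i => ⟨k i, ?_⟩⟩
      · have : (0 : ℝ) ≤ k i := by exact_mod_cast (hk i).1
        simp only [Pi.zero_apply]; positivity
      · have : (k i : ℝ) ≤ n := by exact_mod_cast (hk i).2
        simp only [Pi.one_apply]
        rwa [div_le_one hn']
      · simp only [algebraMap_int_eq, eq_intCast]; field_simp
  have hinj : Function.Injective (fun (k : Fin 3 → ℤ) (i : Fin 3) => (k i : ℝ) / n) := by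
    intro a b hab
    ext i
    have := congrFun hab i
    simp only at this
    rw [div_left_inj' hn'.ne'] at this
    exact_mod_cast this
  rw [himg, tsum_image (fun x : Fin 3 → ℝ => Φ (fun i => ℓ i * x i)) hinj.injOn,
    Finset.tsum_subtype' (gridIdx fun _ => n)
      (fun k => Φ (fun i => ℓ i * ((k i : ℝ) / n)))]
  have e1 : ∏ i, mesh ℓ (fun _ => n) i = boxVolume ℓ / n ^ 3 := by
    simp [mesh, boxVolume, Finset.prod_div_distrib]
  have e2 : ∀ k : Fin 3 → ℤ, gridPt (mesh ℓ fun _ => n) k = fun i => ℓ i * ((k i : ℝ) / n) := by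
    intro k; ext i; simp only [gridPt, mesh]; ring
  rw [e1, Fintype.card_fin]
  simp only [e2]
  ring

theorem gridSum_le_riemannSum {h : Fin 3 → ℝ} (hh : ∀ i, 0 < h i) {N : Fin 3 → ℕ}
    {f : (Fin 3 → ℤ) → ℝ} (hf : ∀ k, 0 ≤ f k) :
    gridSum h N f ≤ (∑ k ∈ gridIdx N, f k) * ∏ i, h i := by
  refine mul_le_mul_of_nonneg_right (Finset.sum_le_sum fun k _ => ?_)
    (Finset.prod_nonneg fun i _ => (hh i).le)
  exact mul_le_of_le_one_left (hf k)
    (Finset.prod_le_one (fun i _ => trapWeight_nonneg _ _) fun i _ => trapWeight_le_one _ _)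

/-! ### The Sobolev inequality on the box -/

theorem exists_gridPt_tendsto {ℓ : Fin 3 → ℝ} (hℓ : ∀ i, 0 < ℓ i) {p : Fin 3 → ℝ}
    (hp : p ∈ box ℓ) : ∃ k : ℕ → Fin 3 → ℤ, (∀ n, k n ∈ gridIdx (fun _ => n)) ∧
      Filter.Tendsto (fun n => gridPt (mesh ℓ fun _ => n) (k n)) Filter.atTop (nhds p) := by
  have h0 : ∀ i, 0 ≤ p i / ℓ i := fun i => div_nonneg (mem_box.1 hp i).1 (hℓ i).le
  refine ⟨fun n i => (⌊p i / ℓ i * n⌋₊ : ℤ), fun n => mem_gridIdx.2 fun i => ⟨by positivity, ?_⟩,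
    tendsto_pi_nhds.2 fun i => ?_⟩
  · have : ⌊p i / ℓ i * n⌋₊ ≤ n := by
      refine Nat.floor_le_of_le ?_
      refine mul_le_of_le_one_left (Nat.cast_nonneg n) ?_
      rw [div_le_one (hℓ i)]; exact (mem_box.1 hp i).2
    exact Int.ofNat_le.2 this
  · have h1 := ((tendsto_nat_floor_mul_div_atTop (h0 i)).comp
      tendsto_natCast_atTop_atTop).mul_const (ℓ i)
    rw [div_mul_cancel₀ _ (hℓ i).ne'] at h1
    refine h1.congr fun n => ?_
    simp only [Function.comp, gridPt, mesh, Int.cast_natCast]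
    ring

theorem continuous_extension {ℓ : Fin 3 → ℝ} (hℓ : ∀ i, 0 < ℓ i) {f : (Fin 3 → ℝ) × ℝ → ℝ}
    (hf : ContinuousOn f (slab ℓ)) {t : ℝ} (ht : 0 ≤ t) :
    Continuous fun x => f (refl ℓ x, t) :=
  hf.comp_continuous ((continuous_refl ℓ).prodMk continuous_const)
    fun x => mk_mem_slab (refl_mem hℓ x) ht

/-- The strong discrete inequality is applied to samples of `v` on grids with `n` cells in each
direction, at grid points converging to `p`. Consistency replaces the discrete Laplacian by the
exact one, Riemann sums converge to the integral, and the constant is unchanged in the limit. -/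
theorem exists_isSobolevConst {ℓ : Fin 3 → ℝ} (hℓ : ∀ i, 0 < ℓ i) :
    ∃ C' : ℝ, IsSobolevConst ℓ C' := by
  obtain ⟨C, hC0, hC⟩ := exists_strong_discreteSobolev hℓ
  refine ⟨C, fun v hv hbc p hp => ?_⟩
  -- Made constant in time, `v` falls under the calculus on the slab; only time `0` is used.
  set f : (Fin 3 → ℝ) × ℝ → ℝ := fun q => v q.1 with hf
  have hfc : ContDiffOn ℝ 4 f (slab ℓ) := hv.comp contDiffOn_fst fun z hz => hz.1
  obtain ⟨n1, n3⟩ := neumann_of_neumannBC hℓ hfc fun _ _ => hbc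
  obtain ⟨B, hB⟩ := exists_dLap_sample_consistent hℓ hfc n1 n3 0
  have h00 : (0 : ℝ) ∈ Set.Icc (0 : ℝ) 0 := by simp
  have hLc : ContinuousOn (fun z => ∑ i, dXX ℓ i f z) (slab ℓ) :=
    (contDiffOn_sum_dXX (m := 2) hℓ hfc (by norm_num)).continuousOn
  obtain ⟨A, hA⟩ := exists_bound_slab hLc 0
  set L : (Fin 3 → ℝ) → ℝ := fun x => ∑ i, dXX ℓ i f (refl ℓ x, 0) with hL
  have hLcont : Continuous L := continuous_extension hℓ hLc le_rfl
  have hVcont : Continuous fun x => v (refl ℓ x) :=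
    continuous_extension (f := f) hℓ hfc.continuousOn le_rfl
  set Φ : (Fin 3 → ℝ) → ℝ := fun x => v (refl ℓ x) ^ 2 + L x ^ 2 with hΦ
  have hΦc : Continuous Φ := (hVcont.pow 2).add (hLcont.pow 2)
  obtain ⟨k, hk, hkp⟩ := exists_gridPt_tendsto hℓ hp
  set δ : ℕ → ℝ := fun n => B * ∑ i, mesh ℓ (fun _ => n) i ^ 2 with hδ
  have hδ0 : Filter.Tendsto δ Filter.atTop (nhds 0) := by
    have h1 : ∀ i, Filter.Tendsto (fun n : ℕ => mesh ℓ (fun _ => n) i ^ 2)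
        Filter.atTop (nhds 0) := by
      intro i
      have := (tendsto_const_div_atTop_nhds_zero_nat (ℓ i)).pow 2
      simpa [mesh] using this
    have := (tendsto_finsetSum Finset.univ fun i _ => h1 i).const_mul B
    simpa using this
  have hmain : ∀ᶠ n : ℕ in Filter.atTop, |v (refl ℓ (gridPt (mesh ℓ fun _ => n) (k n)))|
      ≤ C * √((∑ k ∈ gridIdx (fun _ => n), Φ (gridPt (mesh ℓ fun _ => n) k)) *
        ∏ i, mesh ℓ (fun _ => n) i + (2 * A * δ n + δ n ^ 2) * boxVolume ℓ) := by
    filter_upwards [Filter.eventually_gt_atTop 0] with n hn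
    have hN : ∀ _ : Fin 3, 0 < n := fun _ => hn
    have hh := fun i => mesh_pos (N := fun _ => n) hℓ hN i
    have hs := ((discreteBC_iff hh).1 (sample_discreteBC hℓ hN v)).1
    refine (hC (fun _ => n) hN _ hs (k n) (hk n)).trans ?_
    refine mul_le_mul_of_nonneg_left (Real.sqrt_le_sqrt ?_) hC0
    rw [← gridSum_add]
    have h2 : ∀ m ∈ gridIdx (fun _ => n), sample ℓ (mesh ℓ fun _ => n) v m ^ 2
        + dLap (mesh ℓ fun _ => n) (sample ℓ (mesh ℓ fun _ => n) v) m ^ 2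
        ≤ Φ (gridPt (mesh ℓ fun _ => n) m) + (2 * A * δ n + δ n ^ 2) := by
      intro m _
      have h3 := hB (mesh ℓ fun _ => n) hh 0 h00 m
      have h4 := hA _ (refl_mem hℓ (gridPt (mesh ℓ fun _ => n) m)) 0 h00
      change |dLap (mesh ℓ fun _ => n) (sample ℓ (mesh ℓ fun _ => n) v) m
        - L (gridPt (mesh ℓ fun _ => n) m)| ≤ δ n at h3
      change |L (gridPt (mesh ℓ fun _ => n) m)| ≤ A at h4
      change sample ℓ (mesh ℓ fun _ => n) v m ^ 2 + _ ≤ sample ℓ (mesh ℓ fun _ => n) v m ^ 2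
        + L (gridPt (mesh ℓ fun _ => n) m) ^ 2 + _
      generalize dLap (mesh ℓ fun _ => n) (sample ℓ (mesh ℓ fun _ => n) v) m = a at *
      generalize L (gridPt (mesh ℓ fun _ => n) m) = b at *
      have h5 : |a| ≤ A + δ n := by
        have := abs_add_le (a - b) b
        rw [sub_add_cancel] at this
        linarith
      have h6 : (a - b) * (a + b) ≤ δ n * (2 * A + δ n) := by
        refine (le_abs_self _).trans ?_
        rw [abs_mul]
        exact mul_le_mul h3 ((abs_add_le a b).trans (by linarith)) (abs_nonneg _)
          ((abs_nonneg _).trans h3)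
      nlinarith
    refine (gridSum_mono hh h2).trans ?_
    rw [gridSum_add, gridSum_const hN]
    gcongr
    exact gridSum_le_riemannSum hh fun m => by positivity
  have hlim : Filter.Tendsto (fun n : ℕ => C * √((∑ k ∈ gridIdx (fun _ => n),
      Φ (gridPt (mesh ℓ fun _ => n) k)) * ∏ i, mesh ℓ (fun _ => n) i
        + (2 * A * δ n + δ n ^ 2) * boxVolume ℓ)) Filter.atTop
      (nhds (C * √(∫ q in box ℓ, Φ q))) := by
    have h1 := ((hδ0.const_mul (2 * A)).add (hδ0.pow 2)).mul_const (boxVolume ℓ)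
    have h2 := (tendsto_riemannSum hℓ hΦc).add h1
    simp only [mul_zero, ne_eq, OfNat.ofNat_ne_zero, not_false_eq_true, zero_pow, add_zero,
      zero_mul] at h2
    exact ((Real.continuous_sqrt.tendsto _).comp h2).const_mul C
  have hlim' : Filter.Tendsto (fun n : ℕ => |v (refl ℓ (gridPt (mesh ℓ fun _ => n) (k n)))|)
      Filter.atTop (nhds |v p|) := by
    have := (hVcont.abs.tendsto p).comp hkp
    simpa only [Function.comp_def, refl_of_mem hℓ hp] using this
  refine (le_of_tendsto_of_tendsto hlim' hlim hmain).trans ?_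
  refine mul_le_mul_of_nonneg_left (Real.sqrt_le_sqrt ?_) hC0
  have hcomp : IsCompact (box ℓ) := isCompact_Icc
  have hmeas : MeasurableSet (box ℓ) := measurableSet_Icc
  have hgrad : ∀ q ∈ box ℓ, gradSq ℓ v q = ∑ i, dX ℓ i f (q, 0) ^ 2 := fun q hq =>
    Finset.sum_congr rfl fun i _ => by
      rw [← partialDeriv_eq hℓ (f := f) (hfc.of_le (by norm_num)) i hq le_rfl]
  have hlap : ∀ q ∈ box ℓ, lap ℓ v q = L q := fun q hq => by
    rw [hL]; simp only
    rw [refl_of_mem hℓ hq]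
    exact lap_eq hℓ (f := f) (hfc.of_le (by norm_num)) hq le_rfl
  have hgc : ContinuousOn (fun q => ∑ i, dX ℓ i f (q, 0) ^ 2) (box ℓ) := by
    refine continuousOn_finsetSum _ fun i _ => ContinuousOn.pow ?_ 2
    exact (hfc.dirD (m := 3) hℓ (by norm_num) _).continuousOn.comp
      (continuous_id.prodMk continuous_const).continuousOn fun q hq => mk_mem_slab hq le_rfl
  have hint : MeasureTheory.IntegrableOn (fun q => v q ^ 2 + gradSq ℓ v q + lap ℓ v q ^ 2)
      (box ℓ) := by
    refine MeasureTheory.IntegrableOn.congr_fun (f := fun q => v q ^ 2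
      + (∑ i, dX ℓ i f (q, 0) ^ 2) + L q ^ 2) ?_ (fun q hq => ?_) hmeas
    · exact (((hv.continuousOn.pow 2).add hgc).add (hLcont.pow 2).continuousOn).integrableOn_compact
        hcomp
    · simp only [hgrad q hq, hlap q hq]
  refine MeasureTheory.setIntegral_mono_on (hΦc.continuousOn.integrableOn_compact hcomp) hint hmeas
    fun q hq => ?_
  have : 0 ≤ gradSq ℓ v q := Finset.sum_nonneg fun i _ => sq_nonneg _
  simp only [hΦ, hlap q hq, refl_of_mem hℓ hq]
  linarith

/-! ### Consistency of the scheme -/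

theorem exists_time_lipschitz {ℓ : Fin 3 → ℝ} (hℓ : ∀ i, 0 < ℓ i) {g : (Fin 3 → ℝ) × ℝ → ℝ}
    (hg : ContDiffOn ℝ 1 g (slab ℓ)) (T : ℝ) :
    ∃ B : ℝ, 0 ≤ B ∧ ∀ p ∈ box ℓ, ∀ t ∈ Set.Icc 0 T, ∀ s ∈ Set.Icc 0 T,
      |g (p, s) - g (p, t)| ≤ B * |s - t| := by
  obtain ⟨B, hB⟩ := exists_bound_slab (hg.dirD (m := 0) hℓ (by norm_num) (0, 1)).continuousOn T
  refine ⟨max B 0, le_max_right _ _, fun p hp t ht s hs => ?_⟩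
  exact (convex_Icc 0 T).norm_image_sub_le_of_norm_hasDerivWithin_le (f := fun s => g (p, s))
    (fun r hr => (hasDerivWithinAt_dT hg hp hr.1).mono Set.Icc_subset_Ici_self)
    (fun r hr => (hB p hp r hr).trans (le_max_left _ _)) ht hs

theorem exists_time_taylor {ℓ : Fin 3 → ℝ} (hℓ : ∀ i, 0 < ℓ i) {g : (Fin 3 → ℝ) × ℝ → ℝ}
    (hg : ContDiffOn ℝ 2 g (slab ℓ)) (T : ℝ) :
    ∃ B : ℝ, 0 ≤ B ∧ ∀ p ∈ box ℓ, ∀ t ∈ Set.Icc 0 T, ∀ τ, 0 ≤ τ → t + τ ≤ T →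
      |g (p, t + τ) - g (p, t) - τ * dT ℓ g (p, t)| ≤ B * τ ^ 2 := by
  obtain ⟨B, hB0, hB⟩ := exists_time_lipschitz hℓ (hg.dirD (m := 1) hℓ (by norm_num) (0, 1)) T
  refine ⟨B, hB0, fun p hp t ht τ hτ htτ => ?_⟩
  have h := (convex_Icc t (t + τ)).norm_image_sub_le_of_norm_hasDerivWithin_le
    (f := fun s => g (p, s) - s * dT ℓ g (p, t)) (f' := fun s => dT ℓ g (p, s) - dT ℓ g (p, t))
    (C := B * τ) (x := t) (y := t + τ)
    (fun r hr => by
      have h1 := (hasDerivWithinAt_dT (hg.of_le (by norm_num)) hp (ht.1.trans hr.1)).mono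
        (Set.Icc_subset_Ici_self.trans (Set.Ici_subset_Ici.2 ht.1) : Set.Icc t (t + τ) ⊆ Set.Ici 0)
      have h2 := (hasDerivAt_mul_const (x := r) (dT ℓ g (p, t))).hasDerivWithinAt
        (s := Set.Icc t (t + τ))
      exact h1.sub h2)
    (fun r hr => by
      refine (hB p hp t ht r ⟨ht.1.trans hr.1, hr.2.trans htτ⟩).trans ?_
      rw [abs_of_nonneg (by linarith [hr.1])]
      exact mul_le_mul_of_nonneg_left (by linarith [hr.2]) hB0)
    (Set.left_mem_Icc.2 (by linarith)) (Set.right_mem_Icc.2 (by linarith))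
  rw [Real.norm_eq_abs, Real.norm_eq_abs, add_sub_cancel_left, abs_of_nonneg hτ] at h
  calc _ = |g (p, t + τ) - (t + τ) * dT ℓ g (p, t) - (g (p, t) - t * dT ℓ g (p, t))| := by
        congr 1; ring
    _ ≤ _ := h
    _ = _ := by ring

/-- The right-hand side of the scheme, for the grid functions `f` (old) and `g` (new). -/
noncomputable def schemeRHS (h : Fin 3 → ℝ) (ε η : ℝ) (f g : (Fin 3 → ℤ) → ℝ)
    (k : Fin 3 → ℤ) : ℝ :=
  if η < 1 then
    -(f k ^ 3 + ((1 - η) * g k + ε * dLap h (dLap h g) k) + 2 * dLap h f k)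
  else
    -(f k ^ 3 + ε * dLap h (dLap h g) k - ((η - 1) * f k - 2 * dLap h f k))

/-- The equation is used at the old time, while the bilaplacian, and for `η < 1` the linear term,
are evaluated at the new one. The shift costs `O(τ)`, by Lipschitz continuity in time of `u` and of
its fourth space derivatives. -/
theorem exists_scheme_consistent {ℓ : Fin 3 → ℝ} (hℓ : ∀ i, 0 < ℓ i) {ε η : ℝ} (hε : 0 < ε)
    {u : (Fin 3 → ℝ) → ℝ → ℝ}
    (hu : ContDiffOn ℝ 6 (fun q : (Fin 3 → ℝ) × ℝ => u q.1 q.2) (slab ℓ))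
    (hsol : IsSolution ℓ ε η u) (T : ℝ) :
    ∃ B : ℝ, 0 ≤ B ∧ ∀ N : Fin 3 → ℕ, (∀ i, 0 < N i) → ∀ t, 0 ≤ t → ∀ τ, 0 < τ → t + τ ≤ T →
      ∀ k ∈ gridIdx N,
        |(sample ℓ (mesh ℓ N) (fun p => u p (t + τ)) k - sample ℓ (mesh ℓ N) (fun p => u p t) k) / τ
          - schemeRHS (mesh ℓ N) ε η (sample ℓ (mesh ℓ N) (fun p => u p t))
            (sample ℓ (mesh ℓ N) (fun p => u p (t + τ))) k| ≤ B * (τ + ∑ i, mesh ℓ N i ^ 2) := by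
  set f : (Fin 3 → ℝ) × ℝ → ℝ := fun q => u q.1 q.2 with hf
  obtain ⟨n1, n3⟩ := neumann_of_neumannBC hℓ (hu.of_le (by norm_num)) hsol.bc
  have n5 := neumann_fourth_of_isSolution hℓ hε hu hsol
  obtain ⟨B₁, hB₁0, hB₁⟩ := exists_time_taylor hℓ (hu.of_le (by norm_num)) T
  obtain ⟨B₂, hB₂0, hB₂⟩ := exists_time_lipschitz hℓ (hu.of_le (by norm_num)) T
  have hQ : ContDiffOn ℝ 1 (fun z => ∑ i, ∑ j, dXX ℓ i (dXX ℓ j f) z) (slab ℓ) :=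
    ContDiffOn.sum fun i _ => ContDiffOn.sum fun j _ =>
      (hu.dXX (m := 4) hℓ (by norm_num) j).dXX hℓ (by norm_num) i
  obtain ⟨B₃, hB₃0, hB₃⟩ := exists_time_lipschitz hℓ hQ T
  obtain ⟨B₄, hB₄⟩ := exists_dLap_sample_consistent hℓ (hu.of_le (by norm_num)) n1 n3 T
  obtain ⟨B₅, hB₅⟩ := exists_dLap_dLap_sample_consistent hℓ hu n1 n3 n5 T
  refine ⟨B₁ + |1 - η| * B₂ + ε * B₃ + 2 * |B₄| + ε * |B₅|, by positivity,
    fun N hN t ht τ hτ htT k hk => ?_⟩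
  have hh := fun i => mesh_pos hℓ hN i
  set p := gridPt (mesh ℓ N) k with hp
  have hpb : p ∈ box ℓ := gridPt_mem_box hℓ hN hk
  have htm : t ∈ Set.Icc 0 T := ⟨ht, by linarith⟩
  have htm' : t + τ ∈ Set.Icc 0 T := ⟨by linarith, htT⟩
  set s := ∑ i, mesh ℓ N i ^ 2 with hs
  have hs0 : 0 ≤ s := Finset.sum_nonneg fun i _ => sq_nonneg _
  have c1 := hB₁ p hpb t htm τ hτ.le htT
  have c2 := hB₂ p hpb t htm _ htm'
  have c3 := hB₃ p hpb t htm _ htm'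
  have c4 := hB₄ _ hh t htm k
  have c5 := hB₅ _ hh _ htm' k
  rw [refl_of_mem hℓ hpb] at c4 c5
  rw [add_sub_cancel_left, abs_of_pos hτ] at c2 c3
  have hpde := hsol.pde p hpb t ht
  rw [show derivWithin (fun s => u p s) (Set.Ici 0) t = dT ℓ f (p, t) from
    (hasDerivWithinAt_dT (f := f) (hu.of_le (by norm_num)) hpb ht).derivWithin
      (uniqueDiffOn_Ici 0 _ ht),
    show lap ℓ (lap ℓ fun q => u q t) p = _ from
      lap_lap_eq (f := f) hℓ (hu.of_le (by norm_num)) hpb ht,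
    show lap ℓ (fun q => u q t) p = _ from lap_eq (f := f) hℓ (hu.of_le (by norm_num)) hpb ht]
    at hpde
  rw [schemeRHS, sample_of_mem hℓ hN _ hk, sample_of_mem hℓ hN _ hk, ← hp]
  change |u p (t + τ) - u p t - τ * dT ℓ f (p, t)| ≤ B₁ * τ ^ 2 at c1
  change |u p (t + τ) - u p t| ≤ B₂ * τ at c2
  change |dLap (mesh ℓ N) (sample ℓ (mesh ℓ N) fun p => u p t) k - _| ≤ _ at c4
  change |dLap (mesh ℓ N) (dLap (mesh ℓ N) (sample ℓ (mesh ℓ N) fun p => u p (t + τ))) k - _|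
    ≤ _ at c5
  generalize dLap (mesh ℓ N) (sample ℓ (mesh ℓ N) fun p => u p t) k = a at *
  generalize dLap (mesh ℓ N) (dLap (mesh ℓ N) (sample ℓ (mesh ℓ N) fun p => u p (t + τ))) k = b
    at *
  generalize ∑ i, ∑ j, dXX ℓ i (dXX ℓ j f) (p, t) = q at *
  generalize ∑ i, ∑ j, dXX ℓ i (dXX ℓ j f) (p, t + τ) = q' at *
  generalize ∑ i, dXX ℓ i f (p, t) = r at *
  generalize dT ℓ f (p, t) = w at *
  generalize u p t = x at *
  generalize u p (t + τ) = y at *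
  have d1 : |(y - x) / τ - w| ≤ B₁ * τ := by
    have : (y - x) / τ - w = (y - x - τ * w) / τ := by field_simp
    rw [this, abs_div, abs_of_pos hτ, div_le_iff₀ hτ]
    linarith
  have d2 : |(1 - η) * (y - x)| ≤ |1 - η| * (B₂ * τ) := by
    rw [abs_mul]; gcongr
  have d4 : |a - r| ≤ |B₄| * s := c4.trans (mul_le_mul_of_nonneg_right (le_abs_self _) hs0)
  have d5 : |b - q'| ≤ |B₅| * s := c5.trans (mul_le_mul_of_nonneg_right (le_abs_self _) hs0)
  have d3 : |ε * (b - q' + (q' - q))| ≤ ε * (|B₅| * s + B₃ * τ) := by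
    rw [abs_mul, abs_of_pos hε]
    exact mul_le_mul_of_nonneg_left ((abs_add_le _ _).trans (by linarith)) hε.le
  have d2' : 0 ≤ |1 - η| * (B₂ * τ) := by positivity
  have e1 := abs_le.1 d1
  have e2 := abs_le.1 d2
  have e3 := abs_le.1 d3
  have e4 := abs_le.1 d4
  have g1 : 0 ≤ (B₁ + |1 - η| * B₂ + ε * B₃) * s := by positivity
  have g2 : 0 ≤ (2 * |B₄| + ε * |B₅|) * τ := by positivity
  split_ifs with hη
  · exact abs_le.2 ⟨by linarith, by linarith⟩
  · exact abs_le.2 ⟨by linarith, by linarith⟩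

/-! ### The error estimate -/

/-- The error equation is tested with the new error `e'`. Summation by parts moves the explicit
Laplacian from `e` onto `e'`, where the implicit term `ε (dLap e')²` can absorb it; this avoids any
coupling between `τ` and the mesh. -/
theorem error_step {h : Fin 3 → ℝ} (hh : ∀ i, 0 < h i) {N : Fin 3 → ℕ} (hN : ∀ i, 0 < N i)
    {ε τ a L R : ℝ} (hε : 0 < ε) (hτ : 0 < τ) (ha : 0 ≤ a) (hL : 0 ≤ L)
    {e e' g : (Fin 3 → ℤ) → ℝ} (he : Reflects N e) (he' : Reflects N e')
    (hde' : Reflects N (dLap h e')) (hg : ∀ k ∈ gridIdx N, |g k| ≤ L * |e k| + R)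
    (hstep : ∀ k ∈ gridIdx N, (e' k - e k) / τ
      = -ε * dLap h (dLap h e') k - 2 * dLap h e k - a * e' k + g k) :
    gridSum h N (fun k => e' k ^ 2) - gridSum h N (fun k => e k ^ 2)
      ≤ τ * ((2 / ε + L) * gridSum h N (fun k => e k ^ 2)
        + (L + 1) * gridSum h N (fun k => e' k ^ 2) + gridSum h N (fun _ => R ^ 2)) := by
  have s1 : gridSum h N (fun k => dLap h e' k * dLap h e' k - e' k * dLap h (dLap h e') k) = 0 := by
    rw [gridSum_sub, gridSum_mul_dLap_comm hh hN he' hde', sub_self]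
  have s2 : gridSum h N (fun k => dLap h e' k * e k - e' k * dLap h e k) = 0 := by
    rw [gridSum_sub, gridSum_mul_dLap_comm hh hN he' he, sub_self]
  have hpt : ∀ k ∈ gridIdx N, e' k ^ 2 - e k ^ 2 ≤
      2 * τ * ε * (dLap h e' k * dLap h e' k - e' k * dLap h (dLap h e') k)
        + 4 * τ * (dLap h e' k * e k - e' k * dLap h e k)
        + τ * ((2 / ε + L) * e k ^ 2 + (L + 1) * e' k ^ 2 + R ^ 2) := by
    intro k hk
    have h1 := hstep k hk
    have h2 := hg k hk
    generalize dLap h (dLap h e') k = y at *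
    generalize dLap h e' k = d at *
    generalize dLap h e k = d₀ at *
    generalize e k = x at *
    generalize e' k = x' at *
    generalize g k = w at *
    rw [div_eq_iff hτ.ne'] at h1
    have h3 : w * x' ≤ L / 2 * (x ^ 2 + x' ^ 2) + (R ^ 2 + x' ^ 2) / 2 := by
      have a1 : w * x' ≤ |w| * |x'| := by rw [← abs_mul]; exact le_abs_self _
      have a2 : |w| * |x'| ≤ (L * |x| + R) * |x'| := by gcongr
      have a3 : 0 ≤ L * (|x| - |x'|) ^ 2 := by positivity
      have a4 := sq_nonneg (R - |x'|)
      have b1 := sq_abs x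
      have b2 := sq_abs x'
      nlinarith
    -- Completing the square absorbs the anti-diffusive cross term; its price `x ^ 2 / ε` is the
    -- origin of `2 / ε` in the conclusion.
    have h4 : 0 ≤ ε * d ^ 2 + 2 * d * x + x ^ 2 / ε := by
      have : ε * d ^ 2 + 2 * d * x + x ^ 2 / ε = (ε * d + x) ^ 2 / ε := by field_simp; ring
      rw [this]; positivity
    have h5 : 0 ≤ a * x' ^ 2 := by positivity
    have h6 : x' ^ 2 - x ^ 2 ≤ 2 * ((x' - x) * x') := by nlinarith [sq_nonneg (x' - x)]
    rw [h1] at h6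
    have h7 : 0 ≤ 2 * τ * ((ε * d ^ 2 + 2 * d * x + x ^ 2 / ε) + a * x' ^ 2
        + (L / 2 * (x ^ 2 + x' ^ 2) + (R ^ 2 + x' ^ 2) / 2 - w * x')) :=
      mul_nonneg (by positivity) (by linarith)
    have h8 : 2 / ε * x ^ 2 = 2 * (x ^ 2 / ε) := by ring
    nlinarith
  have hs := gridSum_mono hh hpt
  simp only [gridSum_add, gridSum_sub, gridSum_const_mul] at hs s1 s2 ⊢
  rw [s1, s2] at hs
  linarith

theorem gronwall_step {E E' D τ a b : ℝ} (hτ : 0 < τ) (ha : 0 ≤ a) (hb : 0 ≤ b)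
    (hE : 0 ≤ E) (hD : 0 ≤ D) (haτ : a * τ ≤ 1 / 2) (h : E' - E ≤ τ * (b * E + a * E' + D)) :
    E' ≤ (1 + 2 * (a + b) * τ) * E + 2 * τ * D := by
  have h1 : 0 < 1 - a * τ := by linarith
  refine le_of_mul_le_mul_left ?_ h1
  have h2 : 0 ≤ (1 / 2 - a * τ) * (2 * (a + b) * τ * E) :=
    mul_nonneg (by linarith) (by positivity)
  have h3 : 0 ≤ (1 / 2 - a * τ) * (2 * τ * D) := mul_nonneg (by linarith) (by positivity)
  nlinarith

theorem discrete_gronwall {E : ℕ → ℝ} {D τ c : ℝ} (hτ : 0 < τ) (hc : 0 ≤ c) (hD : 0 ≤ D)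
    (h0 : E 0 ≤ 0) (n : ℕ) (h : ∀ m < n, E (m + 1) ≤ (1 + c * τ) * E m + 2 * τ * D) :
    E n ≤ 2 * (n * τ) * D * Real.exp (c * (n * τ)) := by
  induction n with
  | zero => simpa using h0
  | succ n ih =>
    have h1 := ih fun m hm => h m (by omega)
    have h2 := h n (by omega)
    have h3 : 1 + c * τ ≤ Real.exp (c * τ) := by linarith [Real.add_one_le_exp (c * τ)]
    have h4 : Real.exp (c * ((n + 1 : ℕ) * τ)) = Real.exp (c * τ) * Real.exp (c * (n * τ)) := by
      rw [← Real.exp_add]; congr 1; push_cast; ring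
    have h5 : 1 ≤ Real.exp (c * ((n + 1 : ℕ) * τ)) := Real.one_le_exp (by positivity)
    have h6 : (1 + c * τ) * E n ≤ (1 + c * τ) * (2 * (n * τ) * D * Real.exp (c * (n * τ))) :=
      mul_le_mul_of_nonneg_left h1 (by positivity)
    have h7 : (1 + c * τ) * (2 * (n * τ) * D * Real.exp (c * (n * τ)))
        ≤ Real.exp (c * τ) * (2 * (n * τ) * D * Real.exp (c * (n * τ))) := by gcongr
    have h8 : 2 * τ * D * 1 ≤ 2 * τ * D * Real.exp (c * ((n + 1 : ℕ) * τ)) := by gcongr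
    calc E (n + 1) ≤ Real.exp (c * τ) * (2 * (n * τ) * D * Real.exp (c * (n * τ)))
          + 2 * τ * D * Real.exp (c * ((n + 1 : ℕ) * τ)) := by linarith
      _ = _ := by rw [h4]; push_cast; ring

theorem abs_cube_sub_le {x y M : ℝ} (hx : |x| ≤ M) (hy : |y| ≤ M) :
    |x ^ 3 - y ^ 3| ≤ 3 * M ^ 2 * |x - y| := by
  have hx2 := pow_le_pow_left₀ (abs_nonneg x) hx 2
  have hy2 := pow_le_pow_left₀ (abs_nonneg y) hy 2
  rw [sq_abs] at hx2 hy2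
  rw [show x ^ 3 - y ^ 3 = (x ^ 2 + x * y + y ^ 2) * (x - y) by ring, abs_mul]
  refine mul_le_mul_of_nonneg_right ?_ (abs_nonneg _)
  rw [abs_le]
  constructor <;> nlinarith [sq_nonneg (x + y), sq_nonneg (x - y)]

/-- The quartic and quadratic parts are bounded by the sup norm of `u` at time `0`, the gradient
part is nonpositive, and the Laplacian of the sample is bounded by consistency. Since `U₀` may have
other ghost values than the sample, the two Laplacians still have to be compared. -/
theorem exists_dEnergy_le {ℓ : Fin 3 → ℝ} (hℓ : ∀ i, 0 < ℓ i) {ε η : ℝ} (hε : 0 < ε)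
    {u : (Fin 3 → ℝ) → ℝ → ℝ}
    (hu : ContDiffOn ℝ 6 (fun q : (Fin 3 → ℝ) × ℝ => u q.1 q.2) (slab ℓ))
    (hsol : IsSolution ℓ ε η u) :
    ∃ E : ℝ, ∀ N : Fin 3 → ℕ, (∀ i, 0 < N i) → ∀ U₀ : (Fin 3 → ℤ) → ℝ,
      DiscreteBC (mesh ℓ N) N U₀ → Samples (mesh ℓ N) N U₀ (fun p => u p 0) →
      dEnergy (mesh ℓ N) N ε η U₀ ≤ E := by
  set f : (Fin 3 → ℝ) × ℝ → ℝ := fun q => u q.1 q.2 with hf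
  obtain ⟨n1, n3⟩ := neumann_of_neumannBC hℓ (hu.of_le (by norm_num)) hsol.bc
  have h00 : (0 : ℝ) ∈ Set.Icc (0 : ℝ) 0 := by simp
  obtain ⟨B, hB⟩ := exists_bound_slab hu.continuousOn 0
  obtain ⟨A, hA⟩ := exists_bound_slab
    (contDiffOn_sum_dXX (m := 4) hℓ hu (by norm_num)).continuousOn 0
  obtain ⟨B', hB'⟩ := exists_dLap_sample_consistent hℓ (hu.of_le (by norm_num)) n1 n3 0
  refine ⟨(1 / 4 * B ^ 4 + |1 - η| / 2 * B ^ 2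
    + ε * (A + |B'| * ∑ i, ℓ i ^ 2) ^ 2) * boxVolume ℓ, fun N hN U₀ hbc hsam => ?_⟩
  have hh := fun i => mesh_pos hℓ hN i
  set V := sample ℓ (mesh ℓ N) (fun p => u p 0) with hV
  have hbcV : DiscreteBC (mesh ℓ N) N V := sample_discreteBC hℓ hN _
  rw [discreteBC_iff hh] at hbc hbcV
  have he := hbc.1.sub hbcV.1
  have he' : Reflects N (dLap (mesh ℓ N) fun k => U₀ k - V k) := by
    rw [dLap_sub]; exact hbc.2.sub hbcV.2
  -- Two summations by parts identify this with `⟨U₀ - V, dLap (dLap (U₀ - V))⟩`, and `U₀ - V`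
  -- vanishes on the grid. No ghost value has to be computed.
  have hzero : gridSum (mesh ℓ N) N (fun k => (dLap (mesh ℓ N) U₀ k - dLap (mesh ℓ N) V k) ^ 2)
      = 0 := by
    have h1 := gridSum_mul_dLap_comm hh hN he he'
    have h2 : gridSum (mesh ℓ N) N (fun k => (U₀ k - V k)
        * dLap (mesh ℓ N) (dLap (mesh ℓ N) fun k => U₀ k - V k) k)
        = gridSum (mesh ℓ N) N (fun _ => 0) :=
      gridSum_congr fun k hk => by
        rw [hsam k hk, hV, sample_of_mem hℓ hN _ hk, sub_self, zero_mul]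
    rw [h2, gridSum_const hN, zero_mul, dLap_sub] at h1
    simp only [pow_two]
    exact h1.symm
  have hU : ∀ k ∈ gridIdx N, |U₀ k| ≤ B := fun k hk => by
    rw [hsam k hk]; exact hB _ (gridPt_mem_box hℓ hN hk) 0 h00
  have hmesh : ∑ i, mesh ℓ N i ^ 2 ≤ ∑ i, ℓ i ^ 2 := Finset.sum_le_sum fun i _ =>
    pow_le_pow_left₀ (hh i).le (div_le_self (hℓ i).le (by exact_mod_cast hN i)) 2
  have hdV : ∀ k ∈ gridIdx N, |dLap (mesh ℓ N) V k| ≤ A + |B'| * ∑ i, ℓ i ^ 2 := by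
    intro k hk
    have a1 := hB' _ hh 0 h00 k
    have a2 := hA _ (refl_mem hℓ (gridPt (mesh ℓ N) k)) 0 h00
    change |dLap (mesh ℓ N) V k - _| ≤ _ at a1
    have a3 : B' * ∑ i, mesh ℓ N i ^ 2 ≤ |B'| * ∑ i, ℓ i ^ 2 :=
      mul_le_mul (le_abs_self _) hmesh (Finset.sum_nonneg fun i _ => sq_nonneg _) (abs_nonneg _)
    generalize ∑ i, dXX ℓ i f (refl ℓ (gridPt (mesh ℓ N) k), 0) = r at *
    have := abs_add_le (dLap (mesh ℓ N) V k - r) r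
    rw [sub_add_cancel] at this
    linarith
  have hpt : ∀ k ∈ gridIdx N, 1 / 4 * U₀ k ^ 4 + (1 - η) / 2 * U₀ k ^ 2
      + ε / 2 * dLap (mesh ℓ N) U₀ k ^ 2
      ≤ ε * (dLap (mesh ℓ N) U₀ k - dLap (mesh ℓ N) V k) ^ 2
        + (1 / 4 * B ^ 4 + |1 - η| / 2 * B ^ 2 + ε * (A + |B'| * ∑ i, ℓ i ^ 2) ^ 2) := by
    intro k hk
    have a1 := pow_le_pow_left₀ (abs_nonneg _) (hU k hk) 2
    have a2 := pow_le_pow_left₀ (abs_nonneg _) (hU k hk) 4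
    have a3 := pow_le_pow_left₀ (abs_nonneg _) (hdV k hk) 2
    rw [sq_abs] at a1 a3
    rw [Even.pow_abs (by decide : Even 4)] at a2
    have a4 : (1 - η) / 2 * U₀ k ^ 2 ≤ |1 - η| / 2 * B ^ 2 := by
      have := le_abs_self (1 - η)
      gcongr
    have a5 : ε * (2 * (dLap (mesh ℓ N) U₀ k - dLap (mesh ℓ N) V k) ^ 2
        + 2 * dLap (mesh ℓ N) V k ^ 2 - dLap (mesh ℓ N) U₀ k ^ 2) ≥ 0 :=
      mul_nonneg hε.le (by
        nlinarith [sq_nonneg (dLap (mesh ℓ N) U₀ k - 2 * dLap (mesh ℓ N) V k)])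
    have a6 := mul_le_mul_of_nonneg_left a3 hε.le
    linarith
  have hs := gridSum_mono hh hpt
  simp only [gridSum_add, gridSum_const_mul, hzero, gridSum_const hN] at hs
  have hg : 0 ≤ gridSum (mesh ℓ N) N (dGradSq (mesh ℓ N) U₀) :=
    gridSum_nonneg hh fun k _ => dGradSq_nonneg _ _ k
  rw [dEnergy]
  simp only [gridSum_const_mul]
  linarith

theorem energyBound_mono {ℓ : Fin 3 → ℝ} {ε η ζ : ℝ} (hc : 0 < coercConst ε η ζ) (C : ℝ)
    {E E' : ℝ} (h : E ≤ E') : energyBound ℓ ε η ζ C E ≤ energyBound ℓ ε η ζ C E' := by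
  unfold energyBound
  gcongr

theorem exists_constM_le {ℓ : Fin 3 → ℝ} (hℓ : ∀ i, 0 < ℓ i) {ε η ζ : ℝ} (hε : 0 < ε)
    (hζ : 1 / ε + η - 1 < ζ) (C : ℝ) {u : (Fin 3 → ℝ) → ℝ → ℝ}
    (hu : ContDiffOn ℝ 6 (fun q : (Fin 3 → ℝ) × ℝ => u q.1 q.2) (slab ℓ))
    (hsol : IsSolution ℓ ε η u) :
    ∃ M : ℝ, ∀ N : Fin 3 → ℕ, (∀ i, 0 < N i) → ∀ U₀ : (Fin 3 → ℤ) → ℝ,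
      DiscreteBC (mesh ℓ N) N U₀ → Samples (mesh ℓ N) N U₀ (fun p => u p 0) →
      constM ℓ N ε η ζ C U₀ ≤ M := by
  obtain ⟨E, hE⟩ := exists_dEnergy_le hℓ hε hu hsol
  exact ⟨max (√(max 0 ζ)) (energyBound ℓ ε η ζ C E), fun N hN U₀ hbc hsam =>
    max_le_max le_rfl (energyBound_mono (coercConst_pos hε hζ) C (hE N hN U₀ hbc hsam))⟩

theorem exists_stepRestriction {ℓ : Fin 3 → ℝ} (hℓ : ∀ i, 0 < ℓ i) {ε η ζ : ℝ} (hε : 0 < ε)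
    (hζ : 1 / ε + η - 1 < ζ) (C C' : ℝ) {u : (Fin 3 → ℝ) → ℝ → ℝ}
    (hu : ContDiffOn ℝ 6 (fun q : (Fin 3 → ℝ) × ℝ => u q.1 q.2) (slab ℓ))
    (hsol : IsSolution ℓ ε η u) :
    ∃ τ₀ : ℝ, 0 < τ₀ ∧ ∀ N : Fin 3 → ℕ, (∀ i, 0 < N i) →
      ∀ U₀ : (Fin 3 → ℤ) → ℝ, DiscreteBC (mesh ℓ N) N U₀ →
        Samples (mesh ℓ N) N U₀ (fun p => u p 0) →
        constLhat η (constM' ℓ N ε η ζ C C' U₀ (fun p => u p 0)) ≠ 0 →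
        ∀ τ : ℝ, 0 < τ → τ ≤ τ₀ →
          StepRestriction η (constM ℓ N ε η ζ C U₀)
            (constLhat η (constM' ℓ N ε η ζ C C' U₀ (fun p => u p 0))) τ := by
  obtain ⟨M, hM⟩ := exists_constM_le hℓ hε hζ C hu hsol
  set M' := max M (energyBound ℓ ε η ζ C' (energy ℓ ε η fun p => u p 0)) with hM'
  -- Both upper limits have the form `2 / (3 * m ^ 2 - |1 - η|)` with `m ≤ M'`; the added `1` keeps
  -- the threshold meaningful when `M' = 0`.
  refine ⟨1 / (3 * M' ^ 2 + 1), by positivity, fun N hN U₀ hbc hsam hL τ hτ hτ₀ => ?_⟩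
  have key : ∀ m : ℝ, 0 ≤ m → m ≤ M' → 0 < 3 * m ^ 2 - |1 - η| →
      τ < 2 / (3 * m ^ 2 - |1 - η|) := by
    intro m hm hmM hpos
    have h1 := pow_le_pow_left₀ hm hmM 2
    refine lt_of_le_of_lt hτ₀ ?_
    rw [div_lt_div_iff₀ (by positivity) hpos]
    nlinarith [abs_nonneg (1 - η), sq_nonneg M']
  have h1 := constM_nonneg ℓ N ε η ζ C U₀
  have h2 : constM ℓ N ε η ζ C U₀ ≤ M := hM N hN U₀ hbc hsam
  constructor
  · rcases le_or_gt (3 * constM ℓ N ε η ζ C U₀ ^ 2) |1 - η| with h | h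
    · exact Or.inl h
    · exact Or.inr ⟨h, (key _ h1 (h2.trans (le_max_left _ _)) (by linarith)).le⟩
  · rcases lt_or_gt_of_ne hL with h | h
    · exact Or.inl h
    · exact Or.inr ⟨h, key _ (le_max_of_le_left h1) (max_le_max h2 le_rfl) h⟩

theorem exists_error_bound {ℓ : Fin 3 → ℝ} (hℓ : ∀ i, 0 < ℓ i) {C ε η ζ : ℝ}
    (hC : IsDiscreteSobolevConst ℓ C) (hε : 0 < ε) (hζ : 1 / ε + η - 1 < ζ)
    {u : (Fin 3 → ℝ) → ℝ → ℝ}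
    (hu : ContDiffOn ℝ 6 (fun q : (Fin 3 → ℝ) × ℝ => u q.1 q.2) (slab ℓ))
    (hsol : IsSolution ℓ ε η u) {T : ℝ} (hT : 0 < T) :
    ∃ K : ℝ, ∀ N : Fin 3 → ℕ, (∀ i, 0 < N i) →
      ∀ τ : ℝ, 0 < τ → ∀ U : ℕ → (Fin 3 → ℤ) → ℝ,
        IsSchemeSolution (mesh ℓ N) N ε η τ U →
        Samples (mesh ℓ N) N (U 0) (fun p => u p 0) →
        (3 * constM ℓ N ε η ζ C (U 0) ^ 2 ≤ |1 - η| ∨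
          (|1 - η| < 3 * constM ℓ N ε η ζ C (U 0) ^ 2 ∧
            τ ≤ 2 / (3 * constM ℓ N ε η ζ C (U 0) ^ 2 - |1 - η|))) →
        ∀ n : ℕ, n * τ ≤ T →
          dNorm (mesh ℓ N) N (fun k => U n k - u (gridPt (mesh ℓ N) k) (n * τ)) ≤
            K * (τ + ∑ i, mesh ℓ N i ^ 2) := by
  obtain ⟨M₀, hM₀⟩ := exists_constM_le hℓ hε hζ C hu hsol
  obtain ⟨B₀, hB₀⟩ := exists_bound_slab hu.continuousOn T
  obtain ⟨B, hB0, hB⟩ := exists_scheme_consistent hℓ hε hu hsol T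
  set M := max (max M₀ B₀) 0 with hM
  have hM0 : 0 ≤ M := le_max_right _ _
  set L := 3 * M ^ 2 + |1 - η| with hL
  have hL0 : 0 ≤ L := by positivity
  set c := 2 * ((L + 1) + (2 / ε + L)) with hc
  have hc0 : 0 ≤ c := by positivity
  have hvol := boxVolume_pos hℓ
  refine ⟨max (√(2 * T * boxVolume ℓ * Real.exp (c * T)) * B)
    (2 * M * √(boxVolume ℓ) * (2 * (L + 1))), fun N hN τ hτ U hU hsam hr n hn => ?_⟩
  have hh := fun i => mesh_pos hℓ hN i
  have hstab := scheme_le_constM hℓ hN hC hε hζ hτ hU hr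
  set s := ∑ i, mesh ℓ N i ^ 2 with hs
  have hs0 : 0 ≤ s := Finset.sum_nonneg fun i _ => sq_nonneg _
  set V : ℕ → (Fin 3 → ℤ) → ℝ := fun n => sample ℓ (mesh ℓ N) (fun p => u p (n * τ)) with hV
  set e : ℕ → (Fin 3 → ℤ) → ℝ := fun n k => U n k - V n k with he
  have hUM : ∀ n, ∀ k ∈ gridIdx N, |U n k| ≤ M := fun n k hk =>
    ((hstab n).1 k hk).trans ((hM₀ N hN _ (hU.bc 0) hsam).trans
      ((le_max_left _ _).trans (le_max_left _ _)))
  have hVM : ∀ m : ℕ, m * τ ≤ T → ∀ k ∈ gridIdx N, |V m k| ≤ M := fun m hm k hk =>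
    (hB₀ _ (refl_mem hℓ _) _ ⟨by positivity, hm⟩).trans
      ((le_max_right _ _).trans (le_max_left _ _))
  have hbU := fun n => (discreteBC_iff hh).1 (hU.bc n)
  have hbV : ∀ n, Reflects N (V n) ∧ Reflects N (dLap (mesh ℓ N) (V n)) := fun n =>
    (discreteBC_iff hh).1 (sample_discreteBC hℓ hN _)
  have hnorm : dNorm (mesh ℓ N) N (fun k => U n k - u (gridPt (mesh ℓ N) k) (n * τ))
      = √(gridSum (mesh ℓ N) N (fun k => e n k ^ 2)) := by
    rw [dNorm]
    congr 1
    refine gridSum_congr fun k hk => ?_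
    simp only [he, hV]
    rw [sample_of_mem hℓ hN _ hk]
  rw [hnorm]
  have hR0 : 0 ≤ τ + s := by positivity
  -- For small steps the implicit term is absorbed and Gronwall applies. For large steps the error
  -- is at most `2 * M * √(boxVolume ℓ)` by the sup bounds, and `1 ≤ 2 * (L + 1) * τ` already makes
  -- this `O(τ)`. The two entries of the maximum defining `K` belong to these two cases.
  rcases le_or_gt ((L + 1) * τ) (1 / 2) with hτ' | hτ'
  · have hE : ∀ m < n, gridSum (mesh ℓ N) N (fun k => e (m + 1) k ^ 2)
        ≤ (1 + c * τ) * gridSum (mesh ℓ N) N (fun k => e m k ^ 2)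
          + 2 * τ * ((B * (τ + s)) ^ 2 * boxVolume ℓ) := by
      intro m hm
      have hm1 : (m : ℝ) * τ + τ ≤ T := by
        have : ((m + 1 : ℕ) : ℝ) ≤ n := by exact_mod_cast hm
        have := mul_le_mul_of_nonneg_right this hτ.le
        push_cast at this
        linarith
      have hcons := hB N hN (m * τ) (by positivity) τ hτ hm1
      have hV1 : sample ℓ (mesh ℓ N) (fun p => u p (m * τ + τ)) = V (m + 1) := by
        simp only [hV]; congr 1; ext p; congr 1; push_cast; ring
      rw [hV1] at hcons
      have hdl : ∀ m, dLap (mesh ℓ N) (e m)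
          = fun k => dLap (mesh ℓ N) (U m) k - dLap (mesh ℓ N) (V m) k := fun m =>
        dLap_sub _ _ _
      -- The function `g` is defined as whatever makes the error equation an identity, so all the
      -- content lies in its bound. The linear term sits in `a` when it is implicit and in `g`
      -- otherwise, which is why `L` contains `|1 - η|`.
      have hstep := error_step hh hN (a := max (1 - η) 0) (L := L) (R := B * (τ + s)) (τ := τ)
        (e := e m) (e' := e (m + 1))
        (g := fun k => (e (m + 1) k - e m k) / τ
          + ε * dLap (mesh ℓ N) (dLap (mesh ℓ N) (e (m + 1))) k
          + 2 * dLap (mesh ℓ N) (e m) k + max (1 - η) 0 * e (m + 1) k)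
        hε hτ (le_max_right _ _) hL0
        ((hbU m).1.sub (hbV m).1) ((hbU (m + 1)).1.sub (hbV (m + 1)).1)
        (by rw [hdl]; exact (hbU (m + 1)).2.sub (hbV (m + 1)).2)
        (fun k hk => by
          have r1 := abs_le.1 (hcons k hk)
          have r2 := hU.step m k hk
          have r3 := abs_le.1 (abs_cube_sub_le (hUM m k hk) (hVM m (by linarith) k hk))
          have r4 := abs_le.1 (abs_mul (1 - η) (e m k)).le
          have r5 : (e (m + 1) k - e m k) / τ
              = (U (m + 1) k - U m k) / τ - (V (m + 1) k - V m k) / τ := by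
            simp only [he]; ring
          have r6 : 0 ≤ |1 - η| * |e m k| := by positivity
          have r7 : sample ℓ (mesh ℓ N) (fun p => u p (m * τ)) = V m := rfl
          have r8 : |U m k - V m k| = |e m k| := rfl
          have r9 : e m k = U m k - V m k := rfl
          have r10 : e (m + 1) k = U (m + 1) k - V (m + 1) k := rfl
          rw [r7, schemeRHS] at r1
          rw [r8] at r3
          rw [r5, r2, hdl, hdl, dLap_sub, hL]
          split_ifs at r1 ⊢ with hη
          · rw [max_eq_left (by linarith), r10]
            exact abs_le.2 ⟨by linarith, by linarith⟩
          · rw [max_eq_right (by linarith), zero_mul]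
            rw [r9] at r4
            rw [r9] at r3 r6
            rw [r9]
            exact abs_le.2 ⟨by linarith, by linarith⟩)
        (fun k _ => by ring)
      rw [gridSum_const hN] at hstep
      have hEm : 0 ≤ gridSum (mesh ℓ N) N (fun k => e m k ^ 2) :=
        gridSum_nonneg hh fun k _ => sq_nonneg _
      exact gronwall_step hτ (by positivity) (by positivity) hEm (by positivity) hτ' hstep
    have hE0 : gridSum (mesh ℓ N) N (fun k => e 0 k ^ 2) ≤ 0 := by
      have : gridSum (mesh ℓ N) N (fun k => e 0 k ^ 2) = gridSum (mesh ℓ N) N (fun _ => 0) :=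
        gridSum_congr fun k hk => by
          simp only [he, hV]
          rw [sample_of_mem hℓ hN _ hk, hsam k hk]
          simp
      rw [this, gridSum_const hN, zero_mul]
    have hg := discrete_gronwall (E := fun n => gridSum (mesh ℓ N) N (fun k => e n k ^ 2))
      (D := (B * (τ + s)) ^ 2 * boxVolume ℓ) hτ hc0 (by positivity) hE0 n hE
    have h1 : gridSum (mesh ℓ N) N (fun k => e n k ^ 2)
        ≤ (2 * T * boxVolume ℓ * Real.exp (c * T)) * (B * (τ + s)) ^ 2 := by
      refine hg.trans ?_
      calc 2 * (n * τ) * ((B * (τ + s)) ^ 2 * boxVolume ℓ) * Real.exp (c * (n * τ))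
          ≤ 2 * T * ((B * (τ + s)) ^ 2 * boxVolume ℓ) * Real.exp (c * T) := by gcongr
        _ = _ := by ring
    calc √(gridSum (mesh ℓ N) N (fun k => e n k ^ 2))
        ≤ √((2 * T * boxVolume ℓ * Real.exp (c * T)) * (B * (τ + s)) ^ 2) := Real.sqrt_le_sqrt h1
      _ = √(2 * T * boxVolume ℓ * Real.exp (c * T)) * B * (τ + s) := by
          rw [Real.sqrt_mul (by positivity), Real.sqrt_sq (by positivity)]; ring
      _ ≤ _ := mul_le_mul_of_nonneg_right (le_max_left _ _) hR0
  · have h1 : gridSum (mesh ℓ N) N (fun k => e n k ^ 2) ≤ (2 * M) ^ 2 * boxVolume ℓ := by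
      rw [← gridSum_const hN]
      refine gridSum_mono hh fun k hk => ?_
      rw [← sq_abs (e n k)]
      refine pow_le_pow_left₀ (abs_nonneg _) ?_ 2
      have a1 := abs_sub (U n k) (V n k)
      have a2 := hUM n k hk
      have a3 := hVM n hn k hk
      simp only [he]
      linarith
    calc √(gridSum (mesh ℓ N) N (fun k => e n k ^ 2))
        ≤ √((2 * M) ^ 2 * boxVolume ℓ) := Real.sqrt_le_sqrt h1
      _ = 2 * M * √(boxVolume ℓ) * 1 := by
          rw [Real.sqrt_mul (by positivity), Real.sqrt_sq (by positivity), mul_one]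
      _ ≤ 2 * M * √(boxVolume ℓ) * (2 * (L + 1) * (τ + s)) := by
          refine mul_le_mul_of_nonneg_left ?_ (by positivity)
          nlinarith
      _ = 2 * M * √(boxVolume ℓ) * (2 * (L + 1)) * (τ + s) := by ring
      _ ≤ _ := mul_le_mul_of_nonneg_right (le_max_right _ _) hR0

end SwiftHohenberg

theorem mainTheorem2 (ℓ : Fin 3 → ℝ) (hℓ : ∀ i, 0 < ℓ i) :
    -- Sobolev constants for the box exist, and everything below holds for any choice of them
    (∃ C : ℝ, IsDiscreteSobolevConst ℓ C) ∧ (∃ C' : ℝ, IsSobolevConst ℓ C') ∧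
    ∀ C C' : ℝ, IsDiscreteSobolevConst ℓ C → IsSobolevConst ℓ C' →
    ∀ ε η ζ : ℝ, 0 < ε → 1 / ε + η - 1 < ζ →
    ∀ u : (Fin 3 → ℝ) → ℝ → ℝ,
      ContDiffOn ℝ 6 (fun q : (Fin 3 → ℝ) × ℝ => u q.1 q.2) (box ℓ ×ˢ Set.Ici 0) →
      IsSolution ℓ ε η u →
      -- a mesh-independent bound on the time step suffices for the restriction
      (∃ τ₀ : ℝ, 0 < τ₀ ∧ ∀ N : Fin 3 → ℕ, (∀ i, 0 < N i) →
        ∀ U₀ : (Fin 3 → ℤ) → ℝ, DiscreteBC (mesh ℓ N) N U₀ →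
          Samples (mesh ℓ N) N U₀ (fun p => u p 0) →
          constLhat η (constM' ℓ N ε η ζ C C' U₀ (fun p => u p 0)) ≠ 0 →
          ∀ τ : ℝ, 0 < τ → τ ≤ τ₀ →
            StepRestriction η (constM ℓ N ε η ζ C U₀)
              (constLhat η (constM' ℓ N ε η ζ C C' U₀ (fun p => u p 0))) τ) ∧
      -- the error estimate, with a constant independent of the mesh and of the time step
      ∀ T : ℝ, 0 < T → ∃ K : ℝ, ∀ N : Fin 3 → ℕ, (∀ i, 0 < N i) →
        ∀ τ : ℝ, 0 < τ → ∀ U : ℕ → (Fin 3 → ℤ) → ℝ,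
          IsSchemeSolution (mesh ℓ N) N ε η τ U →
          Samples (mesh ℓ N) N (U 0) (fun p => u p 0) →
          constLhat η (constM' ℓ N ε η ζ C C' (U 0) (fun p => u p 0)) ≠ 0 →
          StepRestriction η (constM ℓ N ε η ζ C (U 0))
            (constLhat η (constM' ℓ N ε η ζ C C' (U 0) (fun p => u p 0))) τ →
          ∀ n : ℕ, n * τ ≤ T →
            dNorm (mesh ℓ N) N (fun k => U n k - u (gridPt (mesh ℓ N) k) (n * τ)) ≤
              K * (τ + ∑ i, mesh ℓ N i ^ 2) := by
  refine ⟨exists_isDiscreteSobolevConst hℓ, exists_isSobolevConst hℓ,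
    fun C C' hC _ ε η ζ hε hζ u hu hsol =>
      ⟨exists_stepRestriction hℓ hε hζ C C' hu hsol, fun T hT => ?_⟩⟩
  obtain ⟨K, hK⟩ := exists_error_bound hℓ hC hε hζ hu hsol hT
  exact ⟨K, fun N hN τ hτ U hU hsam _ hr => hK N hN τ hτ U hU hsam hr.1⟩
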